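/- Notation. Write $\langle x\rangle=(1+|x|^2)^{1/2}$. Let $\hat f(\xi)=\int_{\mathbb R} e^{-ix\xi}f(x)\,dx$ and $\hat w(\xi,\tau)=\iint_{\mathbb R^2} e^{-ix\xi-it\tau}w(t,x)\,dx\,dt$ denote the spatial and space-time Fourier transforms (extended to $L^2$), and put $$\|f\|_{H^s}^2=\int_{\mathbb R}|\hat f(\xi)|^2\langle\xi\rangle^{2s}\,d\xi,\qquad \|u\|_{C^0(I,H^s)}=\sup_{t\in I}\|u(t,\cdot)\|_{H^s},$$ $$\|w\|_{X^{r,b}_\kappa}^2=\iint_{\mathbb R^2}|\hat w(\xi,\tau)|^2\,\langle\tau-\kappa\xi^2\rangle^{2b}\,\langle\xi\rangle^{2r}\,d\xi\,d\tau\in[0,\infty],\qquad \kappa\in\{1,-1\}.$$ For $T>0$ let $\zeta_0,\zeta_1:\mathbb R\to\mathbb R$ be smooth functions supported in $(-2T,2T)$ with $\zeta_0\equiv1$ on $[0,T]$ and $\zeta_1\zeta_0\equiv\zeta_0$, let $\omega\in\{1,-1\}$, and consider the time-cut-off nonlinear Schrödinger equation $$(\mathrm{NLS}^*)\qquad iu_t+u_{xx}+\zeta_0(t)\,\omega|u|^2u=0,\qquad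 u(0,x)=u_0(x).$$ **Proposition.** Let $T_0<\infty$, $s\in(-\tfrac12,0)$, $b>\tfrac12$, $r>-\tfrac14$ and $M<\infty$. There exists $C<\infty$, depending only on $T_0,M,s,r,b$, such that for every $T\in(0,T_0]$, all $\zeta_0,\zeta_1$ as above with $\int_{\mathbb R}|\zeta_0'(t)|\,dt\le M$, every $\omega\in\{1,-1\}$, and every (classical) solution $u\in C^0([-2T,2T],H^{10}(\mathbb R))$ of $(\mathrm{NLS}^*)$ with initial datum $u_0$, the quantities $\|u\|_{C^0([-2T,2T],H^s)}$ and $\|u_0\|_{H^s}$ are finite and $$\Big|\,\|u\|_{C^0([-2T,2T],H^s)}^2-\|u_0\|_{H^s}^2\,\Big|\le C\,\|\zeta_1u\|_{X^{r,b}_\kappa}^4\qquad\text{for both }\kappa=1\text{ and }\kappa=-1.$$ -/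

import Mathlib

open MeasureTheory Set Filter Topology
open scoped ENNReal FourierTransform

noncomputable section

namespace NLS

/-- The bracket `⟨x⟩ = (1 + |x|²)^{1/2}`. -/
def bracket (x : ℝ) : ℝ := Real.sqrt (1 + x ^ 2)

/-- The Fourier transform of a square integrable function, in the normalization
`f̂(ξ) = ∫ e^{-i⟨x, ξ⟩} f(x) dx`, extended to `L²` by Plancherel.
Mathlib's transform `𝓕` on `L²` has the kernel `e^{-2πi⟨x, v⟩}`, so that `f̂(ξ) = (𝓕 f)(ξ / 2π)`.
(As an element of `L²` it is defined up to null sets; it is used only inside integrals.) -/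
def fourierL2 {E : Type*} [NormedAddCommGroup E] [InnerProductSpace ℝ E] [FiniteDimensional ℝ E]
    [MeasurableSpace E] [BorelSpace E] (f : E → ℂ) (hf : MemLp f 2 (volume : Measure E)) :
    E → ℂ :=
  fun ξ => (𝓕 (hf.toLp f) : Lp ℂ 2 (volume : Measure E)) ((2 * Real.pi)⁻¹ • ξ)

open Classical in
/-- The norm `‖f‖_{H^s} = (∫ |f̂(ξ)|² ⟨ξ⟩^{2s} dξ)^{1/2} ∈ [0, ∞]` of a function `f ∈ L²(ℝ)`.
It is `∞` by convention for functions which are not in `L²(ℝ)`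
(for `s ≥ 0` that is the usual value). -/
def sobolevNorm (s : ℝ) (f : ℝ → ℂ) : ℝ≥0∞ :=
  if hf : MemLp f 2 (volume : Measure ℝ) then
    (∫⁻ ξ : ℝ, ‖fourierL2 f hf ξ‖ₑ ^ 2 * ENNReal.ofReal (bracket ξ ^ (2 * s))) ^ (1 / 2 : ℝ)
  else ∞

/-- Space-time `ℝ_t × ℝ_x` with its Euclidean structure; `p.fst` is the time variable `t`
(or its dual `τ`) and `p.snd` is the space variable `x` (or its dual `ξ`). -/
abbrev SpaceTime : Type := WithLp 2 (ℝ × ℝ)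

/-- A function of `(t, x)`, as a function on space-time. -/
def onSpaceTime (w : ℝ → ℝ → ℂ) : SpaceTime → ℂ := fun p => w p.fst p.snd

open Classical in
/-- The norm
`‖w‖_{X^{r,b}} = (∬ |ŵ(ξ,τ)|² ⟨τ - κ ξ²⟩^{2b} ⟨ξ⟩^{2r} dξ dτ)^{1/2} ∈ [0, ∞]`
of `w ∈ L²(ℝ_t × ℝ_x)`, where `ŵ(ξ,τ) = ∬ e^{-ixξ - itτ} w(t,x) dx dt` and `κ = ±1` selects the
parabola `τ = κ ξ²`. It is `∞` by convention for functions which are not in `L²`. -/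
def bourgainNorm (κ r b : ℝ) (w : ℝ → ℝ → ℂ) : ℝ≥0∞ :=
  if hw : MemLp (onSpaceTime w) 2 (volume : Measure SpaceTime) then
    (∫⁻ p : SpaceTime, ‖fourierL2 (onSpaceTime w) hw p‖ₑ ^ 2 *
      ENNReal.ofReal (bracket (p.fst - κ * p.snd ^ 2) ^ (2 * b) * bracket p.snd ^ (2 * r)))
        ^ (1 / 2 : ℝ)
  else ∞

/-- `‖u‖_{C^0(I, H^s)}`, the supremum over `t ∈ I` of `‖u(t)‖_{H^s}`. -/
def supSobolevNorm (I : Set ℝ) (s : ℝ) (u : ℝ → ℝ → ℂ) : ℝ≥0∞ :=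
  ⨆ t ∈ I, sobolevNorm s (u t)

/-- The time cut-offs: `ζ₀` and `ζ₁` are smooth, real-valued and supported in `(-2T, 2T)`,
`ζ₀ ≡ 1` on `[0, T]`, and `ζ₁ ζ₀ ≡ ζ₀`. -/
structure IsCutoffPair (T : ℝ) (ζ₀ ζ₁ : ℝ → ℝ) : Prop where
  smooth_zero : ContDiff ℝ ((⊤ : ℕ∞) : WithTop ℕ∞) ζ₀
  eq_one : ∀ t ∈ Icc 0 T, ζ₀ t = 1
  supp_zero : tsupport ζ₀ ⊆ Ioo (-2 * T) (2 * T)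
  smooth_one : ContDiff ℝ ((⊤ : ℕ∞) : WithTop ℕ∞) ζ₁
  supp_one : tsupport ζ₁ ⊆ Ioo (-2 * T) (2 * T)
  mul_eq : ∀ t, ζ₁ t * ζ₀ t = ζ₀ t

/-- `u ∈ C^0(I, H^k)`. -/
structure IsContinuousInSobolev (I : Set ℝ) (k : ℝ) (u : ℝ → ℝ → ℂ) : Prop where
  finite : ∀ t ∈ I, sobolevNorm k (u t) < ∞
  tendsto : ∀ t₀ ∈ I, Tendsto (fun t => sobolevNorm k (u t - u t₀)) (𝓝[I] t₀) (𝓝 0)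

/-- `u ∈ C^0([-2T, 2T], H^{10})` is a solution of the modified Cauchy problem
`i u_t + u_xx + ζ₀(t) ω |u|² u = 0`, `u(0, ·) = u₀`. At this regularity the equation holds in the
classical sense, `u(t, ·)` being represented by its continuous representative. -/
structure IsSmoothSolution (T ω : ℝ) (ζ₀ : ℝ → ℝ) (u₀ : ℝ → ℂ) (u : ℝ → ℝ → ℂ) : Prop where
  continuous_sobolev : IsContinuousInSobolev (Icc (-2 * T) (2 * T)) 10 u
  contDiff_space : ∀ t ∈ Icc (-2 * T) (2 * T), ContDiff ℝ 2 (u t)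
  differentiable_time : ∀ t ∈ Ioo (-2 * T) (2 * T), ∀ x,
    DifferentiableAt ℝ (fun t' => u t' x) t
  equation : ∀ t ∈ Ioo (-2 * T) (2 * T), ∀ x,
    Complex.I * deriv (fun t' => u t' x) t + iteratedDeriv 2 (u t) x
      + (ζ₀ t : ℂ) * (ω : ℂ) * ((‖u t x‖ ^ 2 : ℝ) : ℂ) * u t x = 0
  initial : u 0 = u₀

end NLS

end

/-!
The energy `E(t) = ‖u(t)‖²_{H^s}` is differentiable, and the dispersive term does not contribute to
`E'`. With `V = û(t)`, the derivative is a multiple of `ζ₀(t)` times the imaginary part of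
`∫ φ(ξ₄) V(ξ₁) conj V(ξ₂) V(ξ₃) conj V(ξ₄)` over `ξ₁ - ξ₂ + ξ₃ - ξ₄ = 0`, where `φ = ⟨ξ⟩^{2s}`
(`IsSmoothSolution.energy_sub`). Complex conjugation exchanges `ξ₁` with `ξ₄` and `ξ₂` with `ξ₃`, so
that the symbol may be replaced by `φ(ξ₄) - φ(ξ₁)` (`energyRate_eq_integral_quarticProduct`). As
`s > -1/2`, this difference is at most a multiple of `(|ξ₁ - ξ₂| + |ξ₁ - ξ₄|) / N`, with `N` the
size of the largest frequency; four weights `⟨ξ⟩^r` with `r > -1/4` cost less than the factor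
`1 / N` (`symbol_bound`).

Where `ζ₀ ≠ 0`, the solution agrees with `ζ₁ u`, and `V` is the integral in `τ` of `e^{itτ}` times
the space-time transform `W` of `ζ₁ u`. The energy change is therefore a superposition of the oscillations
`e^{itθ}`, `θ = τ₁ - τ₂ + τ₃ - τ₄`, integrated against `ζ₀`; as `ζ₀` is of bounded variation, each
of them contributes `O(1 / ⟨θ⟩)` (`norm_integral_mul_exp_le`, `IsSmoothSolution.energy_sub_le`).
Fubini is justified by `W ∈ L¹`, in fact `∫ |W| dτ ∈ L¹ ∩ L²` in `ξ`: by the equation, one time derivative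
and two space derivatives of `ζ₁ u` are square integrable
(`IsSmoothSolution.memLp_parabolicWeight`).

What is left is a positive quartic form (`quartic_le`). With the modulations `σⱼ = τⱼ - κξⱼ²`,
`θ = σ₁ - σ₂ + σ₃ - σ₄ + 2κ(ξ₁ - ξ₂)(ξ₁ - ξ₄)`. For a fixed gap `a = ξ₁ - ξ₂ = ξ₄ - ξ₃`, the form is
symmetric between `(ξ₁, τ₁, τ₂)` and `(ξ₄, τ₄, τ₃)`, and Schur's test applies: the decay `1 / ⟨θ⟩`,
integrated in `ξ₄`, compensates the factor `|a|` (`lintegral_gapWeight_le`), and the weights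
`⟨σ⟩^{-2b}`, `b > 1/2`, are integrable. The sign `κ` plays no role. The term with `|ξ₁ - ξ₄|`
reduces to this one by exchanging `ξ₂` and `ξ₄`.

Mathlib's Fourier transform has the kernel `e^{-2πi⟨x, v⟩}`; accordingly frequencies appear as `2πξ`
and `2πτ`.
-/

noncomputable section

namespace NLS

/-! ### The Fourier transform on `L²` -/

section FourierL2

variable {E : Type*} [NormedAddCommGroup E] [InnerProductSpace ℝ E] [FiniteDimensional ℝ E]
  [MeasurableSpace E] [BorelSpace E]

lemma locallyIntegrable_of_memLp_two {f : E → ℂ} (hf : MemLp f 2 volume) :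
    LocallyIntegrable f volume :=
  hf.locallyIntegrable (by norm_num)

/-- Schwartz functions separate locally integrable functions, as they include the smooth bump
functions. -/
lemma ae_eq_of_integral_schwartz {f g : E → ℂ} (hf : LocallyIntegrable f volume)
    (hg : LocallyIntegrable g volume)
    (h : ∀ η : SchwartzMap E ℂ, ∫ x, η x * f x = ∫ x, η x * g x) : f =ᵐ[volume] g := by
  refine ae_eq_of_integral_contDiff_smul_eq hf hg fun φ hφ hc => ?_
  have hφ' : ContDiff ℝ ((⊤ : ℕ∞) : WithTop ℕ∞) (fun x => (φ x : ℂ)) :=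
    Complex.ofRealCLM.contDiff.comp hφ
  have hc' : HasCompactSupport (fun x => (φ x : ℂ)) :=
    hc.comp_left (g := ((↑) : ℝ → ℂ)) (by simp)
  have := h (hc'.toSchwartzMap hφ')
  simpa using this

/-- The `L²` transform agrees with the transform of tempered distributions. -/
lemma integral_mul_fourier_eq (f : Lp ℂ 2 (volume : Measure E)) (η : SchwartzMap E ℂ) :
    ∫ x, η x * (𝓕 f : Lp ℂ 2 (volume : Measure E)) x = ∫ x, 𝓕 η x * f x := by
  have h := congrArg (fun T => T η) (Lp.fourier_toTemperedDistribution_eq f)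
  simp only [TemperedDistribution.fourier_apply, Lp.toTemperedDistribution_apply,
    smul_eq_mul] at h
  exact h.symm

/-- The inverse Fourier integral is its own transpose. -/
lemma integral_fourierInv_mul (η : SchwartzMap E ℂ) {Y : E → ℂ} (hY : Integrable Y) :
    ∫ x, η x * 𝓕⁻ Y x = ∫ x, 𝓕⁻ η x * Y x := by
  have h := VectorFourier.integral_bilin_fourierIntegral_eq_flip
    (ContinuousLinearMap.mul ℂ ℂ) (L := -innerₗ E) (μ := volume) (ν := volume)
    Real.continuous_fourierChar (by simpa using! continuous_inner.neg) η.integrable hY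
  have e1 : ∀ (g : E → ℂ) x,
      VectorFourier.fourierIntegral Real.fourierChar volume (-innerₗ E) g x = 𝓕⁻ g x := by
    intro g x
    simp [VectorFourier.fourierIntegral, Real.fourierInv_eq]
  have e2 : ∀ (g : E → ℂ) x,
      VectorFourier.fourierIntegral Real.fourierChar volume (-innerₗ E).flip g x = 𝓕⁻ g x := by
    intro g x
    simp [VectorFourier.fourierIntegral, Real.fourierInv_eq, real_inner_comm]
  simp only [e1, e2, ContinuousLinearMap.mul_apply'] at h
  rw [SchwartzMap.fourierInv_coe]
  exact h.symm

lemma continuous_fourierInv {Y : E → ℂ} (hY : Integrable Y) : Continuous (𝓕⁻ Y) := by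
  have := (Real.Lp.fourierTransformInv (memLp_one_iff_integrable.2 hY).toLp).continuous
  rwa [Real.Lp.fourierTransformInv_toLp] at this

lemma ae_eq_fourierInv_fourier (f : Lp ℂ 2 (volume : Measure E))
    (h : Integrable (𝓕 f : Lp ℂ 2 (volume : Measure E))) :
    f =ᵐ[volume] 𝓕⁻ (⇑(𝓕 f : Lp ℂ 2 (volume : Measure E))) := by
  refine ae_eq_of_integral_schwartz (locallyIntegrable_of_memLp_two (Lp.memLp f))
    (continuous_fourierInv h).locallyIntegrable fun η => ?_
  rw [integral_fourierInv_mul η h, integral_mul_fourier_eq f (𝓕⁻ η),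
    FourierTransform.fourier_fourierInv_eq]

/-- Uniqueness for Fourier inversion: if `f ∈ L²` is the inverse Fourier integral of `Y ∈ L¹`, then
`Y` is the `L²` Fourier transform of `f`. -/
lemma fourier_ae_eq_of_eq_fourierInv (f : Lp ℂ 2 (volume : Measure E)) {Y : E → ℂ}
    (hY : Integrable Y) (h : f =ᵐ[volume] 𝓕⁻ Y) :
    (𝓕 f : Lp ℂ 2 (volume : Measure E)) =ᵐ[volume] Y := by
  refine ae_eq_of_integral_schwartz (locallyIntegrable_of_memLp_two (Lp.memLp _))
    hY.locallyIntegrable fun η => ?_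
  rw [integral_mul_fourier_eq f η]
  have : ∫ x, 𝓕 η x * f x = ∫ x, 𝓕 η x * 𝓕⁻ Y x := by
    refine integral_congr_ae ?_
    filter_upwards [h] with x hx
    rw [hx]
  rw [this, integral_fourierInv_mul (𝓕 η) hY, FourierTransform.fourierInv_fourier_eq]

open scoped LineDeriv in
/-- The classical derivative of an `L²` function in the direction `v`, if square integrable, has the
Fourier transform given by the multiplier `2πi⟨x, v⟩`: both sides are tested against Schwartz
functions, integrating by parts along `v`. -/
lemma fourier_lineDeriv_ae_eq {f f' : E → ℂ} (v : E) (hf : MemLp f 2 volume)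
    (hf' : MemLp f' 2 volume) (hd : ∀ x, HasLineDerivAt ℝ f (f' x) x v) :
    (𝓕 (hf'.toLp f') : Lp ℂ 2 (volume : Measure E)) =ᵐ[volume]
      fun x => (2 * Real.pi * Complex.I * (inner ℝ x v : ℝ)) *
        (𝓕 (hf.toLp f) : Lp ℂ 2 (volume : Measure E)) x := by
  have hcont : Continuous fun x : E => (2 * Real.pi * Complex.I * (inner ℝ x v : ℝ) : ℂ) := by
    fun_prop
  have htemp : (inner ℝ · v : E → ℝ).HasTemperateGrowth := by fun_prop
  have hschw : ∀ (η : SchwartzMap E ℂ) {g : E → ℂ}, MemLp g 2 volume →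
      Integrable (fun x => g x * η x) := fun η g hg =>
    MemLp.integrable_mul hg (η.memLp 2)
  refine ae_eq_of_integral_schwartz (locallyIntegrable_of_memLp_two (Lp.memLp _)) ?_ fun η => ?_
  · have := (locallyIntegrable_of_memLp_two
      (Lp.memLp (𝓕 (hf.toLp f) : Lp ℂ 2 (volume : Measure E)))).smul_continuous hcont
    simpa [mul_comm] using this
  have hη : ∀ x, η x * (2 * Real.pi * Complex.I * (inner ℝ x v : ℝ)) =
      ((2 * Real.pi * Complex.I) • SchwartzMap.smulLeftCLM ℂ (inner ℝ · v : E → ℝ) η) x := by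
    intro x
    simp [SchwartzMap.smulLeftCLM_apply_apply htemp]
    ring
  calc ∫ x, η x * (𝓕 (hf'.toLp f') : Lp ℂ 2 (volume : Measure E)) x
      = ∫ x, f' x * 𝓕 η x := by
        rw [integral_mul_fourier_eq]
        refine integral_congr_ae ?_
        filter_upwards [hf'.coeFn_toLp] with x hx
        rw [hx, mul_comm]
    _ = - ∫ x, f x * (∂_{v} (𝓕 η)) x := by
        have h := integral_bilinear_hasLineDerivAt_right_eq_neg_left_of_integrable
          (μ := volume) (B := ContinuousLinearMap.mul ℝ ℂ) (f := f) (f' := f')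
          (g := ⇑(𝓕 η : SchwartzMap E ℂ))
          (g' := ⇑(∂_{v} (𝓕 η : SchwartzMap E ℂ) : SchwartzMap E ℂ)) (v := v)
          ?_ ?_ ?_ ?_ ?_
        · simp only [ContinuousLinearMap.mul_apply'] at h
          rw [h, neg_neg]
        · exact hschw _ hf'
        · exact hschw _ hf
        · exact hschw _ hf
        · exact fun x _ => hd x
        · intro x _
          rw [SchwartzMap.lineDerivOp_apply_eq_fderiv]
          exact ((𝓕 η : SchwartzMap E ℂ).differentiableAt.hasFDerivAt).hasLineDerivAt v
    _ = ∫ x, 𝓕 ((2 * Real.pi * Complex.I) •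
          SchwartzMap.smulLeftCLM ℂ (inner ℝ · v : E → ℝ) η) x * f x := by
        rw [SchwartzMap.lineDerivOp_fourier_eq, ← integral_neg]
        refine integral_congr_ae (Eventually.of_forall fun x => ?_)
        simp [FourierTransform.fourier_smul]
        ring
    _ = _ := by
        rw [← integral_congr_ae (f := fun x => 𝓕 ((2 * Real.pi * Complex.I) •
          SchwartzMap.smulLeftCLM ℂ (inner ℝ · v : E → ℝ) η) x * hf.toLp f x),
          ← integral_mul_fourier_eq]
        · refine integral_congr_ae (Eventually.of_forall fun x => ?_)
          simp only
          rw [← hη, mul_assoc]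
        · filter_upwards [hf.coeFn_toLp] with x hx
          rw [hx]

/-- The `L²` Fourier transform in Mathlib's normalization, kernel `e^{-2πi⟨x, v⟩}`, of a square
integrable function, as a function (a strongly measurable representative). -/
def fourierLp (f : E → ℂ) (hf : MemLp f 2 (volume : Measure E)) : E → ℂ :=
  ⇑(𝓕 (hf.toLp f) : Lp ℂ 2 (volume : Measure E))

lemma stronglyMeasurable_fourierLp {f : E → ℂ} (hf : MemLp f 2 (volume : Measure E)) :
    StronglyMeasurable (fourierLp f hf) :=
  Lp.stronglyMeasurable _

lemma memLp_fourierLp {f : E → ℂ} (hf : MemLp f 2 (volume : Measure E)) :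
    MemLp (fourierLp f hf) 2 volume :=
  Lp.memLp _

lemma eLpNorm_fourierLp {f : E → ℂ} (hf : MemLp f 2 (volume : Measure E)) :
    eLpNorm (fourierLp f hf) 2 volume = eLpNorm f 2 volume := by
  have h := Lp.norm_fourier_eq (hf.toLp f)
  rw [Lp.norm_toLp, Lp.norm_def] at h
  exact (ENNReal.toReal_eq_toReal_iff' (Lp.eLpNorm_ne_top _) hf.eLpNorm_ne_top).1 h

lemma fourierLp_add {f g : E → ℂ} (hf : MemLp f 2 (volume : Measure E))
    (hg : MemLp g 2 (volume : Measure E)) :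
    fourierLp (f + g) (hf.add hg) =ᵐ[volume] fourierLp f hf + fourierLp g hg := by
  rw [fourierLp, MemLp.toLp_add hf hg, FourierTransform.fourier_add]
  exact Lp.coeFn_add _ _

/-- For `Y ∈ L¹ ∩ L²` the inverse Fourier integral of `Y` is square integrable, and `Y` is its
`L²` Fourier transform. -/
lemma exists_memLp_fourierInv {Y : E → ℂ} (h1 : Integrable Y) (h2 : MemLp Y 2 volume) :
    ∃ h : MemLp (𝓕⁻ Y) 2 volume, fourierLp (𝓕⁻ Y) h =ᵐ[volume] Y := by
  set g : Lp ℂ 2 (volume : Measure E) := 𝓕⁻ (h2.toLp Y) with hg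
  have hFg : (𝓕 g : Lp ℂ 2 (volume : Measure E)) = h2.toLp Y := by
    rw [hg, FourierTransform.fourier_fourierInv_eq]
  have hae : g =ᵐ[volume] 𝓕⁻ Y := by
    have := ae_eq_fourierInv_fourier g
      (by rw [hFg]; exact h1.congr h2.coeFn_toLp.symm)
    rw [hFg] at this
    filter_upwards [this] with x hx
    rw [hx, Real.fourierInv_congr_ae h2.coeFn_toLp x]
  refine ⟨(Lp.memLp g).ae_eq hae, ?_⟩
  exact fourier_ae_eq_of_eq_fourierInv _ h1 (MemLp.coeFn_toLp _)

lemma eq_fourierInv_fourierLp {f : E → ℂ} (hf : MemLp f 2 (volume : Measure E))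
    (hc : Continuous f) (h : Integrable (fourierLp f hf)) : f = 𝓕⁻ (fourierLp f hf) := by
  refine (Continuous.ae_eq_iff_eq volume hc (continuous_fourierInv h)).1 ?_
  exact hf.coeFn_toLp.symm.trans (ae_eq_fourierInv_fourier (hf.toLp f) h)

lemma norm_fourierInv_le {Y : E → ℂ} (x : E) : ‖𝓕⁻ Y x‖ₑ ≤ ∫⁻ v, ‖Y v‖ₑ := by
  rw [Real.fourierInv_eq]
  refine (enorm_integral_le_lintegral_enorm _).trans (lintegral_mono fun v => ?_)
  rw [← ofReal_norm, Circle.norm_smul, ofReal_norm]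

lemma lintegral_comp_smul' (f : E → ℝ≥0∞) {R : ℝ} (hR : 0 < R) :
    ∫⁻ x, f (R⁻¹ • x) = ENNReal.ofReal (R ^ Module.finrank ℝ E) * ∫⁻ x, f x := by
  have hR' : R⁻¹ ≠ 0 := (inv_pos.2 hR).ne'
  have h := (Homeomorph.smul (isUnit_iff_ne_zero.2 hR').unit).measurableEmbedding.lintegral_map
    (μ := (volume : Measure E)) f
  have h2 : (⇑(Homeomorph.smul (isUnit_iff_ne_zero.2 hR').unit) : E → E) = (R⁻¹ • ·) := rfl
  rw [h2, Measure.map_addHaar_smul _ hR', lintegral_smul_measure] at h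
  rw [← h, smul_eq_mul]
  congr 2
  rw [inv_pow, inv_inv, abs_of_pos (by positivity)]

end FourierL2

/-! ### Sobolev norms -/

lemma one_le_bracket (x : ℝ) : 1 ≤ bracket x := by
  rw [bracket, Real.one_le_sqrt]
  nlinarith [sq_nonneg x]

lemma bracket_pos (x : ℝ) : 0 < bracket x := zero_lt_one.trans_le (one_le_bracket x)

lemma abs_le_bracket (x : ℝ) : |x| ≤ bracket x :=
  Real.abs_le_sqrt (by linarith)

@[fun_prop]
lemma continuous_bracket : Continuous bracket := by
  unfold bracket; fun_prop

@[fun_prop]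
lemma measurable_bracket : Measurable bracket := continuous_bracket.measurable

lemma sobolevNorm_sq (s : ℝ) {f : ℝ → ℂ} (hf : MemLp f 2 volume) :
    sobolevNorm s f ^ 2 = ENNReal.ofReal (2 * Real.pi) *
      ∫⁻ v, ‖fourierLp f hf v‖ₑ ^ 2 * ENNReal.ofReal (bracket (2 * Real.pi * v) ^ (2 * s)) := by
  have h := lintegral_comp_smul' (fun v : ℝ => ‖fourierLp f hf v‖ₑ ^ 2 *
    ENNReal.ofReal (bracket (2 * Real.pi * v) ^ (2 * s))) Real.two_pi_pos
  rw [Module.finrank_self, pow_one] at h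
  rw [sobolevNorm, dif_pos hf, ← h, ← ENNReal.rpow_natCast, ← ENNReal.rpow_mul]
  norm_num
  refine lintegral_congr fun v => ?_
  have : 2 * Real.pi * (Real.pi⁻¹ * 2⁻¹ * v) = v := by
    field_simp
  simp [fourierL2, fourierLp, this]

lemma memLp_of_sobolevNorm_lt_top {s : ℝ} {f : ℝ → ℂ} (h : sobolevNorm s f < ∞) :
    MemLp f 2 volume := by
  by_contra hf
  rw [sobolevNorm, dif_neg hf] at h
  exact lt_irrefl _ h

lemma sobolevNorm_eq_eLpNorm (s : ℝ) {f : ℝ → ℂ} (hf : MemLp f 2 volume) :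
    sobolevNorm s f = eLpNorm (fun v => (bracket (2 * Real.pi * v) ^ s : ℝ) •
      fourierLp f hf v) 2 (ENNReal.ofReal (2 * Real.pi) • volume) := by
  have h : sobolevNorm s f ^ 2 = (eLpNorm (fun v => (bracket (2 * Real.pi * v) ^ s : ℝ) •
      fourierLp f hf v) 2 (ENNReal.ofReal (2 * Real.pi) • volume)) ^ 2 := by
    rw [sobolevNorm_sq s hf, eLpNorm_eq_lintegral_rpow_enorm_toReal (by norm_num) (by norm_num),
      ← ENNReal.rpow_natCast, ← ENNReal.rpow_mul]
    norm_num
    congr 1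
    refine lintegral_congr fun v => ?_
    have h0 := Real.rpow_nonneg (bracket_pos (2 * Real.pi * v)).le s
    rw [← ofReal_norm (((_ : ℝ) : ℂ)), Complex.norm_real, Real.norm_of_nonneg h0, mul_pow,
      mul_comm, ← ENNReal.ofReal_pow h0,
      ← Real.rpow_natCast, ← Real.rpow_mul (bracket_pos _).le]
    norm_num [mul_comm]
  exact (ENNReal.pow_right_strictMono two_ne_zero).injective h

lemma sobolevNorm_add_le (s : ℝ) {f g : ℝ → ℂ} (hf : MemLp f 2 volume) (hg : MemLp g 2 volume) :
    sobolevNorm s (f + g) ≤ sobolevNorm s f + sobolevNorm s g := by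
  have hm : ∀ {h : ℝ → ℂ} (hh : MemLp h 2 volume), AEStronglyMeasurable
      (fun v => (bracket (2 * Real.pi * v) ^ s : ℝ) • fourierLp h hh v)
      (ENNReal.ofReal (2 * Real.pi) • volume) := by
    intro h hh
    have h1 := stronglyMeasurable_fourierLp hh
    have h2 : Measurable fun v => bracket (2 * Real.pi * v) ^ s := by fun_prop
    exact (h2.stronglyMeasurable.smul h1).aestronglyMeasurable
  rw [sobolevNorm_eq_eLpNorm s (hf.add hg), sobolevNorm_eq_eLpNorm s hf,
    sobolevNorm_eq_eLpNorm s hg]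
  refine le_trans (le_of_eq ?_) (eLpNorm_add_le (hm hf) (hm hg) (by norm_num))
  refine eLpNorm_congr_ae (Measure.ae_smul_measure ?_ _)
  filter_upwards [fourierLp_add hf hg] with v hv
  simp only [Pi.add_apply, hv, smul_add]

lemma sobolevNorm_mono {s s' : ℝ} (hs : s ≤ s') {f : ℝ → ℂ} :
    sobolevNorm s f ≤ sobolevNorm s' f := by
  by_cases hf : MemLp f 2 volume
  · rw [sobolevNorm, sobolevNorm, dif_pos hf, dif_pos hf]
    gcongr
    exact one_le_bracket _
  · simp [sobolevNorm, hf]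

/-- For `f ∈ H¹⁰` of class `C²`, the derivatives of order at most two are given by Fourier
inversion; they are bounded in the supremum norm and in `L²` by the `H¹⁰` norm. -/
lemma exists_sobolev_bound : ∃ C : ℝ≥0∞, C ≠ ∞ ∧ ∀ f : ℝ → ℂ, ContDiff ℝ 2 f →
    ∀ hf : MemLp f 2 volume, sobolevNorm 10 f < ∞ → ∀ k ≤ 2,
      (∀ x, ‖iteratedDeriv k f x‖ₑ ≤ C * sobolevNorm 10 f) ∧
      eLpNorm (iteratedDeriv k f) 2 volume ≤ sobolevNorm 10 f ∧
      ∃ h : MemLp (iteratedDeriv k f) 2 volume, fourierLp (iteratedDeriv k f) h =ᵐ[volume]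
        fun v => (2 * Real.pi * Complex.I * v) ^ k * fourierLp f hf v := by
  -- Cauchy–Schwarz with `⟨v⟩² |f̂| = ⟨v⟩^{-8} · ⟨v⟩^{10} |f̂|`.
  set A : ℝ≥0∞ := ∫⁻ v : ℝ, ENNReal.ofReal (bracket (2 * Real.pi * v) ^ (-16 : ℝ)) with hA
  have hAfin : A ≠ ∞ := by
    have : Integrable (fun v : ℝ => (1 + (2 * Real.pi * v) ^ 2)⁻¹) :=
      integrable_inv_one_add_sq.comp_mul_left' Real.two_pi_pos.ne'
    refine ((lintegral_mono fun v => ?_).trans_lt this.lintegral_lt_top).ne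
    refine ENNReal.ofReal_le_ofReal ?_
    have h1 := one_le_bracket (2 * Real.pi * v)
    calc bracket (2 * Real.pi * v) ^ (-16 : ℝ) ≤ bracket (2 * Real.pi * v) ^ (-2 : ℝ) :=
          Real.rpow_le_rpow_of_exponent_le h1 (by norm_num)
      _ = _ := by
          rw [Real.rpow_neg (bracket_pos _).le, bracket]
          norm_cast
          rw [Real.sq_sqrt (by positivity)]
  have hpi1 : 1 ≤ 2 * Real.pi := by linarith [Real.pi_gt_three]
  refine ⟨A ^ (1 / 2 : ℝ), ENNReal.rpow_ne_top_of_nonneg (by norm_num) hAfin, ?_⟩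
  intro f hC hf hN k hk
  set a := fourierLp f hf with ha
  set Y : ℕ → ℝ → ℂ := fun k v => (2 * Real.pi * Complex.I * v) ^ k * a v with hY
  have ham := stronglyMeasurable_fourierLp hf
  have hYm : ∀ k, StronglyMeasurable (Y k) := fun k => by
    have : Measurable fun v : ℝ => (2 * Real.pi * Complex.I * v : ℂ) ^ k := by fun_prop
    exact this.stronglyMeasurable.mul ham
  have hpoint : ∀ k ≤ 2, ∀ v, ‖Y k v‖ ≤ bracket (2 * Real.pi * v) ^ (2 : ℝ) * ‖a v‖ := by
    intro k hk v
    rw [hY, norm_mul, norm_pow]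
    have e : ‖(2 * Real.pi * Complex.I * v : ℂ)‖ = |2 * Real.pi * v| := by
      simp [abs_mul]
    rw [e]
    gcongr
    have h1 := one_le_bracket (2 * Real.pi * v)
    calc |2 * Real.pi * v| ^ k ≤ bracket (2 * Real.pi * v) ^ k := by
          gcongr; exact abs_le_bracket _
      _ ≤ bracket (2 * Real.pi * v) ^ 2 := pow_le_pow_right₀ h1 hk
      _ = _ := by norm_cast
  have hI : ∫⁻ v, ‖a v‖ₑ ^ 2 * ENNReal.ofReal (bracket (2 * Real.pi * v) ^ (20 : ℝ)) ≤
      sobolevNorm 10 f ^ 2 := by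
    rw [sobolevNorm_sq 10 hf]
    norm_num
    refine le_mul_of_one_le_left zero_le ?_
    rw [show (2 : ℝ≥0∞) * ENNReal.ofReal Real.pi = ENNReal.ofReal (2 * Real.pi) by
      rw [ENNReal.ofReal_mul (by norm_num)]; norm_num]
    simpa using ENNReal.ofReal_le_ofReal hpi1
  have hsq : (sobolevNorm 10 f ^ 2) ^ (1 / 2 : ℝ) = sobolevNorm 10 f := by
    rw [← ENNReal.rpow_natCast, ← ENNReal.rpow_mul]; norm_num
  have hen : ∀ {p : ℝ} {v : ℝ}, 0 ≤ bracket (2 * Real.pi * v) ^ p := fun {p v} =>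
    Real.rpow_nonneg (bracket_pos _).le _
  have hL1 : ∀ k ≤ 2, ∫⁻ v, ‖Y k v‖ₑ ≤ A ^ (1 / 2 : ℝ) * sobolevNorm 10 f := by
    intro k hk
    have hH := ENNReal.lintegral_mul_le_Lp_mul_Lq (volume : Measure ℝ)
      (Real.HolderConjugate.two_two)
      (f := fun v => ENNReal.ofReal (bracket (2 * Real.pi * v) ^ (-8 : ℝ)))
      (g := fun v => ENNReal.ofReal (bracket (2 * Real.pi * v) ^ (10 : ℝ)) * ‖a v‖ₑ)
      (by fun_prop) ((by fun_prop : Measurable fun v =>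
        ENNReal.ofReal (bracket (2 * Real.pi * v) ^ (10 : ℝ))).mul ham.enorm).aemeasurable
    refine (lintegral_mono fun v => ?_).trans (hH.trans ?_)
    · simp only [Pi.mul_apply]
      rw [← mul_assoc, ← ENNReal.ofReal_mul hen, ← Real.rpow_add (bracket_pos _), ← ofReal_norm,
        ← ofReal_norm, ← ENNReal.ofReal_mul hen]
      refine ENNReal.ofReal_le_ofReal ?_
      norm_num
      simpa using hpoint k hk v
    · gcongr
      · refine le_of_eq (lintegral_congr fun v => ?_)
        rw [ENNReal.ofReal_rpow_of_nonneg hen (by norm_num), ← Real.rpow_mul (bracket_pos _).le]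
        norm_num
      · rw [← hsq]
        gcongr
        refine le_trans (le_of_eq (lintegral_congr fun v => ?_)) hI
        rw [ENNReal.mul_rpow_of_nonneg _ _ (by norm_num),
          ENNReal.ofReal_rpow_of_nonneg hen (by norm_num), ← Real.rpow_mul (bracket_pos _).le,
          mul_comm]
        norm_num
  have hL2 : ∀ k ≤ 2, eLpNorm (Y k) 2 volume ≤ sobolevNorm 10 f := by
    intro k hk
    rw [eLpNorm_eq_lintegral_rpow_enorm_toReal (by norm_num) (by norm_num), ← hsq]
    norm_num
    gcongr
    refine le_trans (lintegral_mono fun v => ?_) hI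
    rw [← ofReal_norm, ← ofReal_norm, ← ENNReal.ofReal_pow (norm_nonneg _),
      ← ENNReal.ofReal_pow (norm_nonneg _), ← ENNReal.ofReal_mul (by positivity)]
    refine ENNReal.ofReal_le_ofReal ?_
    calc ‖Y k v‖ ^ 2 ≤ (bracket (2 * Real.pi * v) ^ (2 : ℝ) * ‖a v‖) ^ 2 := by
          gcongr; exact hpoint k hk v
      _ = ‖a v‖ ^ 2 * bracket (2 * Real.pi * v) ^ (4 : ℝ) := by
          rw [mul_pow, mul_comm, ← Real.rpow_natCast (bracket _ ^ _),
            ← Real.rpow_mul (bracket_pos _).le]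
          norm_num
      _ ≤ _ := by
          gcongr
          · exact one_le_bracket _
          · norm_num
  have hint : ∀ k ≤ 2, Integrable (Y k) := fun k hk =>
    ⟨(hYm k).aestronglyMeasurable, (hL1 k hk).trans_lt
      (ENNReal.mul_lt_top (ENNReal.rpow_lt_top_of_nonneg (by norm_num) hAfin) hN)⟩
  have hmem : ∀ k ≤ 2, MemLp (Y k) 2 volume := fun k hk =>
    ⟨(hYm k).aestronglyMeasurable, (hL2 k hk).trans_lt hN⟩
  have hY0 : Y 0 = a := by ext v; simp [hY]
  have hfa : f = 𝓕⁻ a :=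
    eq_fourierInv_fourierLp hf hC.continuous (by rw [← ha, ← hY0]; exact hint 0 (by norm_num))
  have hder : iteratedDeriv k f = 𝓕⁻ (Y k) := by
    rw [hfa, Real.fourierInv_eq_fourier_comp_neg, Real.fourierInv_eq_fourier_comp_neg]
    rw [Real.iteratedDeriv_fourier (N := 2) (n := k)]
    · congr 1
      ext v
      simp only [hY, smul_eq_mul]
      push_cast
      ring
    · intro n hn
      have hn' : n ≤ 2 := by exact_mod_cast hn
      have := ((hint n hn').comp_neg).const_mul ((-2 * Real.pi * Complex.I)⁻¹ ^ n)
      refine this.congr (Eventually.of_forall fun v => ?_)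
      have h0 : (-2 * Real.pi * Complex.I : ℂ) ≠ 0 := by simp [Real.pi_ne_zero]
      simp only [hY, Complex.real_smul]
      push_cast
      rw [← mul_assoc, ← mul_pow]
      congr 2
      field_simp
    · exact_mod_cast hk
  obtain ⟨h, hae⟩ := exists_memLp_fourierInv (hint k hk) (hmem k hk)
  refine ⟨fun x => ?_, ?_, ?_⟩
  · rw [hder]
    exact (norm_fourierInv_le x).trans (hL1 k hk)
  · rw [hder, ← eLpNorm_fourierLp h, eLpNorm_congr_ae hae]
    exact hL2 k hk
  · rw [hder]
    exact ⟨h, hae⟩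

/-! ### Curves in Sobolev spaces and in `L²` -/

lemma exists_sobolevNorm_le {I : Set ℝ} (hI : IsCompact I) {k : ℝ} {u : ℝ → ℝ → ℂ}
    (hu : IsContinuousInSobolev I k u) :
    ∃ K : ℝ≥0∞, K ≠ ∞ ∧ ∀ t ∈ I, sobolevNorm k (u t) ≤ K := by
  refine hI.induction_on (p := fun S => ∃ K : ℝ≥0∞, K ≠ ∞ ∧ ∀ t ∈ S, sobolevNorm k (u t) ≤ K)
    ⟨0, by simp⟩ ?_ ?_ ?_
  · rintro S S' hS ⟨K, hK, h⟩
    exact ⟨K, hK, fun t ht => h t (hS ht)⟩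
  · rintro S S' ⟨K, hK, h⟩ ⟨K', hK', h'⟩
    refine ⟨max K K', by simp [hK, hK'], fun t ht => ?_⟩
    rcases ht with ht | ht
    · exact (h t ht).trans (le_max_left _ _)
    · exact (h' t ht).trans (le_max_right _ _)
  · intro t₀ ht₀
    have h1 : ∀ᶠ t in 𝓝[I] t₀, sobolevNorm k (u t - u t₀) < 1 :=
      (hu.tendsto t₀ ht₀).eventually (gt_mem_nhds zero_lt_one)
    refine ⟨_, h1, 1 + sobolevNorm k (u t₀), by simpa using (hu.finite t₀ ht₀).ne, ?_⟩
    intro t ht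
    have ht : sobolevNorm k (u t - u t₀) < 1 := ht
    have h2 := sobolevNorm_add_le k
      (memLp_of_sobolevNorm_lt_top (ht.trans ENNReal.one_lt_top))
      (memLp_of_sobolevNorm_lt_top (hu.finite t₀ ht₀))
    rw [sub_add_cancel] at h2
    exact h2.trans (by gcongr)

section Regularity

variable {I : Set ℝ} {u : ℝ → ℝ → ℂ}

/-- Continuity in `H¹⁰` gives continuity of the derivatives of order at most two, uniformly in space
and in `L²`. -/
lemma tendsto_enorm_iteratedDeriv_sub (hu : IsContinuousInSobolev I 10 u)
    (hc : ∀ t ∈ I, ContDiff ℝ 2 (u t)) {k : ℕ} (hk : k ≤ 2) {t₀ : ℝ} (ht₀ : t₀ ∈ I) :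
    (∀ ε : ℝ, 0 < ε → ∀ᶠ t in 𝓝[I] t₀,
      ∀ x, ‖iteratedDeriv k (u t) x - iteratedDeriv k (u t₀) x‖ ≤ ε) ∧
    Tendsto (fun t => eLpNorm (iteratedDeriv k (u t) - iteratedDeriv k (u t₀)) 2 volume)
      (𝓝[I] t₀) (𝓝 0) := by
  obtain ⟨C, hC, hS⟩ := exists_sobolev_bound
  have hfin : ∀ᶠ t in 𝓝[I] t₀, sobolevNorm 10 (u t - u t₀) < ∞ :=
    (hu.tendsto t₀ ht₀).eventually (gt_mem_nhds ENNReal.zero_lt_top)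
  have hsub : ∀ t ∈ I, ∀ x, iteratedDeriv k (u t - u t₀) x =
      iteratedDeriv k (u t) x - iteratedDeriv k (u t₀) x := by
    intro t ht x
    have hk' : ((k : ℕ) : WithTop ℕ∞) ≤ 2 := by exact_mod_cast hk
    exact iteratedDeriv_sub ((hc t ht).of_le hk').contDiffAt ((hc t₀ ht₀).of_le hk').contDiffAt
  constructor
  · intro ε hε
    have hlim : Tendsto (fun t => C * sobolevNorm 10 (u t - u t₀)) (𝓝[I] t₀) (𝓝 0) := by
      simpa using ENNReal.Tendsto.const_mul (hu.tendsto t₀ ht₀) (Or.inr hC)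
    have hlt := hlim.eventually (gt_mem_nhds (ENNReal.ofReal_pos.2 hε))
    filter_upwards [hfin, hlt, self_mem_nhdsWithin] with t h1 h2 ht x
    have h3 := (hS _ ((hc t ht).sub (hc t₀ ht₀)) (memLp_of_sobolevNorm_lt_top h1) h1 k hk).1 x
    rw [show (fun x => u t x - u t₀ x) = u t - u t₀ from rfl, hsub t ht x] at h3
    have h4 := h3.trans h2.le
    rw [← ofReal_norm] at h4
    exact (ENNReal.ofReal_le_ofReal_iff hε.le).1 h4
  · refine tendsto_of_tendsto_of_tendsto_of_le_of_le' tendsto_const_nhds (hu.tendsto t₀ ht₀)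
      (Eventually.of_forall fun _ => zero_le) ?_
    filter_upwards [hfin, self_mem_nhdsWithin] with t h1 ht
    have h3 := (hS _ ((hc t ht).sub (hc t₀ ht₀)) (memLp_of_sobolevNorm_lt_top h1) h1 k hk).2.1
    rw [show (fun x => u t x - u t₀ x) = u t - u t₀ from rfl] at h3
    rwa [show iteratedDeriv k (u t - u t₀) = iteratedDeriv k (u t) - iteratedDeriv k (u t₀) from
      funext (hsub t ht)] at h3

lemma exists_bound_iteratedDeriv (hI : IsCompact I) (hu : IsContinuousInSobolev I 10 u)
    (hc : ∀ t ∈ I, ContDiff ℝ 2 (u t)) :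
    ∃ K : ℝ, 0 ≤ K ∧ ∀ t ∈ I, ∀ k ≤ 2, (∀ x, ‖iteratedDeriv k (u t) x‖ ≤ K) ∧
      MemLp (iteratedDeriv k (u t)) 2 volume ∧
      eLpNorm (iteratedDeriv k (u t)) 2 volume ≤ ENNReal.ofReal K := by
  obtain ⟨C, hC, hS⟩ := exists_sobolev_bound
  obtain ⟨N, hN, hle⟩ := exists_sobolevNorm_le hI hu
  have hfin : C * N + N ≠ ∞ := ENNReal.add_ne_top.2 ⟨ENNReal.mul_ne_top hC hN, hN⟩
  refine ⟨(C * N + N).toReal, ENNReal.toReal_nonneg, fun t ht k hk => ?_⟩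
  obtain ⟨h1, h2, h3, -⟩ := hS _ (hc t ht) (memLp_of_sobolevNorm_lt_top (hu.finite t ht))
    (hu.finite t ht) k hk
  refine ⟨fun x => ?_, h3, ?_⟩
  · have h4 : ‖iteratedDeriv k (u t) x‖ₑ ≤ C * N + N :=
      (h1 x).trans ((mul_le_mul_right (hle t ht) C).trans le_self_add)
    have := ENNReal.toReal_mono hfin h4
    simpa using this
  · rw [ENNReal.ofReal_toReal hfin]
    exact h2.trans ((hle t ht).trans le_add_self)

/-- The space derivatives of order at most two are jointly continuous in `(t, x)`. -/
lemma continuousOn_iteratedDeriv (hu : IsContinuousInSobolev I 10 u)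
    (hc : ∀ t ∈ I, ContDiff ℝ 2 (u t)) {k : ℕ} (hk : k ≤ 2) :
    ContinuousOn (fun p : ℝ × ℝ => iteratedDeriv k (u p.1) p.2) (I ×ˢ univ) := by
  rintro ⟨t₀, x₀⟩ ⟨ht₀, -⟩
  have hk' : ((k : ℕ) : WithTop ℕ∞) ≤ 2 := by exact_mod_cast hk
  have hcont : Continuous (iteratedDeriv k (u t₀)) := (hc t₀ ht₀).continuous_iteratedDeriv k hk'
  have hfst : Tendsto (Prod.fst : ℝ × ℝ → ℝ) (𝓝[I ×ˢ univ] (t₀, x₀)) (𝓝[I] t₀) :=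
    tendsto_nhdsWithin_iff.2 ⟨continuous_fst.continuousAt.tendsto.mono_left nhdsWithin_le_nhds,
      by filter_upwards [self_mem_nhdsWithin] with p hp using hp.1⟩
  have h1 : Tendsto (fun p : ℝ × ℝ => iteratedDeriv k (u p.1) p.2 - iteratedDeriv k (u t₀) p.2)
      (𝓝[I ×ˢ univ] (t₀, x₀)) (𝓝 0) := by
    rw [Metric.tendsto_nhds]
    intro ε hε
    filter_upwards [hfst.eventually ((tendsto_enorm_iteratedDeriv_sub hu hc hk ht₀).1 (ε / 2)
      (by positivity))] with p hp
    rw [dist_zero_right]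
    exact (hp p.2).trans_lt (by linarith)
  have h2 : Tendsto (fun p : ℝ × ℝ => iteratedDeriv k (u t₀) p.2)
      (𝓝[I ×ˢ univ] (t₀, x₀)) (𝓝 (iteratedDeriv k (u t₀) x₀)) :=
    ((hcont.comp continuous_snd).tendsto (t₀, x₀)).mono_left nhdsWithin_le_nhds
  have := h1.add h2
  simpa [ContinuousWithinAt] using this

end Regularity

open Classical in
/-- The class in `L²` of a function; it is `0` for functions which are not square integrable. -/
def lpClass (f : ℝ → ℂ) : Lp ℂ 2 (volume : Measure ℝ) :=
  if h : MemLp f 2 volume then h.toLp f else 0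

lemma lpClass_eq {f : ℝ → ℂ} (h : MemLp f 2 volume) : lpClass f = h.toLp f := dif_pos h

lemma coeFn_lpClass {f : ℝ → ℂ} (h : MemLp f 2 volume) : lpClass f =ᵐ[volume] f := by
  rw [lpClass_eq h]; exact h.coeFn_toLp

lemma continuousAt_lpClass {v : ℝ → ℝ → ℂ} {J : Set ℝ} (hJ : ∀ t ∈ J, MemLp (v t) 2 volume)
    {t₀ : ℝ} (ht₀ : t₀ ∈ J)
    (h : Tendsto (fun t => eLpNorm (v t - v t₀) 2 volume) (𝓝[J] t₀) (𝓝 0)) :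
    ContinuousWithinAt (fun t => lpClass (v t)) J t₀ := by
  rw [ContinuousWithinAt, Lp.tendsto_Lp_iff_tendsto_eLpNorm']
  refine h.congr' ?_
  filter_upwards [self_mem_nhdsWithin] with t ht
  refine eLpNorm_congr_ae ?_
  filter_upwards [coeFn_lpClass (hJ t ht), coeFn_lpClass (hJ t₀ ht₀)] with x h1 h2
  simp [h1, h2]

/-- A curve in `L²` whose values have pointwise time derivatives `G t x` that are uniformly bounded
and form a continuous curve in `L²` is differentiable in `L²`. The difference quotients are tested
against Schwartz functions, for which the mean value inequality gives a bound that is uniform on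
the unit ball of `L²`. -/
lemma hasDerivAt_lpClass {J : Set ℝ} (hJ : IsOpen J) {v G : ℝ → ℝ → ℂ} {K : ℝ}
    (hv : ∀ t ∈ J, MemLp (v t) 2 volume) (hG : ∀ t ∈ J, MemLp (G t) 2 volume)
    (hder : ∀ t ∈ J, ∀ x, HasDerivAt (fun s => v s x) (G t x) t)
    (hK : ∀ t ∈ J, ∀ x, ‖G t x‖ ≤ K) {t₀ : ℝ} (ht₀ : t₀ ∈ J)
    (hcont : ContinuousAt (fun t => lpClass (G t)) t₀) :
    HasDerivAt (fun t => lpClass (v t)) (lpClass (G t₀)) t₀ := by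
  have hinner : ∀ (η : SchwartzMap ℝ ℂ) {f : ℝ → ℂ}, MemLp f 2 volume →
      inner ℂ (η.toLp 2) (lpClass f) = ∫ x, f x * (starRingEnd ℂ) (η x) := by
    intro η f hf
    rw [L2.inner_def]
    refine integral_congr_ae ?_
    filter_upwards [coeFn_lpClass hf, η.coeFn_toLp 2 volume] with x h1 h2
    rw [h1, h2]
    simp
  have hηint : ∀ η : SchwartzMap ℝ ℂ, MemLp (fun x => (starRingEnd ℂ) (η x)) 2 volume :=
    fun η => (η.memLp 2 volume).star
  have hweak : ∀ (η : SchwartzMap ℝ ℂ), ∀ t ∈ J, HasDerivAt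
      (fun s => inner ℂ (η.toLp 2) (lpClass (v s))) (inner ℂ (η.toLp 2) (lpClass (G t))) t := by
    intro η t ht
    have hJt : J ∈ 𝓝 t := hJ.mem_nhds ht
    rw [hinner η (hG t ht)]
    have hD := hasDerivAt_integral_of_dominated_loc_of_deriv_le (μ := (volume : Measure ℝ))
      (F := fun s x => v s x * (starRingEnd ℂ) (η x))
      (F' := fun s x => G s x * (starRingEnd ℂ) (η x))
      (bound := fun x => K * ‖η x‖) (x₀ := t) (s := J) hJt
      (by filter_upwards [hJt] with s hs using
            (hv s hs).1.mul (hηint η).1)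
      (MemLp.integrable_mul (hv t ht) (hηint η))
      ((hG t ht).1.mul (hηint η).1)
      (Eventually.of_forall fun x s hs => by
        rw [norm_mul, RCLike.norm_conj]
        gcongr
        exact hK s hs x)
      (η.integrable.norm.const_mul K)
      (Eventually.of_forall fun x s hs => (hder s hs x).mul_const _)
    refine hD.2.congr_of_eventuallyEq ?_
    filter_upwards [hJt] with s hs
    exact hinner η (hv s hs)
  rw [hasDerivAt_iff_isLittleO, Asymptotics.isLittleO_iff]
  intro ε hε
  have hnear : ∀ᶠ s in 𝓝 t₀, s ∈ J ∧ ‖lpClass (G s) - lpClass (G t₀)‖ ≤ ε := by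
    refine (show ∀ᶠ s in 𝓝 t₀, s ∈ J from hJ.mem_nhds ht₀).and ?_
    have := Metric.tendsto_nhds.1 hcont ε hε
    filter_upwards [this] with s hs
    rw [← dist_eq_norm]; exact hs.le
  obtain ⟨δ, hδ, hball⟩ := Metric.eventually_nhds_iff_ball.1 hnear
  filter_upwards [Metric.ball_mem_nhds t₀ hδ] with s hs
  set d := lpClass (v s) - lpClass (v t₀) - (s - t₀) • lpClass (G t₀) with hd
  have hbound : ∀ e : Lp ℂ 2 (volume : Measure ℝ), ‖inner ℂ e d‖ ≤ ε * ‖s - t₀‖ * ‖e‖ := by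
    intro e
    refine (SchwartzMap.denseRange_toLpCLM (E := ℝ) (F := ℂ) (μ := volume) (p := 2)
      (by norm_num)).induction_on
      (p := fun e => ‖inner ℂ e d‖ ≤ ε * ‖s - t₀‖ * ‖e‖) e
      (isClosed_le (by fun_prop) (by fun_prop)) fun η => ?_
    rw [SchwartzMap.toLpCLM_apply]
    have hMV := (convex_ball t₀ δ).norm_image_sub_le_of_norm_hasDerivWithin_le
      (f := fun s => inner ℂ (η.toLp 2) (lpClass (v s)) -
        ((s - t₀ : ℝ) : ℂ) * inner ℂ (η.toLp 2) (lpClass (G t₀)))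
      (f' := fun s => inner ℂ (η.toLp 2) (lpClass (G s)) -
        1 * inner ℂ (η.toLp 2) (lpClass (G t₀))) (C := ε * ‖η.toLp 2‖)
      (fun r hr => by
        refine ((hweak η r (hball r hr).1).sub (HasDerivAt.mul_const ?_ _)).hasDerivWithinAt
        exact ((hasDerivAt_id r).sub_const t₀).ofReal_comp)
      (fun r hr => by
        rw [one_mul, ← inner_sub_right]
        refine (norm_inner_le_norm _ _).trans ?_
        rw [mul_comm]
        gcongr
        exact (hball r hr).2)
      (Metric.mem_ball_self hδ) hs
    refine le_of_eq_of_le ?_ (hMV.trans (le_of_eq (by ring)))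
    congr 1
    rw [hd, inner_sub_right, inner_sub_right, inner_smul_right_eq_smul]
    simp only [Complex.real_smul, sub_self, Complex.ofReal_zero, zero_mul, sub_zero]
    ring
  have hdd := hbound d
  rw [inner_self_eq_norm_sq_to_K] at hdd
  have : ‖d‖ * ‖d‖ ≤ (ε * ‖s - t₀‖) * ‖d‖ := by
    simpa [sq] using hdd
  rcases (norm_nonneg d).eq_or_lt with h0 | h0
  · rw [← h0]; positivity
  · exact le_of_mul_le_mul_right this h0

/-! ### The equation in `L²` -/

/-- The cubic nonlinearity `z ↦ |z|² z`. -/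
def cubic (z : ℂ) : ℂ := ((‖z‖ ^ 2 : ℝ) : ℂ) * z

lemma cubic_eq (z : ℂ) : cubic z = z * ((starRingEnd ℂ) z * z) := by
  rw [cubic, ← mul_assoc, Complex.mul_conj, Complex.normSq_eq_norm_sq]

@[fun_prop]
lemma continuous_cubic : Continuous cubic := by
  unfold cubic; fun_prop

lemma norm_cubic (z : ℂ) : ‖cubic z‖ = ‖z‖ ^ 3 := by
  rw [cubic, norm_mul, Complex.norm_real, Real.norm_of_nonneg (by positivity)]
  ring

lemma norm_cubic_sub_le {K : ℝ} {z w : ℂ} (hz : ‖z‖ ≤ K) (hw : ‖w‖ ≤ K) :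
    ‖cubic z - cubic w‖ ≤ 3 * K ^ 2 * ‖z - w‖ := by
  have hK : 0 ≤ K := (norm_nonneg z).trans hz
  have e : cubic z - cubic w = ((‖z‖ ^ 2 : ℝ) : ℂ) * (z - w) +
      ((‖z‖ ^ 2 - ‖w‖ ^ 2 : ℝ) : ℂ) * w := by
    simp only [cubic]; push_cast; ring
  have h1 : |‖z‖ ^ 2 - ‖w‖ ^ 2| ≤ ‖z - w‖ * (2 * K) := by
    rw [show ‖z‖ ^ 2 - ‖w‖ ^ 2 = (‖z‖ - ‖w‖) * (‖z‖ + ‖w‖) by ring, abs_mul]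
    refine mul_le_mul (abs_norm_sub_norm_le z w) ?_ (abs_nonneg _) (norm_nonneg _)
    rw [abs_of_nonneg (by positivity)]
    linarith
  rw [e]
  refine (norm_add_le _ _).trans ?_
  rw [norm_mul, norm_mul, Complex.norm_real, Complex.norm_real, Real.norm_eq_abs,
    Real.norm_eq_abs, abs_of_nonneg (sq_nonneg ‖z‖)]
  calc ‖z‖ ^ 2 * ‖z - w‖ + |‖z‖ ^ 2 - ‖w‖ ^ 2| * ‖w‖
      ≤ K ^ 2 * ‖z - w‖ + ‖z - w‖ * (2 * K) * K := by gcongr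
    _ = _ := by ring

lemma memLp_cubic {f : ℝ → ℂ} (hf : MemLp f 2 volume) {K : ℝ} (hK : ∀ x, ‖f x‖ ≤ K) :
    MemLp (fun x => cubic (f x)) 2 volume := by
  refine MemLp.of_le_mul (c := K ^ 2) hf
    (continuous_cubic.comp_aestronglyMeasurable hf.1) (Eventually.of_forall fun x => ?_)
  rw [norm_cubic, pow_succ]
  gcongr
  exact hK x

lemma lpClass_add {f g : ℝ → ℂ} (hf : MemLp f 2 volume) (hg : MemLp g 2 volume) :
    lpClass (f + g) = lpClass f + lpClass g := by
  rw [lpClass_eq hf, lpClass_eq hg, lpClass_eq (hf.add hg), MemLp.toLp_add]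

lemma lpClass_smul {f : ℝ → ℂ} (c : ℂ) (hf : MemLp f 2 volume) :
    lpClass (c • f) = c • lpClass f := by
  rw [lpClass_eq hf, lpClass_eq (hf.const_smul c), MemLp.toLp_const_smul]

lemma fourierLp_eq_lpClass {f : ℝ → ℂ} (hf : MemLp f 2 volume) :
    fourierLp f hf = ⇑(𝓕 (lpClass f) : Lp ℂ 2 (volume : Measure ℝ)) := by
  rw [lpClass_eq hf, fourierLp]

section Solution

variable {T ω : ℝ} {ζ₀ : ℝ → ℝ} {u₀ : ℝ → ℂ} {u : ℝ → ℝ → ℂ}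

lemma IsSmoothSolution.hasDerivAt_time (hu : IsSmoothSolution T ω ζ₀ u₀ u) {t : ℝ}
    (ht : t ∈ Ioo (-2 * T) (2 * T)) (x : ℝ) :
    HasDerivAt (fun s => u s x)
      (Complex.I * (iteratedDeriv 2 (u t) x + ((ζ₀ t * ω : ℝ) : ℂ) * cubic (u t x))) t := by
  have h1 := (hu.differentiable_time t ht x).hasDerivAt
  have h2 := hu.equation t ht x
  convert! h1 using 1
  rw [cubic]
  push_cast at h2 ⊢
  linear_combination Complex.I * h2 -
    (deriv (fun s => u s x) t) * Complex.I_mul_I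

lemma IsSmoothSolution.memLp (hu : IsSmoothSolution T ω ζ₀ u₀ u) {t : ℝ}
    (ht : t ∈ Icc (-2 * T) (2 * T)) : MemLp (u t) 2 volume :=
  memLp_of_sobolevNorm_lt_top (hu.continuous_sobolev.finite t ht)

lemma IsSmoothSolution.exists_bound (hu : IsSmoothSolution T ω ζ₀ u₀ u) :
    ∃ K : ℝ, 0 ≤ K ∧ ∀ t ∈ Icc (-2 * T) (2 * T), ∀ k ≤ 2,
      (∀ x, ‖iteratedDeriv k (u t) x‖ ≤ K) ∧
      MemLp (iteratedDeriv k (u t)) 2 volume ∧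
      eLpNorm (iteratedDeriv k (u t)) 2 volume ≤ ENNReal.ofReal K :=
  exists_bound_iteratedDeriv isCompact_Icc hu.continuous_sobolev hu.contDiff_space

lemma IsSmoothSolution.memLp_cubic (hu : IsSmoothSolution T ω ζ₀ u₀ u) {t : ℝ}
    (ht : t ∈ Icc (-2 * T) (2 * T)) : MemLp (fun x => cubic (u t x)) 2 volume := by
  obtain ⟨K, -, hK⟩ := hu.exists_bound
  exact NLS.memLp_cubic (hu.memLp ht) (K := K) (by simpa using (hK t ht 0 (by norm_num)).1)

lemma IsSmoothSolution.continuousOn_lpClass (hu : IsSmoothSolution T ω ζ₀ u₀ u) {k : ℕ}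
    (hk : k ≤ 2) :
    ContinuousOn (fun t => lpClass (iteratedDeriv k (u t))) (Icc (-2 * T) (2 * T)) := by
  obtain ⟨K, -, hK⟩ := hu.exists_bound
  exact fun t₀ ht₀ => continuousAt_lpClass (fun t ht => (hK t ht k hk).2.1) ht₀
    (tendsto_enorm_iteratedDeriv_sub hu.continuous_sobolev hu.contDiff_space hk ht₀).2

lemma IsSmoothSolution.continuousOn_lpClass_cubic (hu : IsSmoothSolution T ω ζ₀ u₀ u) :
    ContinuousOn (fun t => lpClass (fun x => cubic (u t x))) (Icc (-2 * T) (2 * T)) := by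
  obtain ⟨K, hK0, hK⟩ := hu.exists_bound
  have hsup : ∀ t ∈ Icc (-2 * T) (2 * T), ∀ x, ‖u t x‖ ≤ K := fun t ht => by
    simpa using (hK t ht 0 (by norm_num)).1
  intro t₀ ht₀
  refine continuousAt_lpClass (v := fun t x => cubic (u t x))
    (fun t ht => hu.memLp_cubic ht) ht₀ ?_
  have h := (tendsto_enorm_iteratedDeriv_sub hu.continuous_sobolev hu.contDiff_space
    (k := 0) (by norm_num) ht₀).2
  simp only [iteratedDeriv_zero] at h
  have h' : Tendsto (fun t => ENNReal.ofReal (3 * K ^ 2) * eLpNorm (u t - u t₀) 2 volume)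
      (𝓝[Icc (-2 * T) (2 * T)] t₀) (𝓝 0) := by
    have := ENNReal.Tendsto.const_mul (a := ENNReal.ofReal (3 * K ^ 2)) h
      (Or.inr ENNReal.ofReal_ne_top)
    rwa [mul_zero] at this
  refine tendsto_of_tendsto_of_tendsto_of_le_of_le' tendsto_const_nhds h'
    (Eventually.of_forall fun _ => zero_le) ?_
  filter_upwards [self_mem_nhdsWithin] with t ht
  exact eLpNorm_le_mul_eLpNorm_of_ae_le_mul
    (Eventually.of_forall fun x => norm_cubic_sub_le (hsup t ht x) (hsup t₀ ht₀ x)) 2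

/-- The equation holds in `L²`: the solution is differentiable as a curve in `L²`, with derivative
`i (u_xx + ζ₀ ω |u|² u)`. -/
lemma IsSmoothSolution.hasDerivAt_lpClass (hu : IsSmoothSolution T ω ζ₀ u₀ u)
    (hζ : Continuous ζ₀) {t : ℝ} (ht : t ∈ Ioo (-2 * T) (2 * T)) :
    HasDerivAt (fun t => lpClass (u t)) (Complex.I • (lpClass (iteratedDeriv 2 (u t)) +
      ((ζ₀ t * ω : ℝ) : ℂ) • lpClass (fun x => cubic (u t x)))) t := by
  obtain ⟨K, hK0, hK⟩ := hu.exists_bound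
  have hsub : Ioo (-2 * T) (2 * T) ⊆ Icc (-2 * T) (2 * T) := Ioo_subset_Icc_self
  set G : ℝ → ℝ → ℂ := fun t => Complex.I • (iteratedDeriv 2 (u t) +
      ((ζ₀ t * ω : ℝ) : ℂ) • fun x => cubic (u t x)) with hG
  have hm2 : ∀ t ∈ Ioo (-2 * T) (2 * T), MemLp (iteratedDeriv 2 (u t)) 2 volume :=
    fun t ht => (hK t (hsub ht) 2 le_rfl).2.1
  have hm3 : ∀ t ∈ Ioo (-2 * T) (2 * T), MemLp (fun x => cubic (u t x)) 2 volume :=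
    fun t ht => hu.memLp_cubic (hsub ht)
  have hmG : ∀ t ∈ Ioo (-2 * T) (2 * T), MemLp (G t) 2 volume := fun t ht =>
    ((hm2 t ht).add ((hm3 t ht).const_smul _)).const_smul _
  have hGeq : ∀ t ∈ Ioo (-2 * T) (2 * T), lpClass (G t) =
      Complex.I • (lpClass (iteratedDeriv 2 (u t)) +
      ((ζ₀ t * ω : ℝ) : ℂ) • lpClass (fun x => cubic (u t x))) := by
    intro t ht
    rw [hG, lpClass_smul _ ((hm2 t ht).add ((hm3 t ht).const_smul _)),
      lpClass_add (hm2 t ht) ((hm3 t ht).const_smul _), lpClass_smul _ (hm3 t ht)]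
  obtain ⟨Z, hZ⟩ := (isCompact_Icc (a := -2 * T) (b := 2 * T)).exists_bound_of_continuousOn
    hζ.continuousOn
  rw [← hGeq t ht]
  refine NLS.hasDerivAt_lpClass (J := Ioo (-2 * T) (2 * T)) (G := G) isOpen_Ioo
    (K := K + Z * |ω| * K ^ 3)
    (fun t ht => hu.memLp (hsub ht)) hmG (fun t ht x => ?_) (fun t ht x => ?_) ht ?_
  · simpa [hG, mul_add] using hu.hasDerivAt_time ht x
  · have h1 := (hK t (hsub ht) 2 le_rfl).1 x
    have h2 := (hK t (hsub ht) 0 (by norm_num)).1 x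
    rw [iteratedDeriv_zero] at h2
    have h3 := hZ t (hsub ht)
    rw [Real.norm_eq_abs] at h3
    simp only [hG, Pi.smul_apply, Pi.add_apply, smul_eq_mul, norm_mul, Complex.norm_I, one_mul]
    refine (norm_add_le _ _).trans ?_
    rw [norm_mul, norm_cubic, Complex.norm_real, Real.norm_eq_abs, abs_mul]
    have : 0 ≤ Z := (abs_nonneg _).trans h3
    gcongr
  · have hn : Icc (-2 * T) (2 * T) ∈ 𝓝 t := Icc_mem_nhds ht.1 ht.2
    have c1 := (hu.continuousOn_lpClass (k := 2) le_rfl).continuousAt hn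
    have c2 := hu.continuousOn_lpClass_cubic.continuousAt hn
    have c3 : ContinuousAt (fun t => ((ζ₀ t * ω : ℝ) : ℂ)) t := by fun_prop
    refine ((c1.add (c3.smul c2)).const_smul Complex.I).congr ?_
    filter_upwards [isOpen_Ioo.mem_nhds ht] with r hr
    exact (hGeq r hr).symm

end Solution

/-! ### The energy identity -/

/-- The spatial symbol `⟨2πv⟩^{s}`, which is bounded for `s ≤ 0`. -/
def sobolevWeight (s v : ℝ) : ℝ := bracket (2 * Real.pi * v) ^ s

lemma sobolevWeight_pos (s v : ℝ) : 0 < sobolevWeight s v := Real.rpow_pos_of_pos (bracket_pos _) _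

lemma sobolevWeight_le_one {s : ℝ} (hs : s ≤ 0) (v : ℝ) : sobolevWeight s v ≤ 1 :=
  Real.rpow_le_one_of_one_le_of_nonpos (one_le_bracket _) hs

@[fun_prop]
lemma measurable_sobolevWeight (s : ℝ) : Measurable (sobolevWeight s) := by
  unfold sobolevWeight; fun_prop

lemma memLp_sobolevWeight {s : ℝ} (hs : s ≤ 0) :
    MemLp (fun v => (sobolevWeight s v : ℂ)) ∞ (volume : Measure ℝ) := by
  refine memLp_top_of_bound (C := 1) ?_ (Eventually.of_forall fun v => ?_)
  · exact (Complex.measurable_ofReal.comp (measurable_sobolevWeight s)).aestronglyMeasurable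
  · rw [Complex.norm_real, Real.norm_of_nonneg (sobolevWeight_pos s v).le]
    exact sobolevWeight_le_one hs v

/-- The operator `⟨D⟩^s` followed by the Fourier transform, as a bounded operator on `L²`,
for `s ≤ 0`. -/
def weightedFourier {s : ℝ} (hs : s ≤ 0) :
    Lp ℂ 2 (volume : Measure ℝ) →L[ℂ] Lp ℂ 2 (volume : Measure ℝ) :=
  ((ContinuousLinearMap.mul ℂ ℂ).holderL volume ∞ 2 2 (memLp_sobolevWeight hs).toLp) ∘L
    (Lp.fourierTransformₗᵢ ℝ ℂ).toContinuousLinearEquiv.toContinuousLinearMap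

lemma coeFn_weightedFourier {s : ℝ} (hs : s ≤ 0) (f : Lp ℂ 2 (volume : Measure ℝ)) :
    weightedFourier hs f =ᵐ[volume]
      fun v => (sobolevWeight s v : ℂ) * (𝓕 f : Lp ℂ 2 (volume : Measure ℝ)) v := by
  have h : weightedFourier hs f = (ContinuousLinearMap.mul ℂ ℂ).holder 2
      (memLp_sobolevWeight hs).toLp (𝓕 f : Lp ℂ 2 (volume : Measure ℝ)) := rfl
  rw [h]
  filter_upwards [(ContinuousLinearMap.mul ℂ ℂ).coeFn_holder (r := 2)
    (memLp_sobolevWeight hs).toLp (𝓕 f : Lp ℂ 2 (volume : Measure ℝ)),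
    (memLp_sobolevWeight hs).coeFn_toLp] with v h1 h2
  rw [h1, h2]
  rfl

lemma sobolevNorm_toReal_sq {s : ℝ} (hs : s ≤ 0) {f : ℝ → ℂ} (hf : MemLp f 2 volume) :
    (sobolevNorm s f).toReal ^ 2 = 2 * Real.pi * ‖weightedFourier hs (lpClass f)‖ ^ 2 := by
  have h : sobolevNorm s f ^ 2 = ENNReal.ofReal (2 * Real.pi) *
      (eLpNorm (weightedFourier hs (lpClass f)) 2 volume) ^ 2 := by
    rw [sobolevNorm_sq s hf, eLpNorm_congr_ae (coeFn_weightedFourier hs _),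
      eLpNorm_eq_lintegral_rpow_enorm_toReal (by norm_num) (by norm_num),
      ← ENNReal.rpow_natCast, ← ENNReal.rpow_mul, fourierLp_eq_lpClass]
    norm_num
    congr 1
    refine lintegral_congr fun v => ?_
    have h0 := (sobolevWeight_pos s v).le
    rw [← ofReal_norm ((sobolevWeight s v : ℝ) : ℂ), Complex.norm_real, Real.norm_of_nonneg h0,
      mul_pow, mul_comm, ← ENNReal.ofReal_pow h0, sobolevWeight,
      ← Real.rpow_natCast, ← Real.rpow_mul (bracket_pos _).le]
    norm_num [mul_comm]
  rw [← ENNReal.toReal_pow, h, ENNReal.toReal_mul, ENNReal.toReal_pow,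
    ENNReal.toReal_ofReal Real.two_pi_pos.le, Lp.norm_def]

section Solution

variable {T ω : ℝ} {ζ₀ : ℝ → ℝ} {u₀ : ℝ → ℂ} {u : ℝ → ℝ → ℂ}

/-- The imaginary part of the pairing of `f` and `|f|² f` in `H^s`. At `f = u(t)` it is, up to the
factor `-4πω ζ₀(t)`, the rate of change of `‖u(t)‖²_{H^s}` along the flow. -/
def energyRate (s : ℝ) (f : ℝ → ℂ) : ℝ :=
  ∫ v, ((sobolevWeight s v ^ 2 : ℝ) * ((starRingEnd ℂ)
    ((𝓕 (lpClass f) : Lp ℂ 2 (volume : Measure ℝ)) v) *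
    (𝓕 (lpClass fun x => cubic (f x)) : Lp ℂ 2 (volume : Measure ℝ)) v)).im

lemma IsSmoothSolution.continuousOn_energy (hu : IsSmoothSolution T ω ζ₀ u₀ u) {s : ℝ}
    (hs : s ≤ 0) :
    ContinuousOn (fun t => (sobolevNorm s (u t)).toReal ^ 2) (Icc (-2 * T) (2 * T)) := by
  have h1 := hu.continuousOn_lpClass (k := 0) (by norm_num)
  simp only [iteratedDeriv_zero] at h1
  have h2 : ContinuousOn (fun t => 2 * Real.pi * ‖weightedFourier hs (lpClass (u t))‖ ^ 2)
      (Icc (-2 * T) (2 * T)) := by fun_prop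
  exact h2.congr fun t ht => sobolevNorm_toReal_sq hs (hu.memLp ht)

/-- The dispersive term drops out since the multiplier `iξ²` is skew-adjoint. -/
lemma IsSmoothSolution.hasDerivAt_energy (hu : IsSmoothSolution T ω ζ₀ u₀ u)
    (hζ : Continuous ζ₀) {s : ℝ} (hs : s ≤ 0) {t : ℝ} (ht : t ∈ Ioo (-2 * T) (2 * T)) :
    HasDerivAt (fun t => (sobolevNorm s (u t)).toReal ^ 2)
      (-(4 * Real.pi * ω) * (ζ₀ t * energyRate s (u t))) t := by
  have hsub : Ioo (-2 * T) (2 * T) ⊆ Icc (-2 * T) (2 * T) := Ioo_subset_Icc_self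
  have hD := hu.hasDerivAt_lpClass hζ ht
  set D := Complex.I • (lpClass (iteratedDeriv 2 (u t)) +
      ((ζ₀ t * ω : ℝ) : ℂ) • lpClass (fun x => cubic (u t x))) with hDdef
  have hP : HasDerivAt (fun t => weightedFourier hs (lpClass (u t)))
      (weightedFourier hs D) t :=
    ((weightedFourier hs).restrictScalars ℝ).hasFDerivAt.comp_hasDerivAt t hD
  have hN := (hP.inner ℂ hP)
  have hre := (Complex.reCLM.hasFDerivAt.comp_hasDerivAt t hN).const_mul (2 * Real.pi)
  have hEq : (fun t => (sobolevNorm s (u t)).toReal ^ 2) =ᶠ[𝓝 t] fun t => 2 * Real.pi *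
      (Complex.reCLM ∘ fun t => inner ℂ (weightedFourier hs (lpClass (u t)))
        (weightedFourier hs (lpClass (u t)))) t := by
    filter_upwards [isOpen_Ioo.mem_nhds ht] with r hr
    rw [sobolevNorm_toReal_sq hs (hu.memLp (hsub hr))]
    simp only [Function.comp, Complex.reCLM_apply]
    rw [inner_self_eq_norm_sq_to_K]
    norm_cast
  refine (hre.congr_of_eventuallyEq hEq).congr_deriv ?_
  rw [← inner_conj_symm (weightedFourier hs D)]
  simp only [Complex.reCLM_apply, Complex.add_re, Complex.conj_re]
  have hmain : (inner ℂ (weightedFourier hs (lpClass (u t))) (weightedFourier hs D)).re =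
      -(ζ₀ t * ω) * energyRate s (u t) := by
    obtain ⟨K, -, hK⟩ := hu.exists_bound
    obtain ⟨C, -, hS⟩ := exists_sobolev_bound
    obtain ⟨-, -, h2, hft⟩ := hS _ (hu.contDiff_space t (hsub ht)) (hu.memLp (hsub ht))
      (hu.continuous_sobolev.finite t (hsub ht)) 2 le_rfl
    rw [fourierLp_eq_lpClass, fourierLp_eq_lpClass] at hft
    have hint : Integrable (fun v => inner ℂ (weightedFourier hs (lpClass (u t)) v)
      (weightedFourier hs D v)) := L2.integrable_inner _ _
    rw [L2.inner_def, ← Complex.reCLM_apply, ← ContinuousLinearMap.integral_comp_comm _ hint,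
      energyRate, ← integral_const_mul]
    refine integral_congr_ae ?_
    have hFD : (𝓕 D : Lp ℂ 2 (volume : Measure ℝ)) =
        Complex.I • ((𝓕 (lpClass (iteratedDeriv 2 (u t))) : Lp ℂ 2 (volume : Measure ℝ)) +
        ((ζ₀ t * ω : ℝ) : ℂ) • (𝓕 (lpClass (fun x => cubic (u t x))) : Lp ℂ 2 volume)) := by
      rw [hDdef, FourierTransform.fourier_smul, FourierTransform.fourier_add,
        FourierTransform.fourier_smul]
    have e1 := coeFn_weightedFourier hs D
    rw [hFD] at e1
    filter_upwards [hft, coeFn_weightedFourier hs (lpClass (u t)), e1,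
      Lp.coeFn_smul Complex.I
        ((𝓕 (lpClass (iteratedDeriv 2 (u t))) : Lp ℂ 2 (volume : Measure ℝ)) +
        ((ζ₀ t * ω : ℝ) : ℂ) • (𝓕 (lpClass (fun x => cubic (u t x))) : Lp ℂ 2 volume)),
      Lp.coeFn_add (𝓕 (lpClass (iteratedDeriv 2 (u t))) : Lp ℂ 2 (volume : Measure ℝ))
        (((ζ₀ t * ω : ℝ) : ℂ) • (𝓕 (lpClass (fun x => cubic (u t x))) : Lp ℂ 2 volume)),
      Lp.coeFn_smul ((ζ₀ t * ω : ℝ) : ℂ)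
        (𝓕 (lpClass (fun x => cubic (u t x))) : Lp ℂ 2 (volume : Measure ℝ))]
      with v a1 a2 a3 a4 a5 a6
    rw [a2, a3, a4]
    simp only [Pi.smul_apply]
    rw [a5]
    simp only [Pi.add_apply]
    rw [a6, a1]
    simp only [Pi.smul_apply, smul_eq_mul, RCLike.inner_apply, Complex.reCLM_apply, map_mul,
      Complex.conj_ofReal]
    generalize (𝓕 (lpClass (u t)) : Lp ℂ 2 (volume : Measure ℝ)) v = a
    generalize (𝓕 (lpClass (fun x => cubic (u t x))) : Lp ℂ 2 (volume : Measure ℝ)) v = n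
    simp only [Complex.mul_re, Complex.mul_im, Complex.add_re, Complex.add_im, Complex.I_re,
      Complex.I_im, Complex.ofReal_re, Complex.ofReal_im, Complex.conj_re, Complex.conj_im, sq,
      Complex.re_ofNat, Complex.im_ofNat]
    ring
  rw [hmain]
  ring

/-- The `H^s` energy of a solution is the time integral of `energyRate`. -/
lemma IsSmoothSolution.energy_sub (hu : IsSmoothSolution T ω ζ₀ u₀ u)
    (hζ : Continuous ζ₀) {s : ℝ} (hs : s ≤ 0) (hT : 0 < T) {t : ℝ}
    (ht : t ∈ Icc (-2 * T) (2 * T))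
    (hint : IntervalIntegrable (fun r => ζ₀ r * energyRate s (u r)) volume 0 t) :
    (sobolevNorm s (u t)).toReal ^ 2 - (sobolevNorm s u₀).toReal ^ 2 =
      -(4 * Real.pi * ω) * ∫ r in (0)..t, ζ₀ r * energyRate s (u r) := by
  have h0 : (0 : ℝ) ∈ Icc (-2 * T) (2 * T) := ⟨by linarith, by linarith⟩
  have hsub : uIcc 0 t ⊆ Icc (-2 * T) (2 * T) := uIcc_subset_Icc h0 ht
  rw [← intervalIntegral.integral_const_mul]
  have h := intervalIntegral.integral_eq_sub_of_hasDeriv_right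
    ((hu.continuousOn_energy hs).mono hsub)
    (fun r hr => ((hu.hasDerivAt_energy hζ hs (t := r)
      ⟨?_, ?_⟩).hasDerivWithinAt)) (hint.const_mul _)
  · rw [h, hu.initial]
  · exact (le_min h0.1 ht.1).trans_lt hr.1
  · exact hr.2.trans_le (max_le h0.2 ht.2)

end Solution

/-! ### The quartic symbol -/

lemma abs_bracket_sub_le (x y : ℝ) : |bracket x - bracket y| ≤ |x - y| := by
  have hx := bracket_pos x
  have hy := bracket_pos y
  have h : (bracket x - bracket y) * (bracket x + bracket y) = (x - y) * (x + y) := by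
    have h1 : bracket x ^ 2 = 1 + x ^ 2 := Real.sq_sqrt (by positivity)
    have h2 : bracket y ^ 2 = 1 + y ^ 2 := Real.sq_sqrt (by positivity)
    linear_combination h1 - h2
  have h3 : |bracket x - bracket y| * (bracket x + bracket y) = |x - y| * |x + y| := by
    rw [← abs_mul, ← h, abs_mul, abs_of_pos (add_pos hx hy)]
  have h4 : |x + y| ≤ bracket x + bracket y :=
    (abs_add_le x y).trans (add_le_add (abs_le_bracket x) (abs_le_bracket y))
  have h5 : |x - y| * |x + y| ≤ |x - y| * (bracket x + bracket y) := by gcongr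
  exact le_of_mul_le_mul_right (h3.le.trans h5) (add_pos hx hy)

/-- For `-1 ≤ q ≤ 0` the power `X ^ q` varies at most at the rate `1 / max X Y`. -/
lemma abs_rpow_sub_mul_max_le {q X Y : ℝ} (hq : q ∈ Icc (-1 : ℝ) 0) (hX : 1 ≤ X) (hY : 1 ≤ Y) :
    |X ^ q - Y ^ q| * max X Y ≤ |X - Y| := by
  wlog h : Y ≤ X generalizing X Y
  · rw [abs_sub_comm, max_comm, abs_sub_comm X]
    exact this hY hX (le_of_not_ge h)
  have hX0 : 0 < X := by linarith
  have hY0 : 0 < Y := by linarith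
  have h1 : X ^ q ≤ Y ^ q := Real.rpow_le_rpow_of_nonpos hY0 h hq.2
  rw [max_eq_left h, abs_sub_comm, abs_of_nonneg (sub_nonneg.2 h1), abs_of_nonneg (sub_nonneg.2 h)]
  have h2 : Y ^ q ≤ 1 := Real.rpow_le_one_of_one_le_of_nonpos hY hq.2
  have h3 : Y ^ q * Y ≤ X ^ q * X := by
    rw [← Real.rpow_add_one hY0.ne', ← Real.rpow_add_one hX0.ne']
    exact Real.rpow_le_rpow hY0.le h (by linarith [hq.1])
  nlinarith

/-- The weight left over from the symbol and the Sobolev weights, as a function of the frequency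
differences `a = x₁ - x₂` and `c = x₁ - x₄`. -/
def gapWeight (δ a c : ℝ) : ℝ := |a| * ((1 + |a|) * (1 + |c|)) ^ (-δ)

lemma gapWeight_nonneg (δ a c : ℝ) : 0 ≤ gapWeight δ a c := by
  unfold gapWeight; positivity

@[fun_prop]
lemma _root_.Measurable.gapWeight {S : Type*} [MeasurableSpace S] (δ : ℝ) {a c : S → ℝ}
    (ha : Measurable a) (hc : Measurable c) : Measurable fun x => gapWeight δ (a x) (c x) := by
  unfold NLS.gapWeight; fun_prop

/-- The bound on the quartic symbol. With `N = max ⟨x₁⟩ ⟨x₄⟩ + |x₁ - x₂|`, which dominates all four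
`⟨xⱼ⟩`, the difference of the symbols at `x₄` and `x₁` is at most `(|x₁ - x₂| + |x₁ - x₄|) / N`, and
the four Sobolev weights lose at most `N^{-4r}`. Since `r > -1/4`, a negative power of `N` is left,
and it is at most a multiple of the decay factor of `gapWeight`. -/
lemma symbol_bound {q r : ℝ} (hq : q ∈ Icc (-1 : ℝ) 0) (hr : -1 / 4 < r) (hr0 : r ≤ 0)
    {x₁ x₂ x₃ x₄ : ℝ} (h : x₃ = x₂ + x₄ - x₁) :
    |bracket x₄ ^ q - bracket x₁ ^ q| ≤ 9 ^ ((1 + 4 * r) / 2) *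
      (gapWeight ((1 + 4 * r) / 2) (x₁ - x₂) (x₁ - x₄) +
        gapWeight ((1 + 4 * r) / 2) (x₁ - x₄) (x₁ - x₂)) *
      (bracket x₁ ^ r * bracket x₂ ^ r * bracket x₃ ^ r * bracket x₄ ^ r) := by
  set δ := (1 + 4 * r) / 2 with hδ
  have hδ0 : 0 < δ := by rw [hδ]; linarith
  set a := x₁ - x₂ with ha
  set c := x₁ - x₄ with hc
  set N := max (bracket x₁) (bracket x₄) + |a| with hN
  have b1 := one_le_bracket x₁
  have b4 := one_le_bracket x₄
  have hN1 : 1 ≤ N := by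
    have : bracket x₁ ≤ max (bracket x₁) (bracket x₄) := le_max_left _ _
    have := abs_nonneg a
    linarith
  have hN0 : 0 < N := by linarith
  have e1 : bracket x₁ ≤ N := (le_max_left _ _).trans (le_add_of_nonneg_right (abs_nonneg _))
  have e4 : bracket x₄ ≤ N := (le_max_right _ _).trans (le_add_of_nonneg_right (abs_nonneg _))
  have e2 : bracket x₂ ≤ N := by
    have h1 := (le_abs_self _).trans (abs_bracket_sub_le x₂ x₁)
    have h2 : bracket x₁ ≤ max (bracket x₁) (bracket x₄) := le_max_left _ _
    rw [abs_sub_comm] at h1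
    linarith
  have e3 : bracket x₃ ≤ N := by
    have h1 := (le_abs_self _).trans (abs_bracket_sub_le x₃ x₄)
    have h2 : bracket x₄ ≤ max (bracket x₁) (bracket x₄) := le_max_right _ _
    rw [abs_sub_comm, show x₄ - x₃ = a by rw [h, ha]; ring] at h1
    linarith
  have hsym : |bracket x₄ ^ q - bracket x₁ ^ q| * N ≤ |a| + |c| := by
    have h1 := abs_rpow_sub_mul_max_le hq b4 b1
    have h2 := abs_bracket_sub_le x₄ x₁
    rw [abs_sub_comm x₄ x₁] at h2
    have h3 : |bracket x₄ ^ q - bracket x₁ ^ q| ≤ 1 := by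
      have p1 := Real.rpow_le_one_of_one_le_of_nonpos b1 hq.2
      have p4 := Real.rpow_le_one_of_one_le_of_nonpos b4 hq.2
      have q1 := Real.rpow_nonneg (bracket_pos x₁).le q
      have q4 := Real.rpow_nonneg (bracket_pos x₄).le q
      rw [abs_le]; constructor <;> linarith
    rw [hN, mul_add, max_comm]
    have h4 := mul_le_mul_of_nonneg_right h3 (abs_nonneg a)
    linarith
  have hprod : N ^ (4 * r) ≤
      bracket x₁ ^ r * bracket x₂ ^ r * bracket x₃ ^ r * bracket x₄ ^ r := by
    have hm : ∀ x, bracket x ≤ N → N ^ r ≤ bracket x ^ r := fun x hx =>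
      Real.rpow_le_rpow_of_nonpos (bracket_pos x) hx hr0
    have hNr : N ^ (4 * r) = N ^ r * N ^ r * N ^ r * N ^ r := by
      rw [← Real.rpow_add hN0, ← Real.rpow_add hN0, ← Real.rpow_add hN0]
      congr 1; ring
    have hp := Real.rpow_nonneg hN0.le r
    have hb : ∀ x, 0 ≤ bracket x ^ r := fun x => Real.rpow_nonneg (bracket_pos x).le r
    rw [hNr]
    have := hb x₁; have := hb x₂; have := hb x₃; have := hb x₄
    have := hm _ e1; have := hm _ e2; have := hm _ e3; have := hm _ e4
    generalize N ^ r = n at *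
    generalize bracket x₁ ^ r = y₁ at *
    generalize bracket x₂ ^ r = y₂ at *
    generalize bracket x₃ ^ r = y₃ at *
    generalize bracket x₄ ^ r = y₄ at *
    gcongr
  have hgap : (N ^ 2) ^ (-δ) ≤ 9 ^ δ * ((1 + |a|) * (1 + |c|)) ^ (-δ) := by
    have p1 : 1 + |a| ≤ 3 * N := by
      have : 0 ≤ max (bracket x₁) (bracket x₄) := (bracket_pos x₁).le.trans (le_max_left _ _)
      linarith
    have p2 : 1 + |c| ≤ 3 * N := by
      have i1 := (abs_le_bracket x₁).trans e1
      have i4 := (abs_le_bracket x₄).trans e4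
      have := abs_sub x₁ x₄
      linarith
    have p3 : (1 + |a|) * (1 + |c|) ≤ 9 * N ^ 2 := by
      calc _ ≤ (3 * N) * (3 * N) := by gcongr
        _ = _ := by ring
    have p4 := Real.rpow_le_rpow_of_nonpos (by positivity) p3 (neg_nonpos.2 hδ0.le)
    rw [Real.mul_rpow (by norm_num) (by positivity)] at p4
    calc (N ^ 2) ^ (-δ) = 9 ^ δ * (9 ^ (-δ) * (N ^ 2) ^ (-δ)) := by
          rw [← mul_assoc, ← Real.rpow_add (by norm_num)]; simp
      _ ≤ _ := by gcongr
  have hsum : gapWeight δ a c + gapWeight δ c a =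
      (|a| + |c|) * ((1 + |a|) * (1 + |c|)) ^ (-δ) := by
    rw [gapWeight, gapWeight, mul_comm (1 + |c|)]; ring
  have hNpow : N ^ (-1 : ℝ) = (N ^ 2) ^ (-δ) * N ^ (4 * r) := by
    rw [← Real.rpow_natCast, ← Real.rpow_mul hN0.le, ← Real.rpow_add hN0, hδ]
    congr 1; push_cast; ring
  rw [hsum]
  calc |bracket x₄ ^ q - bracket x₁ ^ q|
      = |bracket x₄ ^ q - bracket x₁ ^ q| * N * N ^ (-1 : ℝ) := by
        rw [Real.rpow_neg_one]; field_simp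
    _ ≤ (|a| + |c|) * ((N ^ 2) ^ (-δ) * N ^ (4 * r)) := by
        rw [hNpow]; gcongr
    _ ≤ (|a| + |c|) * ((9 ^ δ * ((1 + |a|) * (1 + |c|)) ^ (-δ)) *
        (bracket x₁ ^ r * bracket x₂ ^ r * bracket x₃ ^ r * bracket x₄ ^ r)) := by
        gcongr
    _ = _ := by ring

lemma lintegral_comp_affine (f : ℝ → ℝ≥0∞) {k : ℝ} (hk : k ≠ 0) (d : ℝ) :
    ENNReal.ofReal |k| * ∫⁻ x, f (k * x + d) = ∫⁻ y, f y := by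
  have h := (Homeomorph.mulLeft₀ k hk).measurableEmbedding.lintegral_map
    (μ := (volume : Measure ℝ)) (fun y => f (y + d))
  have h2 : (⇑(Homeomorph.mulLeft₀ k hk) : ℝ → ℝ) = (k * ·) := rfl
  rw [h2, Real.map_volume_mul_left hk, lintegral_smul_measure, lintegral_add_right_eq_self] at h
  rw [← h, smul_eq_mul, ← mul_assoc, ← ENNReal.ofReal_mul (abs_nonneg _), ← abs_mul,
    mul_inv_cancel₀ hk]
  simp

/-- The decay in the time frequency of the Fourier transform of a cut-off of bounded variation. -/
def timeDecay (θ : ℝ) : ℝ := (1 + |2 * Real.pi * θ|)⁻¹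

lemma timeDecay_neg (θ : ℝ) : timeDecay (-θ) = timeDecay θ := by
  simp [timeDecay]

@[fun_prop]
lemma measurable_timeDecay : Measurable timeDecay := by
  unfold timeDecay; fun_prop

/-- For fixed `a`, the time decay at `A + 2κac`, integrated over the second frequency gap `c`,
compensates the factor `|a|`. The constant is uniform in `A` and `a`. -/
lemma lintegral_gapWeight_le {δ : ℝ} (hδ : 0 < δ) : ∃ B : ℝ≥0∞, B ≠ ∞ ∧
    ∀ κ : ℝ, κ ^ 2 = 1 → ∀ A a ξ₁ : ℝ,
      ∫⁻ ξ, ENNReal.ofReal (gapWeight δ a (2 * Real.pi * (ξ₁ - ξ))) *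
        ENNReal.ofReal (1 + |A - 2 * κ * a * (2 * Real.pi * ξ)|)⁻¹ ≤ B := by
  set g : ℝ → ℝ≥0∞ := fun y => ENNReal.ofReal ((1 + ‖y‖) ^ (-(1 + δ))) with hg
  have hgfin : ∫⁻ y, g y < ∞ := finite_integral_one_add_norm (by simpa using hδ)
  refine ⟨ENNReal.ofReal (2 ^ δ) * ((∫⁻ y, g y) + ∫⁻ y, g y), ENNReal.mul_ne_top
    ENNReal.ofReal_ne_top (ENNReal.add_ne_top.2 ⟨hgfin.ne, hgfin.ne⟩), ?_⟩
  intro κ hκ A a ξ₁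
  have hκa : |κ| = 1 := by
    rw [← sq_eq_sq₀ (abs_nonneg κ) zero_le_one, sq_abs, hκ, one_pow]
  rcases eq_or_ne a 0 with rfl | ha
  · simp [gapWeight]
  have hgm : Measurable g := by fun_prop
  set k := -(2 * κ * a * (2 * Real.pi)) with hk
  set d := 2 * κ * a * (2 * Real.pi * ξ₁) with hd
  have hκ0 : κ ≠ 0 := by rintro rfl; simp at hκa
  have hk0 : k ≠ 0 := by
    rw [hk]; simp [hκ0, ha, Real.pi_ne_zero]
  have hka : |a| ≤ |k| := by
    rw [hk, abs_neg, abs_mul, abs_mul, abs_mul, hκa, abs_of_pos Real.two_pi_pos]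
    have := Real.pi_gt_three
    have := abs_nonneg a
    norm_num
    nlinarith
  have hpt : ∀ ξ : ℝ, ENNReal.ofReal (gapWeight δ a (2 * Real.pi * (ξ₁ - ξ))) *
      ENNReal.ofReal (1 + |A - 2 * κ * a * (2 * Real.pi * ξ)|)⁻¹ ≤
      ENNReal.ofReal (2 ^ δ) * (ENNReal.ofReal |k| * (g (k * ξ + d) +
        g (k * ξ + A))) := by
    intro ξ
    set y := k * ξ + d with hy
    set z := k * ξ + A with hz
    have hy' : |y| = 2 * (|a| * |2 * Real.pi * (ξ₁ - ξ)|) := by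
      rw [hy, hk, hd, show -(2 * κ * a * (2 * Real.pi)) * ξ + 2 * κ * a * (2 * Real.pi * ξ₁) =
        κ * (2 * (a * (2 * Real.pi * (ξ₁ - ξ)))) by ring, abs_mul, hκa, abs_mul, abs_mul a]
      norm_num
    have hz' : A - 2 * κ * a * (2 * Real.pi * ξ) = z := by rw [hz, hk]; ring
    rw [hz', hg, ← ENNReal.ofReal_add (by positivity) (by positivity),
      ← ENNReal.ofReal_mul (gapWeight_nonneg _ _ _), ← ENNReal.ofReal_mul (abs_nonneg _),
      ← ENNReal.ofReal_mul (by positivity)]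
    refine ENNReal.ofReal_le_ofReal ?_
    set c := 2 * Real.pi * (ξ₁ - ξ) with hc
    have h1 : (1 + |y|) / 2 ≤ (1 + |a|) * (1 + |c|) := by
      have := abs_nonneg a; have := abs_nonneg c
      rw [hy']; nlinarith
    have h2 : ((1 + |a|) * (1 + |c|)) ^ (-δ) ≤ 2 ^ δ * (1 + |y|) ^ (-δ) := by
      refine (Real.rpow_le_rpow_of_nonpos (by positivity) h1 (neg_nonpos.2 hδ.le)).trans_eq ?_
      rw [Real.div_rpow (by positivity) (by norm_num), Real.rpow_neg (x := 2) (by norm_num)]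
      rw [div_inv_eq_mul, mul_comm]
    have h3 : (1 + |y|) ^ (-δ) * (1 + |z|)⁻¹ ≤ (1 + |y|) ^ (-(1 + δ)) + (1 + |z|) ^ (-(1 + δ)) := by
      have e : ∀ x : ℝ, (1 + |x|) ^ (-(1 + δ)) = (1 + |x|) ^ (-δ) * (1 + |x|)⁻¹ := by
        intro x
        rw [neg_add, Real.rpow_add (by positivity), Real.rpow_neg_one, mul_comm]
      have p : ∀ x : ℝ, 0 ≤ (1 + |x|) ^ (-(1 + δ)) := fun x => by positivity
      rcases le_total |y| |z| with hle | hle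
      · have : (1 + |y|) ^ (-δ) * (1 + |z|)⁻¹ ≤ (1 + |y|) ^ (-(1 + δ)) := by
          rw [e]; gcongr
        linarith [p z]
      · have : (1 + |y|) ^ (-δ) * (1 + |z|)⁻¹ ≤ (1 + |z|) ^ (-(1 + δ)) := by
          rw [e]
          gcongr ?_ * _
          exact Real.rpow_le_rpow_of_nonpos (by positivity) (by gcongr) (neg_nonpos.2 hδ.le)
        linarith [p y]
    simp only [Real.norm_eq_abs]
    calc gapWeight δ a c * (1 + |z|)⁻¹
        ≤ |a| * (2 ^ δ * (1 + |y|) ^ (-δ)) * (1 + |z|)⁻¹ := by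
          rw [gapWeight]; gcongr
      _ = 2 ^ δ * (|a| * ((1 + |y|) ^ (-δ) * (1 + |z|)⁻¹)) := by ring
      _ ≤ _ := by gcongr
  calc _ ≤ ∫⁻ ξ, ENNReal.ofReal (2 ^ δ) * (ENNReal.ofReal |k| * (g (k * ξ + d) +
        g (k * ξ + A))) := lintegral_mono hpt
    _ = ENNReal.ofReal (2 ^ δ) * ((ENNReal.ofReal |k| * ∫⁻ ξ, g (k * ξ + d)) +
        ENNReal.ofReal |k| * ∫⁻ ξ, g (k * ξ + A)) := by
        rw [lintegral_const_mul _ (by fun_prop), lintegral_const_mul _ (by fun_prop),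
          lintegral_add_left (by fun_prop), mul_add]
    _ = _ := by rw [lintegral_comp_affine g hk0, lintegral_comp_affine g hk0]

/-! ### The Schur estimate -/

lemma ennreal_mul_le_add_sq (a b : ℝ≥0∞) : a * b ≤ a ^ 2 + b ^ 2 := by
  rcases le_total a b with h | h
  · calc a * b ≤ b * b := by gcongr
      _ = b ^ 2 := (sq b).symm
      _ ≤ _ := le_add_self
  · calc a * b ≤ a * a := by gcongr
      _ = a ^ 2 := (sq a).symm
      _ ≤ _ := le_self_add

/-- A weighted Schur test for a symmetric kernel. -/
lemma schur_test {S : Type*} [MeasurableSpace S] {μ : Measure S} [SFinite μ]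
    {k : S → S → ℝ≥0∞} (hk : Measurable (Function.uncurry k)) (hsymm : ∀ x y, k x y = k y x)
    {Q ρ : S → ℝ≥0∞} (hQ : Measurable Q) (hρ : Measurable ρ) {B : ℝ≥0∞}
    (hB : ∀ x, ∫⁻ y, ρ y ^ 2 * k x y ∂μ ≤ B) :
    ∫⁻ x, ∫⁻ y, (Q x * ρ x) * (Q y * ρ y) * k x y ∂μ ∂μ ≤ 2 * B * ∫⁻ x, Q x ^ 2 ∂μ := by
  have hmeas : Measurable (Function.uncurry fun x y => Q x ^ 2 * (ρ y ^ 2 * k x y)) := by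
    have : Measurable fun p : S × S => Q p.1 ^ 2 * (ρ p.2 ^ 2 * k p.1 p.2) := by fun_prop
    exact this
  have hmeas' : Measurable (Function.uncurry fun x y => Q y ^ 2 * (ρ x ^ 2 * k y x)) := by
    have : Measurable fun p : S × S => Q p.2 ^ 2 * (ρ p.1 ^ 2 * k p.2 p.1) := by fun_prop
    exact this
  have h1 : ∫⁻ x, ∫⁻ y, Q x ^ 2 * (ρ y ^ 2 * k x y) ∂μ ∂μ ≤ B * ∫⁻ x, Q x ^ 2 ∂μ := by
    rw [← lintegral_const_mul _ (by fun_prop)]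
    refine lintegral_mono fun x => ?_
    rw [lintegral_const_mul _ (by fun_prop), mul_comm]
    gcongr
    exact hB x
  have h2 : ∫⁻ x, ∫⁻ y, Q y ^ 2 * (ρ x ^ 2 * k y x) ∂μ ∂μ ≤ B * ∫⁻ x, Q x ^ 2 ∂μ := by
    rw [lintegral_lintegral_swap hmeas'.aemeasurable]
    exact h1
  calc ∫⁻ x, ∫⁻ y, (Q x * ρ x) * (Q y * ρ y) * k x y ∂μ ∂μ
      ≤ ∫⁻ x, ∫⁻ y, Q x ^ 2 * (ρ y ^ 2 * k x y) + Q y ^ 2 * (ρ x ^ 2 * k y x) ∂μ ∂μ := by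
        refine lintegral_mono fun x => lintegral_mono fun y => ?_
        calc (Q x * ρ x) * (Q y * ρ y) * k x y = (Q x * ρ y) * (Q y * ρ x) * k x y := by ring
          _ ≤ ((Q x * ρ y) ^ 2 + (Q y * ρ x) ^ 2) * k x y := by
              gcongr; exact ennreal_mul_le_add_sq _ _
          _ = _ := by rw [hsymm y x]; ring
    _ = (∫⁻ x, ∫⁻ y, Q x ^ 2 * (ρ y ^ 2 * k x y) ∂μ ∂μ) +
        ∫⁻ x, ∫⁻ y, Q y ^ 2 * (ρ x ^ 2 * k y x) ∂μ ∂μ := by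
        rw [← lintegral_add_left (by fun_prop)]
        refine lintegral_congr fun x => ?_
        rw [lintegral_add_left (by fun_prop)]
    _ ≤ B * (∫⁻ x, Q x ^ 2 ∂μ) + B * ∫⁻ x, Q x ^ 2 ∂μ := add_le_add h1 h2
    _ = _ := by ring

/-- The weight `⟨τ - κξ²⟩^{-b}` in the frequency variables dual to Mathlib's Fourier transform. -/
def modWeight (κ b ξ τ : ℝ) : ℝ≥0∞ :=
  ENNReal.ofReal (bracket (2 * Real.pi * τ - κ * (2 * Real.pi * ξ) ^ 2) ^ (-b))

@[fun_prop]
lemma _root_.Measurable.modWeight {S : Type*} [MeasurableSpace S] (κ b : ℝ) {ξ τ : S → ℝ}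
    (hξ : Measurable ξ) (hτ : Measurable τ) : Measurable fun x => modWeight κ b (ξ x) (τ x) := by
  unfold NLS.modWeight; fun_prop

lemma lintegral_bracket_rpow_lt_top {b : ℝ} (hb : 1 / 2 < b) :
    ∫⁻ t : ℝ, ENNReal.ofReal (bracket (2 * Real.pi * t) ^ (-b)) ^ 2 < ∞ := by
  have h1 : Integrable (fun t : ℝ => (1 + ‖2 * Real.pi * t‖ ^ 2) ^ (-(2 * b) / 2)) :=
    (integrable_rpow_neg_one_add_norm_sq (E := ℝ) (μ := volume) (r := 2 * b)
      (by rw [Module.finrank_self]; push_cast; linarith)).comp_mul_left' Real.two_pi_pos.ne'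
  refine (lintegral_mono fun t => ?_).trans_lt h1.lintegral_lt_top
  have hb0 := bracket_pos (2 * Real.pi * t)
  rw [← ENNReal.ofReal_pow (Real.rpow_nonneg hb0.le _)]
  refine ENNReal.ofReal_le_ofReal (le_of_eq ?_)
  rw [Real.norm_eq_abs, sq_abs, bracket, Real.sqrt_eq_rpow, ← Real.rpow_mul (by positivity),
    ← Real.rpow_natCast, ← Real.rpow_mul (by positivity)]
  congr 1
  push_cast
  ring

/-- The kernel pairing `(ξ₁, τ₁, τ₂)` with `(ξ₄, τ₄, τ₃)` when the frequency gap
`ξ₁ - ξ₂ = ξ₄ - ξ₃` is `α`. -/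
def gapKernel (δ α : ℝ) (x y : ℝ × ℝ × ℝ) : ℝ≥0∞ :=
  ENNReal.ofReal (gapWeight δ (2 * Real.pi * α) (2 * Real.pi * (x.1 - y.1))) *
    ENNReal.ofReal (timeDecay ((x.2.1 - x.2.2) - (y.2.1 - y.2.2)))

lemma gapKernel_symm (δ α : ℝ) (x y : ℝ × ℝ × ℝ) : gapKernel δ α x y = gapKernel δ α y x := by
  have h1 : |2 * Real.pi * (x.1 - y.1)| = |2 * Real.pi * (y.1 - x.1)| := by
    rw [← abs_neg]; congr 1; ring
  rw [gapKernel, gapKernel, ← timeDecay_neg, gapWeight, gapWeight, h1]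
  congr 3
  ring

@[fun_prop]
lemma _root_.Measurable.gapKernel {S : Type*} [MeasurableSpace S] (δ : ℝ) {α : S → ℝ}
    {x y : S → ℝ × ℝ × ℝ} (hα : Measurable α) (hx : Measurable x) (hy : Measurable y) :
    Measurable fun z => gapKernel δ (α z) (x z) (y z) := by
  unfold NLS.gapKernel; fun_prop

/-- After shifting the time frequencies by the parabola, the argument of the time decay is affine
in `ξ₄` with slope `-2κ(2π)²α`: the resonance function `x₁² - x₂² + x₃² - x₄²` factors as
`2 (x₁ - x₂)(x₁ - x₄)`. -/
lemma lintegral_gapKernel_le {δ b : ℝ} (hδ : 0 < δ) (hb : 1 / 2 < b) : ∃ B : ℝ≥0∞, B ≠ ∞ ∧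
    ∀ κ : ℝ, κ ^ 2 = 1 → ∀ (α : ℝ) (x : ℝ × ℝ × ℝ),
      ∫⁻ y : ℝ × ℝ × ℝ, (modWeight κ b y.1 y.2.1 * modWeight κ b (y.1 - α) y.2.2) ^ 2 *
        gapKernel δ α x y ≤ B := by
  obtain ⟨B, hB, hle⟩ := lintegral_gapWeight_le hδ
  set c := ∫⁻ t : ℝ, ENNReal.ofReal (bracket (2 * Real.pi * t) ^ (-b)) ^ 2 with hc
  have hcfin : c < ∞ := lintegral_bracket_rpow_lt_top hb
  refine ⟨c * c * B, ENNReal.mul_ne_top (ENNReal.mul_ne_top hcfin.ne hcfin.ne) hB, ?_⟩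
  rintro κ hκ α ⟨ξ₁, τ₁, τ₂⟩
  set β : ℝ → ℝ≥0∞ := fun t => ENNReal.ofReal (bracket (2 * Real.pi * t) ^ (-b)) with hβ
  have hβm : Measurable β := by fun_prop
  set H : ℝ → ℝ × ℝ → ℝ≥0∞ := fun ξ q => (β q.1 ^ 2 * β q.2 ^ 2) *
    (ENNReal.ofReal (gapWeight δ (2 * Real.pi * α) (2 * Real.pi * (ξ₁ - ξ))) *
      ENNReal.ofReal (1 + |(2 * Real.pi * (τ₁ - τ₂ - q.1 + q.2) + κ * (2 * Real.pi * α) ^ 2) -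
        2 * κ * (2 * Real.pi * α) * (2 * Real.pi * ξ)|)⁻¹) with hH
  have hHm : Measurable (Function.uncurry H) := by
    have : Measurable fun p : ℝ × ℝ × ℝ => H p.1 p.2 := by
      simp only [hH]; fun_prop
    exact this
  have hm : Measurable fun y : ℝ × ℝ × ℝ =>
      (modWeight κ b y.1 y.2.1 * modWeight κ b (y.1 - α) y.2.2) ^ 2 *
        gapKernel δ α (ξ₁, τ₁, τ₂) y := by
    fun_prop
  rw [Measure.volume_eq_prod, lintegral_prod _ hm.aemeasurable]
  calc _ = ∫⁻ ξ : ℝ, ∫⁻ q : ℝ × ℝ, H ξ q := by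
        refine lintegral_congr fun ξ => ?_
        -- The shift of `τ₄`, `τ₃` by the parabola turns them into modulations.
        rw [← lintegral_add_right_eq_self _
          ((2 * Real.pi * κ * ξ ^ 2, 2 * Real.pi * κ * (ξ - α) ^ 2) : ℝ × ℝ)]
        refine lintegral_congr fun q => ?_
        simp only [hH, gapKernel, modWeight, timeDecay, Prod.fst_add, Prod.snd_add, mul_pow, hβ]
        have e1 : 2 * Real.pi * (q.1 + 2 * Real.pi * κ * ξ ^ 2) -
            κ * (2 ^ 2 * Real.pi ^ 2 * ξ ^ 2) = 2 * Real.pi * q.1 := by ring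
        have e2 : 2 * Real.pi * (q.2 + 2 * Real.pi * κ * (ξ - α) ^ 2) -
            κ * (2 ^ 2 * Real.pi ^ 2 * (ξ - α) ^ 2) = 2 * Real.pi * q.2 := by ring
        have e3 : 2 * Real.pi * (τ₁ - τ₂ - (q.1 + 2 * Real.pi * κ * ξ ^ 2 -
            (q.2 + 2 * Real.pi * κ * (ξ - α) ^ 2))) =
            (2 * Real.pi * (τ₁ - τ₂ - q.1 + q.2) + κ * (2 ^ 2 * Real.pi ^ 2 * α ^ 2)) -
            2 * κ * (2 * Real.pi * α) * (2 * Real.pi * ξ) := by ring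
        rw [e1, e2, e3]
    _ = ∫⁻ q : ℝ × ℝ, ∫⁻ ξ : ℝ, H ξ q := lintegral_lintegral_swap hHm.aemeasurable
    _ ≤ ∫⁻ q : ℝ × ℝ, (β q.1 ^ 2 * β q.2 ^ 2) * B := by
        refine lintegral_mono fun q => ?_
        simp only [hH]
        rw [lintegral_const_mul _ (by fun_prop)]
        gcongr
        exact hle κ hκ _ _ _
    _ = _ := by
        rw [lintegral_mul_const _ (by fun_prop), Measure.volume_eq_prod,
          lintegral_prod_mul (f := fun t => β t ^ 2) (g := fun t => β t ^ 2)
            (by fun_prop) (by fun_prop)]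

/-- The quartic form with the weight `gapWeight` in the gaps `ξ₁ - ξ₂`, `ξ₁ - ξ₄`. The variables
are `p = (τ₁, τ₂)` and `q = (τ₄, τ₃)`, and `ξ₃ = ξ₂ + ξ₄ - ξ₁`. -/
lemma quartic_gapWeight_le {δ b : ℝ} (hδ : 0 < δ) (hb : 1 / 2 < b) : ∃ B : ℝ≥0∞, B ≠ ∞ ∧
    ∀ κ : ℝ, κ ^ 2 = 1 → ∀ F : ℝ → ℝ → ℝ≥0∞, Measurable (Function.uncurry F) →
      ∀ V : ℝ → ℝ → ℝ≥0∞, (∀ ξ τ, V ξ τ = F ξ τ * modWeight κ b ξ τ) →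
      ∫⁻ ξ₁, ∫⁻ ξ₂, ∫⁻ ξ₄, ∫⁻ p : ℝ × ℝ, ∫⁻ q : ℝ × ℝ,
        ENNReal.ofReal (gapWeight δ (2 * Real.pi * (ξ₁ - ξ₂)) (2 * Real.pi * (ξ₁ - ξ₄))) *
        (V ξ₁ p.1 * V ξ₂ p.2 * V (ξ₂ + ξ₄ - ξ₁) q.2 * V ξ₄ q.1) *
        ENNReal.ofReal (timeDecay ((p.1 - p.2) - (q.1 - q.2))) ≤
      B * (∫⁻ ξ, ∫⁻ τ, F ξ τ ^ 2) ^ 2 := by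
  obtain ⟨B, hB, hle⟩ := lintegral_gapKernel_le hδ hb
  refine ⟨2 * B, ENNReal.mul_ne_top (by norm_num) hB, ?_⟩
  intro κ hκ F hF V hV
  set Q : ℝ → ℝ × ℝ × ℝ → ℝ≥0∞ := fun α x => F x.1 x.2.1 * F (x.1 - α) x.2.2 with hQ
  set R : ℝ → ℝ × ℝ × ℝ → ℝ≥0∞ := fun α x =>
    modWeight κ b x.1 x.2.1 * modWeight κ b (x.1 - α) x.2.2 with hR
  have hQm : Measurable fun p : ℝ × ℝ × ℝ × ℝ => Q p.1 p.2 := by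
    simp only [hQ]; fun_prop
  have hRm : Measurable fun p : ℝ × ℝ × ℝ × ℝ => R p.1 p.2 := by
    simp only [hR]; fun_prop
  set G : ℝ → ℝ × ℝ × ℝ → ℝ × ℝ × ℝ → ℝ≥0∞ := fun α x y =>
    (Q α x * R α x) * (Q α y * R α y) * gapKernel δ α x y with hG
  have hGm : Measurable fun p : ℝ × (ℝ × ℝ × ℝ) × (ℝ × ℝ × ℝ) => G p.1 p.2.1 p.2.2 := by
    have c1 : Measurable fun p : ℝ × (ℝ × ℝ × ℝ) × (ℝ × ℝ × ℝ) => (p.1, p.2.1) := by fun_prop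
    have c2 : Measurable fun p : ℝ × (ℝ × ℝ × ℝ) × (ℝ × ℝ × ℝ) => (p.1, p.2.2) := by fun_prop
    have h1 := hQm.comp c1
    have h2 := hRm.comp c1
    have h3 := hQm.comp c2
    have h4 := hRm.comp c2
    simp only [Function.comp_def] at h1 h2 h3 h4
    have h5 : Measurable fun p : ℝ × (ℝ × ℝ × ℝ) × (ℝ × ℝ × ℝ) =>
      gapKernel δ p.1 p.2.1 p.2.2 := by fun_prop
    exact ((h1.mul h2).mul (h3.mul h4)).mul h5
  have hschur : ∀ α, ∫⁻ x, ∫⁻ y, G α x y ≤ 2 * B * ∫⁻ x, Q α x ^ 2 := by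
    intro α
    have cα : Measurable fun x : ℝ × ℝ × ℝ => (α, x) := by fun_prop
    refine schur_test (k := gapKernel δ α) ?_ (gapKernel_symm δ α) (hQm.comp cα) (hRm.comp cα)
      (hle κ hκ α)
    have : Measurable fun p : (ℝ × ℝ × ℝ) × (ℝ × ℝ × ℝ) => gapKernel δ α p.1 p.2 := by fun_prop
    exact this
  have hcomb : ∀ ξ₁ α ξ₄, ∀ p q : ℝ × ℝ,
      ENNReal.ofReal (gapWeight δ (2 * Real.pi * (ξ₁ - (ξ₁ - α))) (2 * Real.pi * (ξ₁ - ξ₄))) *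
        (V ξ₁ p.1 * V (ξ₁ - α) p.2 * V ((ξ₁ - α) + ξ₄ - ξ₁) q.2 * V ξ₄ q.1) *
        ENNReal.ofReal (timeDecay ((p.1 - p.2) - (q.1 - q.2))) =
      G α (ξ₁, p) (ξ₄, q) := by
    intro ξ₁ α ξ₄ p q
    have e1 : ξ₁ - (ξ₁ - α) = α := by ring
    have e2 : ξ₁ - α + ξ₄ - ξ₁ = ξ₄ - α := by ring
    simp only [hG, hQ, hR, gapKernel, hV, e1, e2]
    ring
  calc _ = ∫⁻ ξ₁, ∫⁻ α, ∫⁻ ξ₄, ∫⁻ p : ℝ × ℝ, ∫⁻ q : ℝ × ℝ, G α (ξ₁, p) (ξ₄, q) := by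
        refine lintegral_congr fun ξ₁ => ?_
        rw [← lintegral_sub_left_eq_self _ ξ₁]
        refine lintegral_congr fun α => lintegral_congr fun ξ₄ => lintegral_congr fun p =>
          lintegral_congr fun q => hcomb ξ₁ α ξ₄ p q
    _ = ∫⁻ ξ₁, ∫⁻ α, ∫⁻ p : ℝ × ℝ, ∫⁻ y : ℝ × ℝ × ℝ, G α (ξ₁, p) y := by
        refine lintegral_congr fun ξ₁ => lintegral_congr fun α => ?_
        have c0 : Measurable fun z : (ℝ × ℝ) × (ℝ × ℝ × ℝ) => G α (ξ₁, z.1) z.2 :=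
          hGm.comp (by fun_prop : Measurable
            fun z : (ℝ × ℝ) × (ℝ × ℝ × ℝ) => (α, (ξ₁, z.1), z.2))
        rw [lintegral_lintegral_swap]
        · refine lintegral_congr fun p => ?_
          rw [Measure.volume_eq_prod (ℝ) (ℝ × ℝ), lintegral_prod]
          exact (c0.comp (by fun_prop : Measurable fun y : ℝ × ℝ × ℝ => (p, y))).aemeasurable
        · refine Measurable.aemeasurable ?_
          have : Measurable fun z : (ℝ × (ℝ × ℝ)) × (ℝ × ℝ) => G α (ξ₁, z.1.2) (z.1.1, z.2) :=
            c0.comp (by fun_prop : Measurable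
              fun z : (ℝ × (ℝ × ℝ)) × (ℝ × ℝ) => (z.1.2, (z.1.1, z.2)))
          exact this.lintegral_prod_right'
    _ = ∫⁻ α, ∫⁻ x : ℝ × ℝ × ℝ, ∫⁻ y : ℝ × ℝ × ℝ, G α x y := by
        have c1 : Measurable fun z : (ℝ × (ℝ × ℝ × ℝ)) => ∫⁻ y, G z.1 z.2 y := by
          have : Measurable fun z : (ℝ × (ℝ × ℝ × ℝ)) × (ℝ × ℝ × ℝ) => G z.1.1 z.1.2 z.2 :=
            hGm.comp (by fun_prop : Measurable
              fun z : (ℝ × (ℝ × ℝ × ℝ)) × (ℝ × ℝ × ℝ) => (z.1.1, z.1.2, z.2))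
          exact this.lintegral_prod_right'
        rw [lintegral_lintegral_swap]
        · refine lintegral_congr fun α => ?_
          rw [Measure.volume_eq_prod (ℝ) (ℝ × ℝ), lintegral_prod]
          exact (c1.comp (by fun_prop : Measurable fun x : ℝ × ℝ × ℝ => (α, x))).aemeasurable
        · refine Measurable.aemeasurable ?_
          have : Measurable fun z : (ℝ × ℝ) × (ℝ × ℝ) => ∫⁻ y, G z.1.2 (z.1.1, z.2) y :=
            c1.comp (by fun_prop : Measurable
              fun z : (ℝ × ℝ) × (ℝ × ℝ) => (z.1.2, (z.1.1, z.2)))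
          exact this.lintegral_prod_right'
    _ ≤ ∫⁻ α, 2 * B * ∫⁻ x, Q α x ^ 2 := lintegral_mono hschur
    _ = 2 * B * ∫⁻ α, ∫⁻ x, Q α x ^ 2 := by
        rw [lintegral_const_mul]
        have : Measurable fun p : ℝ × ℝ × ℝ × ℝ => Q p.1 p.2 ^ 2 := hQm.pow_const 2
        exact this.lintegral_prod_right'
    _ = 2 * B * (∫⁻ ξ, ∫⁻ τ, F ξ τ ^ 2) ^ 2 := by
        congr 1
        set N : ℝ → ℝ≥0∞ := fun ξ => ∫⁻ τ, F ξ τ ^ 2 with hN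
        have hF2 : Measurable fun z : ℝ × ℝ => F z.1 z.2 ^ 2 := by
          have : Measurable fun z : ℝ × ℝ => F z.1 z.2 := hF
          exact this.pow_const 2
        have hNm : Measurable N := hF2.lintegral_prod_right'
        have hFs : ∀ ξ, Measurable fun τ => F ξ τ ^ 2 := fun ξ =>
          hF2.comp (by fun_prop : Measurable fun τ : ℝ => (ξ, τ))
        have e1 : ∀ α, ∫⁻ x, Q α x ^ 2 = ∫⁻ ξ, N ξ * N (ξ - α) := by
          intro α
          rw [Measure.volume_eq_prod, lintegral_prod]
          · refine lintegral_congr fun ξ => ?_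
            simp only [hQ, mul_pow]
            rw [Measure.volume_eq_prod, lintegral_prod_mul (hFs ξ).aemeasurable
              (hFs (ξ - α)).aemeasurable]
          · exact ((hQm.comp (by fun_prop : Measurable
              fun x : ℝ × ℝ × ℝ => (α, x))).pow_const 2).aemeasurable
        simp only [e1]
        rw [lintegral_lintegral_swap (by fun_prop)]
        simp only [fun ξ => lintegral_const_mul (μ := volume) (N ξ)
          (by fun_prop : Measurable fun α => N (ξ - α)), fun ξ : ℝ =>
          lintegral_sub_left_eq_self (μ := (volume : Measure ℝ)) N ξ]
        rw [lintegral_mul_const _ hNm, sq]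

/-! ### The quartic estimate -/

/-- Exchanging the second coordinate of the outer variable with the first of the inner one. -/
lemma lintegral_pair_exchange {f : ℝ × ℝ → ℝ × ℝ → ℝ≥0∞} (hf : Measurable (Function.uncurry f)) :
    ∫⁻ p : ℝ × ℝ, ∫⁻ q : ℝ × ℝ, f (p.1, q.1) (p.2, q.2) =
      ∫⁻ p : ℝ × ℝ, ∫⁻ q : ℝ × ℝ, f p q := by
  have key : ∀ g : ℝ × ℝ → ℝ × ℝ → ℝ≥0∞, Measurable (Function.uncurry g) →
      ∫⁻ p : ℝ × ℝ, ∫⁻ q : ℝ × ℝ, g p q =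
      ∫⁻ x, ∫⁻ y, ∫⁻ z, ∫⁻ w, g (x, y) (z, w) := by
    intro g hg
    rw [Measure.volume_eq_prod, lintegral_prod _ (by fun_prop)]
    refine lintegral_congr fun x => lintegral_congr fun y => ?_
    rw [lintegral_prod _ (by fun_prop)]
  rw [key f hf, key (fun p q => f (p.1, q.1) (p.2, q.2)) (by fun_prop)]
  refine lintegral_congr fun x => ?_
  rw [lintegral_lintegral_swap (by fun_prop)]

/-- The quartic estimate: the antisymmetrized form, with its modulations weighted by the time decay,
is bounded by the fourth power of the Bourgain norm. The frequencies are `ξ₁, ξ₂, ξ₄` and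
`ξ₃ = ξ₂ + ξ₄ - ξ₁`, with `p = (τ₁, τ₂)` and `q = (τ₄, τ₃)`. -/
lemma quartic_le {s r b : ℝ} (hs : s ∈ Ioo (-1 / 2 : ℝ) 0) (hr : -1 / 4 < r) (hb : 1 / 2 < b) :
    ∃ B : ℝ≥0∞, B ≠ ∞ ∧ ∀ κ : ℝ, κ ^ 2 = 1 → ∀ w : ℝ → ℝ → ℝ≥0∞,
      Measurable (Function.uncurry w) →
      ∫⁻ ξ₁, ∫⁻ ξ₂, ∫⁻ ξ₄, ∫⁻ p : ℝ × ℝ, ∫⁻ q : ℝ × ℝ,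
        ENNReal.ofReal |sobolevWeight s ξ₄ ^ 2 - sobolevWeight s ξ₁ ^ 2| *
        (w ξ₁ p.1 * w ξ₂ p.2 * w (ξ₂ + ξ₄ - ξ₁) q.2 * w ξ₄ q.1) *
        ENNReal.ofReal (timeDecay ((p.1 - p.2) - (q.1 - q.2))) ≤
      B * (∫⁻ ξ, ∫⁻ τ, w ξ τ ^ 2 *
        ENNReal.ofReal (bracket (2 * Real.pi * τ - κ * (2 * Real.pi * ξ) ^ 2) ^ (2 * b) *
          bracket (2 * Real.pi * ξ) ^ (2 * r))) ^ 2 := by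
  -- Decreasing `r` to a negative value only shrinks the right-hand side.
  set r' := min r (-1 / 8) with hr'
  have hr1 : -1 / 4 < r' := lt_min hr (by norm_num)
  have hr0 : r' ≤ 0 := (min_le_right _ _).trans (by norm_num)
  set δ := (1 + 4 * r') / 2 with hδdef
  have hδ : 0 < δ := by rw [hδdef]; linarith
  obtain ⟨B, hB, hle⟩ := quartic_gapWeight_le hδ hb
  refine ⟨ENNReal.ofReal (9 ^ δ) * (B + B), ENNReal.mul_ne_top ENNReal.ofReal_ne_top
    (ENNReal.add_ne_top.2 ⟨hB, hB⟩), ?_⟩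
  intro κ hκ w hw
  set J : ℝ → ℝ≥0∞ := fun ξ => ENNReal.ofReal (bracket (2 * Real.pi * ξ) ^ r') with hJ
  have hJm : Measurable J := by fun_prop
  set V : ℝ → ℝ → ℝ≥0∞ := fun ξ τ => w ξ τ * J ξ with hVdef
  have hVm : Measurable (Function.uncurry V) := by
    have : Measurable fun p : ℝ × ℝ => w p.1 p.2 * J p.1 := by fun_prop
    exact this
  set F : ℝ → ℝ → ℝ≥0∞ := fun ξ τ => V ξ τ *
    ENNReal.ofReal (bracket (2 * Real.pi * τ - κ * (2 * Real.pi * ξ) ^ 2) ^ b) with hF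
  have hFm : Measurable (Function.uncurry F) := by
    have : Measurable fun p : ℝ × ℝ => V p.1 p.2 *
      ENNReal.ofReal (bracket (2 * Real.pi * p.2 - κ * (2 * Real.pi * p.1) ^ 2) ^ b) := by fun_prop
    exact this
  have hV : ∀ ξ τ, V ξ τ = F ξ τ * modWeight κ b ξ τ := by
    intro ξ τ
    have h0 := bracket_pos (2 * Real.pi * τ - κ * (2 * Real.pi * ξ) ^ 2)
    rw [hF, modWeight, mul_assoc, ← ENNReal.ofReal_mul (Real.rpow_nonneg h0.le _),
      ← Real.rpow_add h0]
    simp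
  have hX : ∫⁻ ξ, ∫⁻ τ, F ξ τ ^ 2 ≤ ∫⁻ ξ, ∫⁻ τ, w ξ τ ^ 2 *
        ENNReal.ofReal (bracket (2 * Real.pi * τ - κ * (2 * Real.pi * ξ) ^ 2) ^ (2 * b) *
          bracket (2 * Real.pi * ξ) ^ (2 * r)) := by
    refine lintegral_mono fun ξ => lintegral_mono fun τ => ?_
    have h0 := bracket_pos (2 * Real.pi * τ - κ * (2 * Real.pi * ξ) ^ 2)
    have h1 := bracket_pos (2 * Real.pi * ξ)
    simp only [hF, hVdef, hJ]
    have hle : bracket (2 * Real.pi * ξ) ^ r' * bracket (2 * Real.pi * ξ) ^ r' ≤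
        bracket (2 * Real.pi * ξ) ^ (2 * r) := by
      rw [← Real.rpow_add h1]
      refine Real.rpow_le_rpow_of_exponent_le (one_le_bracket _) ?_
      linarith [(min_le_left _ _ : r' ≤ r)]
    have heq : bracket (2 * Real.pi * τ - κ * (2 * Real.pi * ξ) ^ 2) ^ b *
        bracket (2 * Real.pi * τ - κ * (2 * Real.pi * ξ) ^ 2) ^ b =
        bracket (2 * Real.pi * τ - κ * (2 * Real.pi * ξ) ^ 2) ^ (2 * b) := by
      rw [← Real.rpow_add h0]; congr 1; ring
    have p1 := Real.rpow_nonneg h1.le r'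
    have p0 := Real.rpow_nonneg h0.le b
    rw [mul_assoc, mul_pow, ← ENNReal.ofReal_mul p1, ← ENNReal.ofReal_pow (mul_nonneg p1 p0)]
    refine mul_le_mul_right (ENNReal.ofReal_le_ofReal ?_) _
    rw [← heq]
    calc _ = bracket (2 * Real.pi * τ - κ * (2 * Real.pi * ξ) ^ 2) ^ b *
        bracket (2 * Real.pi * τ - κ * (2 * Real.pi * ξ) ^ 2) ^ b *
        (bracket (2 * Real.pi * ξ) ^ r' * bracket (2 * Real.pi * ξ) ^ r') := by ring
      _ ≤ _ := mul_le_mul_of_nonneg_left hle (mul_nonneg p0 p0)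
  obtain ⟨Ψ, hΨ⟩ : ∃ Ψ : ℝ → ℝ → ℝ → ℝ × ℝ → ℝ × ℝ → ℝ≥0∞, Ψ = fun ξ₁ ξ₂ ξ₄ p q =>
    ENNReal.ofReal (gapWeight δ (2 * Real.pi * (ξ₁ - ξ₂)) (2 * Real.pi * (ξ₁ - ξ₄))) *
        (V ξ₁ p.1 * V ξ₂ p.2 * V (ξ₂ + ξ₄ - ξ₁) q.2 * V ξ₄ q.1) *
        ENNReal.ofReal (timeDecay ((p.1 - p.2) - (q.1 - q.2))) := ⟨_, rfl⟩
  have hΨm : Measurable fun z : ℝ × ℝ × ℝ × (ℝ × ℝ) × (ℝ × ℝ) =>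
      Ψ z.1 z.2.1 z.2.2.1 z.2.2.2.1 z.2.2.2.2 := by
    simp only [hΨ]; fun_prop
  have hΨle : ∫⁻ ξ₁, ∫⁻ ξ₂, ∫⁻ ξ₄, ∫⁻ p : ℝ × ℝ, ∫⁻ q : ℝ × ℝ, Ψ ξ₁ ξ₂ ξ₄ p q ≤
      B * (∫⁻ ξ, ∫⁻ τ, F ξ τ ^ 2) ^ 2 := by
    rw [hΨ]; exact hle κ hκ F hFm V hV
  have hpq : ∀ ξ₁ ξ₂ ξ₄, Measurable (Function.uncurry (Ψ ξ₁ ξ₂ ξ₄)) := by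
    intro ξ₁ ξ₂ ξ₄
    have : Measurable fun z : (ℝ × ℝ) × (ℝ × ℝ) => Ψ ξ₁ ξ₂ ξ₄ z.1 z.2 :=
      hΨm.comp (by fun_prop : Measurable fun z : (ℝ × ℝ) × (ℝ × ℝ) => (ξ₁, ξ₂, ξ₄, z.1, z.2))
    exact this
  have hinner : Measurable fun z : ℝ × ℝ × ℝ =>
      ∫⁻ p : ℝ × ℝ, ∫⁻ q : ℝ × ℝ, Ψ z.1 z.2.1 z.2.2 p q := by
    have h1 : Measurable fun z : ((ℝ × ℝ × ℝ) × (ℝ × ℝ)) × (ℝ × ℝ) =>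
        Ψ z.1.1.1 z.1.1.2.1 z.1.1.2.2 z.1.2 z.2 :=
      hΨm.comp (by fun_prop : Measurable fun z : ((ℝ × ℝ × ℝ) × (ℝ × ℝ)) × (ℝ × ℝ) =>
        (z.1.1.1, z.1.1.2.1, z.1.1.2.2, z.1.2, z.2))
    exact (h1.lintegral_prod_right').lintegral_prod_right'
  -- `gapWeight` is not symmetric in the two gaps; exchanging the second and the fourth variable
  -- reduces the other half of the symbol bound to the first.
  have hΨle' : ∫⁻ ξ₁, ∫⁻ ξ₂, ∫⁻ ξ₄, ∫⁻ p : ℝ × ℝ, ∫⁻ q : ℝ × ℝ,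
      Ψ ξ₁ ξ₄ ξ₂ (p.1, q.1) (p.2, q.2) ≤ B * (∫⁻ ξ, ∫⁻ τ, F ξ τ ^ 2) ^ 2 := by
    refine le_of_eq_of_le (lintegral_congr fun ξ₁ => ?_) hΨle
    rw [lintegral_lintegral_swap]
    · refine lintegral_congr fun ξ₂ => lintegral_congr fun ξ₄ => ?_
      exact lintegral_pair_exchange (hpq ξ₁ ξ₂ ξ₄)
    · have : (fun z : ℝ × ℝ => ∫⁻ p : ℝ × ℝ, ∫⁻ q : ℝ × ℝ,
          Ψ ξ₁ z.2 z.1 (p.1, q.1) (p.2, q.2)) =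
          fun z : ℝ × ℝ => ∫⁻ p : ℝ × ℝ, ∫⁻ q : ℝ × ℝ, Ψ ξ₁ z.2 z.1 p q := by
        ext z
        exact lintegral_pair_exchange (hpq ξ₁ z.2 z.1)
      refine Measurable.aemeasurable ?_
      change Measurable (fun z : ℝ × ℝ => ∫⁻ p : ℝ × ℝ, ∫⁻ q : ℝ × ℝ,
          Ψ ξ₁ z.2 z.1 (p.1, q.1) (p.2, q.2))
      rw [this]
      exact hinner.comp (by fun_prop : Measurable fun z : ℝ × ℝ => (ξ₁, z.2, z.1))
  have hpt : ∀ ξ₁ ξ₂ ξ₄ : ℝ, ∀ p q : ℝ × ℝ,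
      ENNReal.ofReal |sobolevWeight s ξ₄ ^ 2 - sobolevWeight s ξ₁ ^ 2| *
        (w ξ₁ p.1 * w ξ₂ p.2 * w (ξ₂ + ξ₄ - ξ₁) q.2 * w ξ₄ q.1) *
        ENNReal.ofReal (timeDecay ((p.1 - p.2) - (q.1 - q.2))) ≤
      ENNReal.ofReal (9 ^ δ) * (Ψ ξ₁ ξ₂ ξ₄ p q + Ψ ξ₁ ξ₄ ξ₂ (p.1, q.1) (p.2, q.2)) := by
    intro ξ₁ ξ₂ ξ₄ p q
    have hsq : ∀ ξ, sobolevWeight s ξ ^ 2 = bracket (2 * Real.pi * ξ) ^ (2 * s) := by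
      intro ξ
      rw [sobolevWeight, ← Real.rpow_natCast, ← Real.rpow_mul (bracket_pos _).le]
      congr 1
      push_cast
      ring
    have hsym := symbol_bound (q := 2 * s) ⟨by linarith [hs.1], by linarith [hs.2]⟩ hr1 hr0
      (x₁ := 2 * Real.pi * ξ₁) (x₂ := 2 * Real.pi * ξ₂) (x₃ := 2 * Real.pi * (ξ₂ + ξ₄ - ξ₁))
      (x₄ := 2 * Real.pi * ξ₄) (by ring)
    rw [← hδdef, ← mul_sub, ← mul_sub] at hsym
    have hb0 : ∀ x, 0 ≤ bracket x ^ r' := fun x => Real.rpow_nonneg (bracket_pos x).le _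
    have hE := ENNReal.ofReal_le_ofReal hsym
    rw [ENNReal.ofReal_mul (mul_nonneg (by positivity)
        (add_nonneg (gapWeight_nonneg _ _ _) (gapWeight_nonneg _ _ _))),
      ENNReal.ofReal_mul (by positivity), ENNReal.ofReal_add (gapWeight_nonneg _ _ _)
        (gapWeight_nonneg _ _ _),
      ENNReal.ofReal_mul (mul_nonneg (mul_nonneg (hb0 _) (hb0 _)) (hb0 _)),
      ENNReal.ofReal_mul (mul_nonneg (hb0 _) (hb0 _)), ENNReal.ofReal_mul (hb0 _)] at hE
    rw [hsq, hsq]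
    refine (mul_le_mul_left (mul_le_mul_left hE _) _).trans (le_of_eq ?_)
    have e1 : ξ₄ + ξ₂ - ξ₁ = ξ₂ + ξ₄ - ξ₁ := by ring
    have e2 : p.1 - q.1 - (p.2 - q.2) = p.1 - p.2 - (q.1 - q.2) := by ring
    simp only [hΨ, hVdef, hJ, e1, e2]
    ring
  set X := ∫⁻ ξ, ∫⁻ τ, F ξ τ ^ 2 with hXdef
  calc _ ≤ ∫⁻ ξ₁, ∫⁻ ξ₂, ∫⁻ ξ₄, ∫⁻ p : ℝ × ℝ, ∫⁻ q : ℝ × ℝ, ENNReal.ofReal (9 ^ δ) *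
        (Ψ ξ₁ ξ₂ ξ₄ p q + Ψ ξ₁ ξ₄ ξ₂ (p.1, q.1) (p.2, q.2)) :=
        lintegral_mono fun ξ₁ => lintegral_mono fun ξ₂ => lintegral_mono fun ξ₄ =>
          lintegral_mono fun p => lintegral_mono fun q => hpt ξ₁ ξ₂ ξ₄ p q
    _ = ENNReal.ofReal (9 ^ δ) *
        ((∫⁻ ξ₁, ∫⁻ ξ₂, ∫⁻ ξ₄, ∫⁻ p : ℝ × ℝ, ∫⁻ q : ℝ × ℝ, Ψ ξ₁ ξ₂ ξ₄ p q) +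
        ∫⁻ ξ₁, ∫⁻ ξ₂, ∫⁻ ξ₄, ∫⁻ p : ℝ × ℝ, ∫⁻ q : ℝ × ℝ,
          Ψ ξ₁ ξ₄ ξ₂ (p.1, q.1) (p.2, q.2)) := by
        have n9 : ENNReal.ofReal (9 ^ δ) ≠ ∞ := ENNReal.ofReal_ne_top
        simp only [lintegral_const_mul' _ _ n9]
        congr 1
        have m3 : ∀ ξ₁, Measurable fun z : ℝ × ℝ =>
            ∫⁻ p : ℝ × ℝ, ∫⁻ q : ℝ × ℝ, Ψ ξ₁ z.1 z.2 p q := fun ξ₁ =>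
          hinner.comp (by fun_prop : Measurable fun z : ℝ × ℝ => (ξ₁, z.1, z.2))
        have m2 : Measurable fun ξ₁ => ∫⁻ ξ₂, ∫⁻ ξ₄, ∫⁻ p : ℝ × ℝ, ∫⁻ q : ℝ × ℝ,
            Ψ ξ₁ ξ₂ ξ₄ p q := by
          have h1 : Measurable fun z : (ℝ × ℝ) × ℝ =>
              ∫⁻ p : ℝ × ℝ, ∫⁻ q : ℝ × ℝ, Ψ z.1.1 z.1.2 z.2 p q :=
            hinner.comp (by fun_prop : Measurable fun z : (ℝ × ℝ) × ℝ => (z.1.1, z.1.2, z.2))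
          exact (h1.lintegral_prod_right').lintegral_prod_right'
        rw [← lintegral_add_left m2]
        refine lintegral_congr fun ξ₁ => ?_
        rw [← lintegral_add_left (m3 ξ₁).lintegral_prod_right']
        refine lintegral_congr fun ξ₂ => ?_
        have m4 : Measurable fun ξ₄ => ∫⁻ p : ℝ × ℝ, ∫⁻ q : ℝ × ℝ, Ψ ξ₁ ξ₂ ξ₄ p q :=
          (m3 ξ₁).comp (by fun_prop : Measurable fun ξ₄ : ℝ => (ξ₂, ξ₄))
        refine Eq.trans ?_ (lintegral_add_left m4 _)
        refine lintegral_congr fun ξ₄ => ?_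
        have m5 : Measurable fun p => ∫⁻ q : ℝ × ℝ, Ψ ξ₁ ξ₂ ξ₄ p q :=
          (hpq ξ₁ ξ₂ ξ₄).lintegral_prod_right'
        refine Eq.trans ?_ (lintegral_add_left m5 _)
        refine lintegral_congr fun p => ?_
        have m6 : Measurable fun q => Ψ ξ₁ ξ₂ ξ₄ p q :=
          (hpq ξ₁ ξ₂ ξ₄).comp (by fun_prop : Measurable fun q : ℝ × ℝ => (p, q))
        exact lintegral_add_left m6 _
    _ ≤ ENNReal.ofReal (9 ^ δ) * (B * X ^ 2 + B * X ^ 2) := by gcongr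
    _ = ENNReal.ofReal (9 ^ δ) * (B + B) * X ^ 2 := by ring
    _ ≤ _ := by gcongr

/-! ### Space-time regularity of the cut-off solution -/

section SpaceTimeRegularity

lemma lintegral_spaceTime {f : SpaceTime → ℝ≥0∞} (hf : Measurable f) :
    ∫⁻ p, f p = ∫⁻ ξ : ℝ, ∫⁻ τ : ℝ, f (WithLp.toLp 2 (τ, ξ)) := by
  have hm := (WithLp.volume_preserving_toLp ℝ ℝ)
  rw [← hm.lintegral_comp hf, Measure.volume_eq_prod, lintegral_prod_symm]
  exact (hf.comp hm.measurable).aemeasurable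

lemma integrable_toLp {f : SpaceTime → ℂ} (hf : Integrable f) :
    Integrable (fun z : ℝ × ℝ => f (WithLp.toLp 2 z)) (volume.prod volume) := by
  have hm := (WithLp.volume_preserving_toLp ℝ ℝ)
  exact (hm.integrable_comp_emb (MeasurableEquiv.toLp 2 (ℝ × ℝ)).measurableEmbedding).2 hf

lemma integral_spaceTime {f : SpaceTime → ℂ} (hf : Integrable f) :
    ∫ p, f p = ∫ ξ : ℝ, ∫ τ : ℝ, f (WithLp.toLp 2 (τ, ξ)) := by
  have hm := (WithLp.volume_preserving_toLp ℝ ℝ)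
  rw [← hm.integral_comp (MeasurableEquiv.toLp 2 (ℝ × ℝ)).measurableEmbedding,
    Measure.volume_eq_prod, integral_prod_symm _ (integrable_toLp hf)]

/-- Multiplication by a time cut-off extends a function by zero outside of the time interval. -/
lemma continuous_cutoff_mul {ζ : ℝ → ℝ} (hζ : Continuous ζ) {a b : ℝ}
    (hs : tsupport ζ ⊆ Ioo a b) {v : ℝ → ℝ → ℂ}
    (hv : ContinuousOn (Function.uncurry v) (Icc a b ×ˢ univ)) :
    Continuous fun z : ℝ × ℝ => (ζ z.1 : ℂ) * v z.1 z.2 := by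
  refine continuous_iff_continuousAt.2 fun z => ?_
  by_cases hz : z.1 ∈ tsupport ζ
  · have h1 : ContinuousAt (Function.uncurry v) z :=
      hv.continuousAt (prod_mem_nhds_iff.2 ⟨Icc_mem_nhds (hs hz).1 (hs hz).2, univ_mem⟩)
    have h2 : ContinuousAt (fun z : ℝ × ℝ => (ζ z.1 : ℂ)) z := by fun_prop
    exact h2.mul h1
  · have h1 : (fun z : ℝ × ℝ => (ζ z.1 : ℂ) * v z.1 z.2) =ᶠ[𝓝 z] fun _ => 0 := by
      have : ∀ᶠ z' in 𝓝 z, z'.1 ∉ tsupport ζ :=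
        continuous_fst.continuousAt.eventually
          ((isClosed_tsupport ζ).isOpen_compl.mem_nhds hz)
      filter_upwards [this] with z' hz'
      rw [image_eq_zero_of_notMem_tsupport hz']
      simp
    exact continuousAt_const.congr h1.symm

/-- A time cut-off makes a curve that is bounded in `L²` square integrable in space-time. -/
lemma memLp_onSpaceTime_cutoff_mul {ζ : ℝ → ℝ} (hζ : Continuous ζ) {a b : ℝ}
    (hs : tsupport ζ ⊆ Ioo a b) {v : ℝ → ℝ → ℂ}
    (hv : ContinuousOn (Function.uncurry v) (Icc a b ×ˢ univ)) {K : ℝ}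
    (hK : ∀ t ∈ Icc a b, eLpNorm (v t) 2 volume ≤ ENNReal.ofReal K) :
    MemLp (onSpaceTime fun t x => (ζ t : ℂ) * v t x) 2 volume := by
  have hc := continuous_cutoff_mul hζ hs hv
  have hsuppζ : HasCompactSupport ζ :=
    HasCompactSupport.of_support_subset_isCompact isCompact_Icc
      ((subset_tsupport ζ).trans (hs.trans Ioo_subset_Icc_self))
  have h2 : MemLp (fun z : ℝ × ℝ => (ζ z.1 : ℂ) * v z.1 z.2) 2 volume := by
    refine ⟨hc.aestronglyMeasurable, ?_⟩
    rw [eLpNorm_lt_top_iff_lintegral_rpow_enorm_lt_top (by norm_num) (by norm_num),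
      Measure.volume_eq_prod, lintegral_prod _ (hc.measurable.enorm.pow_const _).aemeasurable]
    have h3 : ∀ t, ∫⁻ x, ‖(ζ t : ℂ) * v t x‖ₑ ^ (2 : ℝ≥0∞).toReal ≤
        ‖ζ t‖ₑ ^ (2 : ℝ) * ENNReal.ofReal K ^ (2 : ℝ) := by
      intro t
      by_cases ht : t ∈ Icc a b
      · have e : ∀ x, ‖(ζ t : ℂ) * v t x‖ₑ ^ (2 : ℝ≥0∞).toReal =
            ‖ζ t‖ₑ ^ (2 : ℝ) * ‖v t x‖ₑ ^ (2 : ℝ) := by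
          intro x
          rw [enorm_mul, ENNReal.toReal_ofNat, ENNReal.mul_rpow_of_nonneg _ _ (by norm_num)]
          congr 2
          simp [← ofReal_norm]
        simp only [e]
        rw [lintegral_const_mul' _ _ (by finiteness)]
        gcongr
        have := hK t ht
        rw [eLpNorm_eq_lintegral_rpow_enorm_toReal (by norm_num) (by norm_num),
          ENNReal.toReal_ofNat] at this
        calc _ = ((∫⁻ x, ‖v t x‖ₑ ^ (2 : ℝ)) ^ (1 / (2 : ℝ))) ^ (2 : ℝ) := by
              rw [← ENNReal.rpow_mul]; norm_num
          _ ≤ _ := by gcongr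
      · have : ζ t = 0 := image_eq_zero_of_notMem_tsupport
          fun h => ht (Ioo_subset_Icc_self (hs h))
        simp [this]
    refine (lintegral_mono h3).trans_lt ?_
    rw [lintegral_mul_const _ (by fun_prop)]
    refine ENNReal.mul_lt_top ?_ (by finiteness)
    have h4 : MemLp ζ 2 volume := hζ.memLp_of_hasCompactSupport hsuppζ
    have := (eLpNorm_lt_top_iff_lintegral_rpow_enorm_lt_top (by norm_num) (by norm_num)).1 h4.2
    simpa using this
  exact h2.comp_measurePreserving (WithLp.volume_preserving_ofLp ℝ ℝ)

variable {T ω : ℝ} {ζ₀ ζ₁ : ℝ → ℝ} {u₀ : ℝ → ℂ} {u : ℝ → ℝ → ℂ}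

lemma IsSmoothSolution.memLp_cutoff_iteratedDeriv (hu : IsSmoothSolution T ω ζ₀ u₀ u) {ζ : ℝ → ℝ}
    (hζ : Continuous ζ) (hs : tsupport ζ ⊆ Ioo (-2 * T) (2 * T)) {k : ℕ} (hk : k ≤ 2) :
    MemLp (onSpaceTime fun t x => (ζ t : ℂ) * iteratedDeriv k (u t) x) 2 volume := by
  obtain ⟨K, -, hK⟩ := hu.exists_bound
  exact memLp_onSpaceTime_cutoff_mul hζ hs
    (continuousOn_iteratedDeriv hu.continuous_sobolev hu.contDiff_space hk)
    fun t ht => (hK t ht k hk).2.2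

lemma IsSmoothSolution.memLp_cutoff_cubic (hu : IsSmoothSolution T ω ζ₀ u₀ u) {ζ : ℝ → ℝ}
    (hζ : Continuous ζ) (hs : tsupport ζ ⊆ Ioo (-2 * T) (2 * T)) :
    MemLp (onSpaceTime fun t x => (ζ t : ℂ) * cubic (u t x)) 2 volume := by
  obtain ⟨K, hK0, hK⟩ := hu.exists_bound
  have hc := continuousOn_iteratedDeriv hu.continuous_sobolev hu.contDiff_space
    (k := 0) (by norm_num)
  simp only [iteratedDeriv_zero] at hc
  refine memLp_onSpaceTime_cutoff_mul (v := fun t x => cubic (u t x)) hζ hs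
    (continuous_cubic.comp_continuousOn hc) (K := K ^ 2 * K) fun t ht => ?_
  have h := hK t ht 0 (by norm_num)
  simp only [iteratedDeriv_zero] at h
  refine (eLpNorm_le_mul_eLpNorm_of_ae_le_mul (g := u t) (c := K ^ 2)
    (Eventually.of_forall fun x => ?_) _).trans ?_
  · rw [norm_cubic, pow_succ]
    gcongr
    exact h.1 x
  · rw [ENNReal.ofReal_mul (by positivity)]
    gcongr
    exact h.2.2

lemma IsSmoothSolution.continuous_cutoff (hu : IsSmoothSolution T ω ζ₀ u₀ u) {ζ : ℝ → ℝ}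
    (hζ : Continuous ζ) (hs : tsupport ζ ⊆ Ioo (-2 * T) (2 * T)) :
    Continuous (onSpaceTime fun t x => (ζ t : ℂ) * u t x) := by
  have hc := continuousOn_iteratedDeriv hu.continuous_sobolev hu.contDiff_space
    (k := 0) (by norm_num)
  simp only [iteratedDeriv_zero] at hc
  exact (continuous_cutoff_mul hζ hs hc).comp (WithLp.prod_continuous_ofLp 2 ℝ ℝ)

/-- The unit vector of space-time in the time direction. -/
def timeDir : SpaceTime := WithLp.toLp 2 (1, 0)

/-- The unit vector of space-time in the space direction. -/
def spaceDir : SpaceTime := WithLp.toLp 2 (0, 1)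

lemma IsSmoothSolution.hasLineDerivAt_space (hu : IsSmoothSolution T ω ζ₀ u₀ u) {ζ : ℝ → ℝ}
    (hs : tsupport ζ ⊆ Ioo (-2 * T) (2 * T)) {k : ℕ} (hk : k < 2) (p : SpaceTime) :
    HasLineDerivAt ℝ (onSpaceTime fun t x => (ζ t : ℂ) * iteratedDeriv k (u t) x)
      (onSpaceTime (fun t x => (ζ t : ℂ) * iteratedDeriv (k + 1) (u t) x) p) p spaceDir := by
  have e : (fun a : ℝ => onSpaceTime (fun t x => (ζ t : ℂ) * iteratedDeriv k (u t) x)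
      (p + a • spaceDir)) = fun a => (ζ p.fst : ℂ) * iteratedDeriv k (u p.fst) (p.snd + a) := by
    ext a
    simp [onSpaceTime, spaceDir]
  rw [HasLineDerivAt, e]
  by_cases ht : p.fst ∈ tsupport ζ
  · have hc := hu.contDiff_space _ (Ioo_subset_Icc_self (hs ht))
    have hd : Differentiable ℝ (iteratedDeriv k (u p.fst)) :=
      hc.differentiable_iteratedDeriv k (by exact_mod_cast hk)
    have h1 := (hd p.snd).hasDerivAt
    rw [← iteratedDeriv_succ] at h1
    have h2 : HasDerivAt (fun a => iteratedDeriv k (u p.fst) (p.snd + a))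
        (iteratedDeriv (k + 1) (u p.fst) p.snd) 0 := by
      refine HasDerivAt.comp_const_add p.snd 0 ?_
      simpa using h1
    exact h2.const_mul _
  · have : ζ p.fst = 0 := image_eq_zero_of_notMem_tsupport ht
    simpa [onSpaceTime, this] using hasDerivAt_const (0 : ℝ) (0 : ℂ)

/-- The time derivative of `ζ u`, with `u_t` replaced by means of the equation. -/
lemma IsSmoothSolution.hasLineDerivAt_time (hu : IsSmoothSolution T ω ζ₀ u₀ u) {ζ : ℝ → ℝ}
    (hζ : Differentiable ℝ ζ) (hs : tsupport ζ ⊆ Ioo (-2 * T) (2 * T)) (p : SpaceTime) :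
    HasLineDerivAt ℝ (onSpaceTime fun t x => (ζ t : ℂ) * u t x)
      (onSpaceTime (fun t x => ((deriv ζ t : ℝ) : ℂ) * u t x + (Complex.I *
        ((ζ t : ℂ) * iteratedDeriv 2 (u t) x) + Complex.I *
          (((ζ t * (ζ₀ t * ω) : ℝ) : ℂ) * cubic (u t x)))) p) p timeDir := by
  have e : (fun a : ℝ => onSpaceTime (fun t x => (ζ t : ℂ) * u t x)
      (p + a • timeDir)) = fun a => (ζ (p.fst + a) : ℂ) * u (p.fst + a) p.snd := by
    ext a
    simp [onSpaceTime, timeDir]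
  rw [HasLineDerivAt, e]
  refine HasDerivAt.comp_const_add (f := fun t => (ζ t : ℂ) * u t p.snd) p.fst 0 ?_
  rw [add_zero]
  by_cases ht : p.fst ∈ tsupport ζ
  · have h1 := hu.hasDerivAt_time (hs ht) p.snd
    have h2 := (hζ p.fst).hasDerivAt.ofReal_comp
    refine (h2.mul h1).congr_deriv ?_
    simp only [onSpaceTime]
    push_cast
    ring
  · have h1 : (fun t => (ζ t : ℂ) * u t p.snd) =ᶠ[𝓝 p.fst] fun _ => 0 := by
      filter_upwards [(isClosed_tsupport ζ).isOpen_compl.mem_nhds ht] with t ht'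
      rw [image_eq_zero_of_notMem_tsupport ht']
      simp
    have h2 : ζ p.fst = 0 := image_eq_zero_of_notMem_tsupport ht
    have h3 : deriv ζ p.fst = 0 := image_eq_zero_of_notMem_tsupport
      fun h => ht (tsupport_deriv_subset h)
    simpa [onSpaceTime, h2, h3] using (hasDerivAt_const p.fst (0 : ℂ)).congr_of_eventuallyEq h1

end SpaceTimeRegularity

/-! ### Integrability of the space-time Fourier transform -/

section Parabolic

/-- The weight `1 + |2πτ| + |2πξ|²`, the symbol of one derivative in time plus two in space. -/
def parabolicWeight (ξ τ : ℝ) : ℝ := 1 + |2 * Real.pi * τ| + (2 * Real.pi * ξ) ^ 2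

@[fun_prop]
lemma _root_.Measurable.parabolicWeight {S : Type*} [MeasurableSpace S] {ξ τ : S → ℝ}
    (hξ : Measurable ξ) (hτ : Measurable τ) :
    Measurable fun x => parabolicWeight (ξ x) (τ x) := by
  unfold NLS.parabolicWeight
  simp only [← Real.norm_eq_abs]
  fun_prop

lemma bracket_le_one_add_abs (x : ℝ) : bracket x ≤ 1 + |x| := by
  rw [bracket]
  refine Real.sqrt_le_iff.2 ⟨by positivity, ?_⟩
  nlinarith [abs_nonneg x, sq_abs x]

lemma bracket_sq (x : ℝ) : bracket x ^ 2 = 1 + x ^ 2 := Real.sq_sqrt (by positivity)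

/-- The parabolic weight splits into powers of `⟨τ⟩` and `⟨ξ⟩`; with the exponents `5/8 + 3/8 = 1`
both factors are square integrable. -/
lemma one_le_parabolicWeight_mul (ξ τ : ℝ) :
    1 ≤ parabolicWeight ξ τ *
      (bracket (2 * Real.pi * τ) ^ (-(5 / 8) : ℝ) *
        bracket (2 * Real.pi * ξ) ^ (-(3 / 4) : ℝ)) := by
  set N := parabolicWeight ξ τ with hN
  have h1 : bracket (2 * Real.pi * τ) ≤ N := by
    refine (bracket_le_one_add_abs _).trans ?_
    rw [hN, parabolicWeight]
    have := sq_nonneg (2 * Real.pi * ξ)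
    linarith
  have h2 : bracket (2 * Real.pi * ξ) ^ 2 ≤ N := by
    rw [bracket_sq, hN, parabolicWeight]
    have := abs_nonneg (2 * Real.pi * τ)
    linarith
  have p1 := bracket_pos (2 * Real.pi * τ)
  have p2 := bracket_pos (2 * Real.pi * ξ)
  have pN : 0 < N := p1.trans_le h1
  have h3 : bracket (2 * Real.pi * τ) ^ (5 / 8 : ℝ) *
      bracket (2 * Real.pi * ξ) ^ (3 / 4 : ℝ) ≤ N := by
    calc _ = bracket (2 * Real.pi * τ) ^ (5 / 8 : ℝ) *
          (bracket (2 * Real.pi * ξ) ^ 2) ^ (3 / 8 : ℝ) := by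
          rw [← Real.rpow_natCast, ← Real.rpow_mul p2.le]; norm_num
      _ ≤ N ^ (5 / 8 : ℝ) * N ^ (3 / 8 : ℝ) := by gcongr
      _ = N := by rw [← Real.rpow_add pN]; norm_num
  rw [Real.rpow_neg p1.le, Real.rpow_neg p2.le, ← mul_inv]
  rw [← div_eq_mul_inv, le_div_iff₀ (by positivity), one_mul]
  exact h3

lemma lintegral_mul_sq_le {S : Type*} [MeasurableSpace S] {μ : Measure S} {f g : S → ℝ≥0∞}
    (hf : AEMeasurable f μ) (hg : AEMeasurable g μ) :
    (∫⁻ x, f x * g x ∂μ) ^ 2 ≤ (∫⁻ x, f x ^ 2 ∂μ) * ∫⁻ x, g x ^ 2 ∂μ := by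
  have h := ENNReal.lintegral_mul_le_Lp_mul_Lq μ (p := 2) (q := 2)
    (Real.holderConjugate_iff.2 ⟨by norm_num, by norm_num⟩) hf hg
  simp only [Pi.mul_apply, ENNReal.rpow_ofNat] at h
  calc _ ≤ ((∫⁻ x, f x ^ 2 ∂μ) ^ (1 / 2 : ℝ) * (∫⁻ x, g x ^ 2 ∂μ) ^ (1 / 2 : ℝ)) ^ 2 := by
        gcongr
    _ = _ := by
        rw [mul_pow, ← ENNReal.rpow_natCast, ← ENNReal.rpow_natCast, ← ENNReal.rpow_mul,
          ← ENNReal.rpow_mul]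
        norm_num

/-- If the parabolic weight times `w` is square integrable, the integral of `w` in `τ` is a
function of `ξ` in `L¹ ∩ L²`. -/
lemma lintegral_lt_top_of_parabolicWeight {w : ℝ → ℝ → ℝ≥0∞} (hw : Measurable (Function.uncurry w))
    (h : ∫⁻ ξ, ∫⁻ τ, (ENNReal.ofReal (parabolicWeight ξ τ) * w ξ τ) ^ 2 < ∞) :
    ∫⁻ ξ, ∫⁻ τ, w ξ τ < ∞ ∧ ∫⁻ ξ, (∫⁻ τ, w ξ τ) ^ 2 < ∞ := by
  set β : ℝ → ℝ≥0∞ := fun τ => ENNReal.ofReal (bracket (2 * Real.pi * τ) ^ (-(5 / 8) : ℝ)) with hβ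
  set γ : ℝ → ℝ≥0∞ := fun ξ => ENNReal.ofReal (bracket (2 * Real.pi * ξ) ^ (-(3 / 4) : ℝ)) with hγ
  have hβm : Measurable β := by fun_prop
  have hγm : Measurable γ := by fun_prop
  have hβi : ∫⁻ τ, β τ ^ 2 < ∞ := lintegral_bracket_rpow_lt_top (b := 5 / 8) (by norm_num)
  have hγi : ∫⁻ ξ, γ ξ ^ 2 < ∞ := lintegral_bracket_rpow_lt_top (b := 3 / 4) (by norm_num)
  obtain ⟨F, hF⟩ : ∃ F : ℝ → ℝ → ℝ≥0∞,
      F = fun ξ τ => ENNReal.ofReal (parabolicWeight ξ τ) * w ξ τ := ⟨_, rfl⟩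
  have hFm : Measurable (Function.uncurry F) := by
    have : Measurable fun z : ℝ × ℝ => F z.1 z.2 := by simp only [hF]; fun_prop
    exact this
  have hFi : ∫⁻ ξ, ∫⁻ τ, F ξ τ ^ 2 < ∞ := by rw [hF]; exact h
  have hpt : ∀ ξ τ, w ξ τ ≤ F ξ τ * (β τ * γ ξ) := by
    intro ξ τ
    have h1 := ENNReal.ofReal_le_ofReal (one_le_parabolicWeight_mul ξ τ)
    have p1 := bracket_pos (2 * Real.pi * τ)
    have p2 := bracket_pos (2 * Real.pi * ξ)
    rw [ENNReal.ofReal_one, ENNReal.ofReal_mul (by rw [parabolicWeight]; positivity),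
      ENNReal.ofReal_mul (by positivity)] at h1
    calc w ξ τ = 1 * w ξ τ := (one_mul _).symm
      _ ≤ _ := mul_le_mul_left h1 _
      _ = _ := by rw [hF]; ring
  constructor
  · calc ∫⁻ ξ, ∫⁻ τ, w ξ τ ≤ ∫⁻ ξ, ∫⁻ τ, (F ξ τ ^ 2 + (β τ * γ ξ) ^ 2) :=
          lintegral_mono fun ξ => lintegral_mono fun τ =>
            (hpt ξ τ).trans (ennreal_mul_le_add_sq _ _)
      _ = (∫⁻ ξ, ∫⁻ τ, F ξ τ ^ 2) + ∫⁻ ξ, ∫⁻ τ, (β τ * γ ξ) ^ 2 := by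
          rw [← lintegral_add_left (by fun_prop)]
          refine lintegral_congr fun ξ => ?_
          rw [lintegral_add_left (by fun_prop)]
      _ = (∫⁻ ξ, ∫⁻ τ, F ξ τ ^ 2) + (∫⁻ τ, β τ ^ 2) * ∫⁻ ξ, γ ξ ^ 2 := by
          simp only [mul_pow]
          congr 1
          rw [← lintegral_const_mul _ (by fun_prop)]
          refine lintegral_congr fun ξ => ?_
          rw [lintegral_mul_const _ (by fun_prop)]
      _ < ∞ := ENNReal.add_lt_top.2 ⟨hFi, ENNReal.mul_lt_top hβi hγi⟩
  · have hγ1 : ∀ ξ, γ ξ ≤ 1 := fun ξ => by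
      rw [← ENNReal.ofReal_one]
      exact ENNReal.ofReal_le_ofReal
        (Real.rpow_le_one_of_one_le_of_nonpos (one_le_bracket _) (by norm_num))
    calc ∫⁻ ξ, (∫⁻ τ, w ξ τ) ^ 2 ≤ ∫⁻ ξ, (∫⁻ τ, F ξ τ ^ 2) * ∫⁻ τ, β τ ^ 2 := by
          refine lintegral_mono fun ξ => ?_
          refine le_trans ?_ (lintegral_mul_sq_le (f := F ξ) (g := β) (by fun_prop) (by fun_prop))
          gcongr with τ
          refine (hpt ξ τ).trans ?_
          gcongr
          exact mul_le_of_le_one_right' (hγ1 ξ)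
      _ = (∫⁻ ξ, ∫⁻ τ, F ξ τ ^ 2) * ∫⁻ τ, β τ ^ 2 := by
          rw [lintegral_mul_const _ (by fun_prop)]
      _ < ∞ := ENNReal.mul_lt_top hFi hβi

variable {T ω : ℝ} {ζ₀ ζ₁ : ℝ → ℝ} {u₀ : ℝ → ℂ} {u : ℝ → ℝ → ℂ}

lemma inner_timeDir (p : SpaceTime) : inner ℝ p timeDir = p.fst := by
  simp [timeDir, WithLp.prod_inner_apply]

lemma inner_spaceDir (p : SpaceTime) : inner ℝ p spaceDir = p.snd := by
  simp [spaceDir, WithLp.prod_inner_apply]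

lemma IsSmoothSolution.memLp_cutoff (hu : IsSmoothSolution T ω ζ₀ u₀ u)
    (hζ : IsCutoffPair T ζ₀ ζ₁) :
    MemLp (onSpaceTime fun t x => (ζ₁ t : ℂ) * u t x) 2 volume := by
  have := hu.memLp_cutoff_iteratedDeriv hζ.smooth_one.continuous hζ.supp_one (k := 0) (by norm_num)
  simpa only [iteratedDeriv_zero] using this

/-- One time derivative and two space derivatives of `ζ₁ u` are square integrable. -/
lemma IsSmoothSolution.memLp_parabolicWeight (hu : IsSmoothSolution T ω ζ₀ u₀ u)
    (hζ : IsCutoffPair T ζ₀ ζ₁) :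
    MemLp (fun p : SpaceTime => (parabolicWeight p.snd p.fst : ℂ) *
      fourierLp _ (hu.memLp_cutoff hζ) p) 2 volume := by
  have hζc := hζ.smooth_one.continuous
  have hs := hζ.supp_one
  have hζ' : Continuous (deriv ζ₁) := hζ.smooth_one.continuous_deriv (by simp)
  have hs' : tsupport (deriv ζ₁) ⊆ Ioo (-2 * T) (2 * T) := tsupport_deriv_subset.trans hs
  have m0 := hu.memLp_cutoff hζ
  have m1 := hu.memLp_cutoff_iteratedDeriv hζc hs (k := 1) (by norm_num)
  have m2 := hu.memLp_cutoff_iteratedDeriv hζc hs (k := 2) le_rfl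
  have n0 := hu.memLp_cutoff_iteratedDeriv hζ' hs' (k := 0) (by norm_num)
  simp only [iteratedDeriv_zero] at n0
  have n1 := hu.memLp_cutoff_cubic (ζ := fun t => ζ₁ t * (ζ₀ t * ω))
    (hζc.mul (hζ.smooth_zero.continuous.mul continuous_const))
    ((tsupport_mul_subset_left).trans hs)
  have nt : MemLp (onSpaceTime fun t x => ((deriv ζ₁ t : ℝ) : ℂ) * u t x + (Complex.I *
        ((ζ₁ t : ℂ) * iteratedDeriv 2 (u t) x) + Complex.I *
          (((ζ₁ t * (ζ₀ t * ω) : ℝ) : ℂ) * cubic (u t x)))) 2 volume :=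
    n0.add ((m2.const_mul Complex.I).add (n1.const_mul Complex.I))
  have et := fourier_lineDeriv_ae_eq timeDir m0 nt
    (hu.hasLineDerivAt_time (hζ.smooth_one.differentiable (by simp)) hs)
  have es := fourier_lineDeriv_ae_eq spaceDir m0 m1 (by
    have := hu.hasLineDerivAt_space hs (k := 0) (by norm_num)
    simpa only [iteratedDeriv_zero] using this)
  have es' := fourier_lineDeriv_ae_eq spaceDir m1 m2 (hu.hasLineDerivAt_space hs (by norm_num))
  have hW := memLp_fourierLp m0
  have hg := (hW.norm.add (memLp_fourierLp nt).norm).add (memLp_fourierLp m2).norm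
  refine hg.of_le ?_ ?_
  · have : Measurable fun p : SpaceTime => (parabolicWeight p.snd p.fst : ℂ) := by fun_prop
    exact (this.mul (stronglyMeasurable_fourierLp m0).measurable).aestronglyMeasurable
  · filter_upwards [et, es, es'] with p h1 h2 h3
    rw [h2, ← mul_assoc] at h3
    simp only [Pi.add_apply]
    rw [fourierLp, fourierLp, fourierLp, h1, h3, inner_timeDir, inner_spaceDir]
    refine le_of_eq ?_
    rw [Real.norm_of_nonneg (by positivity)]
    simp only [norm_mul, Complex.norm_real, parabolicWeight, Complex.norm_I, mul_one,
      Complex.norm_ofNat, Real.norm_eq_abs]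
    rw [abs_of_nonneg (by positivity : (0 : ℝ) ≤ 1 + |2 * Real.pi * p.fst| +
      (2 * Real.pi * p.snd) ^ 2), ← sq_abs (2 * Real.pi * p.snd), abs_mul, abs_mul, abs_mul,
      abs_mul]
    simp only [abs_two]
    ring

end Parabolic

/-! ### Slices of the space-time Fourier transform -/

section Slices

variable {T ω : ℝ} {ζ₀ ζ₁ : ℝ → ℝ} {u₀ : ℝ → ℂ} {u : ℝ → ℝ → ℂ}

/-- The space-time Fourier transform of `w`, as a function of `(ξ, τ)`. -/
def spaceTimeFourier (w : ℝ → ℝ → ℂ) (hw : MemLp (onSpaceTime w) 2 volume) (ξ τ : ℝ) : ℂ :=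
  fourierLp (onSpaceTime w) hw (WithLp.toLp 2 (τ, ξ))

lemma measurable_spaceTimeFourier {w : ℝ → ℝ → ℂ} (hw : MemLp (onSpaceTime w) 2 volume) :
    Measurable (Function.uncurry (spaceTimeFourier w hw)) := by
  have h1 := (stronglyMeasurable_fourierLp hw).measurable
  have h2 : Measurable fun z : ℝ × ℝ => (WithLp.toLp 2 (z.2, z.1) : SpaceTime) :=
    (WithLp.volume_preserving_toLp ℝ ℝ).measurable.comp measurable_swap
  exact h1.comp h2

lemma bourgainNorm_sq (κ r b : ℝ) {w : ℝ → ℝ → ℂ} (hw : MemLp (onSpaceTime w) 2 volume) :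
    bourgainNorm κ r b w ^ 2 = ENNReal.ofReal ((2 * Real.pi) ^ 2) *
      ∫⁻ ξ, ∫⁻ τ, ‖spaceTimeFourier w hw ξ τ‖ₑ ^ 2 *
        ENNReal.ofReal (bracket (2 * Real.pi * τ - κ * (2 * Real.pi * ξ) ^ 2) ^ (2 * b) *
          bracket (2 * Real.pi * ξ) ^ (2 * r)) := by
  have hm := (stronglyMeasurable_fourierLp hw).measurable
  set g : SpaceTime → ℝ≥0∞ := fun p => ‖fourierLp (onSpaceTime w) hw p‖ₑ ^ 2 *
    ENNReal.ofReal (bracket (2 * Real.pi * p.fst - κ * (2 * Real.pi * p.snd) ^ 2) ^ (2 * b) *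
      bracket (2 * Real.pi * p.snd) ^ (2 * r)) with hg
  have hgm : Measurable g := by fun_prop
  have h1 : bourgainNorm κ r b w ^ 2 = ∫⁻ p, g ((2 * Real.pi)⁻¹ • p) := by
    rw [bourgainNorm, dif_pos hw, ← ENNReal.rpow_natCast, ← ENNReal.rpow_mul]
    norm_num
    refine lintegral_congr fun p => ?_
    have e : ∀ x : ℝ, 2 * Real.pi * ((Real.pi⁻¹ * 2⁻¹) * x) = x := by
      intro x
      have := Real.pi_pos.ne'
      field_simp
    simp [hg, fourierL2, fourierLp, e]
  have h2 : Module.finrank ℝ SpaceTime = 2 := by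
    rw [(WithLp.linearEquiv 2 ℝ (ℝ × ℝ)).finrank_eq]
    simp
  rw [h1, lintegral_comp_smul' g Real.two_pi_pos, h2, lintegral_spaceTime hgm]
  rfl

/-- The spatial Fourier transform of the slice at time `t`, recovered from the space-time
Fourier transform `W`. -/
def timeSlice (W : ℝ → ℝ → ℂ) (t ξ : ℝ) : ℂ :=
  ∫ τ : ℝ, Complex.exp (2 * Real.pi * t * τ * Complex.I) * W ξ τ

lemma norm_exp_two_pi (a b : ℝ) : ‖Complex.exp (2 * Real.pi * a * b * Complex.I)‖ = 1 := by
  have := Complex.norm_exp_ofReal_mul_I (2 * Real.pi * a * b)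
  push_cast at this
  exact this

lemma enorm_exp_two_pi (a b : ℝ) : ‖Complex.exp (2 * Real.pi * a * b * Complex.I)‖ₑ = 1 := by
  rw [← ofReal_norm, norm_exp_two_pi, ENNReal.ofReal_one]

lemma enorm_timeSlice_le (W : ℝ → ℝ → ℂ) (t ξ : ℝ) :
    ‖timeSlice W t ξ‖ₑ ≤ ∫⁻ τ, ‖W ξ τ‖ₑ := by
  refine (enorm_integral_le_lintegral_enorm _).trans (lintegral_mono fun τ => ?_)
  rw [enorm_mul, enorm_exp_two_pi, one_mul]

lemma measurable_timeSlice {W : ℝ → ℝ → ℂ} (hW : Measurable (Function.uncurry W)) (t : ℝ) :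
    Measurable (timeSlice W t) := by
  have h : StronglyMeasurable fun z : ℝ × ℝ =>
      Complex.exp (2 * Real.pi * t * z.2 * Complex.I) * W z.1 z.2 := by
    refine Measurable.stronglyMeasurable ?_
    fun_prop
  exact h.integral_prod_right'.measurable

lemma IsSmoothSolution.lintegral_spaceTimeFourier_lt_top (hu : IsSmoothSolution T ω ζ₀ u₀ u)
    (hζ : IsCutoffPair T ζ₀ ζ₁) :
    ∫⁻ ξ, ∫⁻ τ, ‖spaceTimeFourier _ (hu.memLp_cutoff hζ) ξ τ‖ₑ < ∞ ∧
      ∫⁻ ξ, (∫⁻ τ, ‖spaceTimeFourier _ (hu.memLp_cutoff hζ) ξ τ‖ₑ) ^ 2 < ∞ := by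
  have hw := hu.memLp_cutoff hζ
  have hm := measurable_spaceTimeFourier hw
  have hm' := (stronglyMeasurable_fourierLp hw).measurable
  refine lintegral_lt_top_of_parabolicWeight
    (w := fun ξ τ => ‖spaceTimeFourier _ hw ξ τ‖ₑ) (Measurable.enorm hm) ?_
  have h := (eLpNorm_lt_top_iff_lintegral_rpow_enorm_lt_top (by norm_num) (by norm_num)).1
    (hu.memLp_parabolicWeight hζ).2
  rw [lintegral_spaceTime (by fun_prop)] at h
  simp only [ENNReal.toReal_ofNat, ENNReal.rpow_ofNat, enorm_mul] at h
  refine lt_of_le_of_lt (le_of_eq ?_) h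
  refine lintegral_congr fun ξ => lintegral_congr fun τ => ?_
  have : ‖(parabolicWeight ξ τ : ℂ)‖ₑ = ENNReal.ofReal (parabolicWeight ξ τ) := by
    rw [← ofReal_norm, Complex.norm_real, Real.norm_of_nonneg]
    rw [parabolicWeight]; positivity
  rw [← this]
  rfl

/-- Each slice of `ζ₁ u` is, at every point, the inverse Fourier integral of the slice of the
space-time transform. -/
lemma IsSmoothSolution.eq_fourierInv_timeSlice (hu : IsSmoothSolution T ω ζ₀ u₀ u)
    (hζ : IsCutoffPair T ζ₀ ζ₁) (t : ℝ) :
    (fun x => (ζ₁ t : ℂ) * u t x) =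
      𝓕⁻ (timeSlice (spaceTimeFourier _ (hu.memLp_cutoff hζ)) t) := by
  have hw := hu.memLp_cutoff hζ
  have hm' := (stronglyMeasurable_fourierLp hw).measurable
  have hint : Integrable (fourierLp _ hw) := by
    refine ⟨hm'.aestronglyMeasurable, ?_⟩
    rw [HasFiniteIntegral, lintegral_spaceTime (by fun_prop)]
    exact (hu.lintegral_spaceTimeFourier_lt_top hζ).1
  have h := eq_fourierInv_fourierLp hw
    (hu.continuous_cutoff hζ.smooth_one.continuous hζ.supp_one) hint
  ext x
  have hx := congrFun h (WithLp.toLp 2 (t, x))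
  have hi : Integrable fun p : SpaceTime =>
      Complex.exp (↑(2 * Real.pi * inner ℝ p (WithLp.toLp 2 (t, x) : SpaceTime)) * Complex.I) •
        fourierLp _ hw p := by
    refine hint.bdd_mul (c := 1) ?_ (Eventually.of_forall fun p => ?_)
    · have : Continuous fun p : SpaceTime => Complex.exp
        (↑(2 * Real.pi * inner ℝ p (WithLp.toLp 2 (t, x) : SpaceTime)) * Complex.I) := by fun_prop
      exact this.aestronglyMeasurable
    · rw [Complex.norm_exp_ofReal_mul_I]
  rw [Real.fourierInv_eq', integral_spaceTime hi] at hx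
  rw [Real.fourierInv_eq']
  refine hx.trans (integral_congr_ae (Eventually.of_forall fun ξ => ?_))
  simp only [timeSlice, smul_eq_mul]
  rw [← integral_const_mul]
  refine integral_congr_ae (Eventually.of_forall fun τ => ?_)
  simp only [spaceTimeFourier]
  rw [← mul_assoc, ← Complex.exp_add]
  congr 2
  simp only [WithLp.prod_inner_apply, RCLike.inner_apply, conj_trivial]
  push_cast
  ring

end Slices

/-! ### Oscillatory integrals in time -/

lemma abs_le_integral_abs_deriv {ζ : ℝ → ℝ} (hζ : ContDiff ℝ 1 ζ) (hc : HasCompactSupport ζ)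
    (t : ℝ) : |ζ t| ≤ ∫ r, |deriv ζ r| := by
  have hi : Integrable (deriv ζ) :=
    (hζ.continuous_deriv le_rfl).integrable_of_hasCompactSupport hc.deriv
  rw [← hc.integral_Iic_deriv_eq hζ t]
  refine (norm_integral_le_integral_norm (f := deriv ζ) (μ := volume.restrict (Iic t))).trans ?_
  exact setIntegral_le_integral hi.norm (Eventually.of_forall fun r => norm_nonneg _)

/-- Integration by parts: the bounded variation of `ζ` gives one power of decay. -/
lemma norm_integral_mul_exp_le {ζ : ℝ → ℝ} (hζ : ContDiff ℝ 1 ζ) (hc : HasCompactSupport ζ)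
    {M L t : ℝ} (hM : ∫ r, |deriv ζ r| ≤ M) (ht : |t| ≤ L) (θ : ℝ) :
    ‖∫ r in (0 : ℝ)..t, (ζ r : ℂ) * Complex.exp (2 * Real.pi * r * θ * Complex.I)‖ ≤
      (L + 3) * M * timeDecay θ := by
  have hb : ∀ r, |ζ r| ≤ M := fun r => (abs_le_integral_abs_deriv hζ hc r).trans hM
  have hM0 : 0 ≤ M := (abs_nonneg _).trans (hb 0)
  set I := ∫ r in (0 : ℝ)..t, (ζ r : ℂ) * Complex.exp (2 * Real.pi * r * θ * Complex.I) with hI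
  have h1 : ‖I‖ ≤ M * L := by
    refine (intervalIntegral.norm_integral_le_of_norm_le_const (C := M) fun r _ => ?_).trans ?_
    · rw [norm_mul, norm_exp_two_pi, mul_one, Complex.norm_real]
      exact hb r
    · rw [sub_zero]; gcongr
  have h2 : |2 * Real.pi * θ| * ‖I‖ ≤ 3 * M := by
    set v : ℝ → ℂ := fun r => Complex.exp (2 * Real.pi * r * θ * Complex.I) with hv
    have hvd : ∀ r, HasDerivAt v (2 * Real.pi * θ * Complex.I * v r) r := by
      intro r
      have h : HasDerivAt (fun r : ℝ => (2 * Real.pi * r * θ * Complex.I : ℂ))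
          (2 * Real.pi * 1 * θ * Complex.I) r :=
        (((hasDerivAt_id r).ofReal_comp.const_mul (2 * Real.pi : ℂ)).mul_const (θ : ℂ)).mul_const
          Complex.I
      refine h.cexp.congr_deriv ?_
      simp only [hv]; ring
    have hvc : Continuous v := by fun_prop
    have hζd : ∀ r, HasDerivAt (fun r => (ζ r : ℂ)) ((deriv ζ r : ℝ) : ℂ) r := fun r =>
      ((hζ.differentiable one_ne_zero) r).hasDerivAt.ofReal_comp
    have hζc : Continuous (deriv ζ) := hζ.continuous_deriv le_rfl
    have hparts := intervalIntegral.integral_mul_deriv_eq_deriv_mul (a := 0) (b := t)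
      (fun r _ => hζd r) (fun r _ => hvd r)
      (Continuous.intervalIntegrable (by fun_prop) _ _)
      (Continuous.intervalIntegrable (by fun_prop) _ _)
    have e1 : ∫ r in (0 : ℝ)..t, (ζ r : ℂ) * (2 * Real.pi * θ * Complex.I * v r) =
        2 * Real.pi * θ * Complex.I * I := by
      rw [hI, ← intervalIntegral.integral_const_mul]
      refine intervalIntegral.integral_congr fun r _ => ?_
      simp only [hv]; ring
    have e2 : |2 * Real.pi * θ| * ‖I‖ = ‖2 * Real.pi * θ * Complex.I * I‖ := by
      rw [norm_mul, norm_mul, Complex.norm_I, mul_one]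
      have := Complex.norm_real (2 * Real.pi * θ)
      push_cast at this
      rw [this, Real.norm_eq_abs]
    have hv1 : ∀ r, ‖v r‖ = 1 := fun r => norm_exp_two_pi r θ
    have e3 : ‖∫ r in (0 : ℝ)..t, ((deriv ζ r : ℝ) : ℂ) * v r‖ ≤ M := by
      have hi : Integrable (deriv ζ) := hζc.integrable_of_hasCompactSupport hc.deriv
      calc _ ≤ ∫ r in uIoc 0 t, ‖((deriv ζ r : ℝ) : ℂ) * v r‖ :=
            intervalIntegral.norm_integral_le_integral_norm_uIoc
        _ = ∫ r in uIoc 0 t, |deriv ζ r| := by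
            simp only [norm_mul, hv1, mul_one, Complex.norm_real, Real.norm_eq_abs]
        _ ≤ ∫ r, |deriv ζ r| :=
            setIntegral_le_integral hi.norm (Eventually.of_forall fun r => abs_nonneg _)
        _ ≤ M := hM
    have hz : ∀ r, ‖(ζ r : ℂ) * v r‖ ≤ M := fun r => by
      rw [norm_mul, hv1, mul_one, Complex.norm_real]; exact hb r
    rw [e2, ← e1, hparts]
    calc _ ≤ ‖(ζ t : ℂ) * v t‖ + ‖(ζ 0 : ℂ) * v 0‖ +
          ‖∫ r in (0 : ℝ)..t, ((deriv ζ r : ℝ) : ℂ) * v r‖ :=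
          (norm_sub_le _ _).trans (add_le_add_left (norm_sub_le _ _) _)
      _ ≤ M + M + M := add_le_add (add_le_add (hz t) (hz 0)) e3
      _ = 3 * M := by ring
  -- The two bounds add up to one for `(1 + |2πθ|) ‖I‖`.
  rw [timeDecay, ← div_eq_mul_inv, le_div_iff₀ (by positivity)]
  nlinarith

/-- Fubini: the integral in time of a superposition of oscillations, against a time cut-off, is
bounded by the decay of the individual oscillations. -/
lemma integral_superposition_le {Y : Type*} [MeasurableSpace Y] {μ : Measure Y} [SFinite μ]
    {A : Y → ℂ} (hA : Integrable A μ) {θ : Y → ℝ} (hθ : Measurable θ) {ζ : ℝ → ℝ}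
    (hζ : Continuous ζ) {t K : ℝ}
    (hK : ∀ a : ℝ, ‖∫ r in (0 : ℝ)..t, (ζ r : ℂ) *
      Complex.exp (2 * Real.pi * r * a * Complex.I)‖ ≤ K * timeDecay a) :
    IntervalIntegrable (fun r => (ζ r : ℂ) *
      ∫ y, Complex.exp (2 * Real.pi * r * θ y * Complex.I) * A y ∂μ) volume 0 t ∧
    ‖∫ r in (0 : ℝ)..t, (ζ r : ℂ) *
      ∫ y, Complex.exp (2 * Real.pi * r * θ y * Complex.I) * A y ∂μ‖ₑ ≤
      ∫⁻ y, ‖A y‖ₑ * ENNReal.ofReal (K * timeDecay (θ y)) ∂μ := by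
  have hζi : Integrable (fun r => (ζ r : ℂ)) (volume.restrict (uIoc 0 t)) := by
    have : IntervalIntegrable (fun r => (ζ r : ℂ)) volume 0 t :=
      Continuous.intervalIntegrable (by fun_prop) _ _
    exact intervalIntegrable_iff.1 this
  have hF : Integrable (fun z : ℝ × Y => (ζ z.1 : ℂ) *
      (Complex.exp (2 * Real.pi * z.1 * θ z.2 * Complex.I) * A z.2))
      ((volume.restrict (uIoc 0 t)).prod μ) := by
    have h1 := hζi.mul_prod hA
    have h2 : Measurable fun z : ℝ × Y => Complex.exp (2 * Real.pi * z.1 * θ z.2 * Complex.I) := by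
      fun_prop
    refine (h1.bdd_mul (c := 1) h2.aestronglyMeasurable
      (Eventually.of_forall fun z => (norm_exp_two_pi _ _).le)).congr
      (Eventually.of_forall fun z => ?_)
    simp only
    ring
  have hpull : ∀ r, (ζ r : ℂ) * ∫ y, Complex.exp (2 * Real.pi * r * θ y * Complex.I) * A y ∂μ =
      ∫ y, (ζ r : ℂ) * (Complex.exp (2 * Real.pi * r * θ y * Complex.I) * A y) ∂μ := fun r =>
    (integral_const_mul _ _).symm
  simp only [hpull]
  constructor
  · exact intervalIntegrable_iff.2 hF.integral_prod_left
  · rw [intervalIntegral_integral_swap hF]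
    refine (enorm_integral_le_lintegral_enorm _).trans (lintegral_mono fun y => ?_)
    have e : ∫ r in (0 : ℝ)..t, (ζ r : ℂ) *
        (Complex.exp (2 * Real.pi * r * θ y * Complex.I) * A y) =
        A y * ∫ r in (0 : ℝ)..t, (ζ r : ℂ) *
          Complex.exp (2 * Real.pi * r * θ y * Complex.I) := by
      rw [← intervalIntegral.integral_const_mul]
      refine intervalIntegral.integral_congr fun r _ => ?_
      ring
    rw [e, enorm_mul]
    gcongr
    rw [← ofReal_norm]
    exact ENNReal.ofReal_le_ofReal (hK _)

/-- A form with Hermitian kernel `H` and real weight `φ` has imaginary part governed by the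
differences of `φ`. -/
lemma im_integral_hermitian {H : ℝ × ℝ → ℂ} (hH : Integrable H) (hsymm : ∀ z, H z.swap = star (H z))
    {φ : ℝ → ℝ} (hφ : Measurable φ) (hφ1 : ∀ x, |φ x| ≤ 1) :
    2 * Complex.I * ((∫ z, (φ z.1 : ℂ) * H z).im : ℂ) =
      ∫ z, ((φ z.1 - φ z.2 : ℝ) : ℂ) * H z := by
  have hi : ∀ g : ℝ × ℝ → ℝ, Measurable g → Integrable fun z : ℝ × ℝ => (φ (g z) : ℂ) * H z :=
    fun g hg => hH.bdd_mul (c := 1) (by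
      have : Measurable fun z => (φ (g z) : ℂ) := by fun_prop
      exact this.aestronglyMeasurable)
      (Eventually.of_forall fun z => by rw [Complex.norm_real]; exact hφ1 _)
  have h1 : ∫ z, (φ z.2 : ℂ) * H z = star (∫ z, (φ z.1 : ℂ) * H z) := by
    have e := integral_prod_swap (μ := (volume : Measure ℝ)) (ν := (volume : Measure ℝ))
      fun z : ℝ × ℝ => (φ z.2 : ℂ) * H z
    rw [Measure.volume_eq_prod, ← e, ← starRingEnd_apply, ← integral_conj]
    refine integral_congr_ae (Eventually.of_forall fun z => ?_)
    simp only [hsymm, Prod.snd_swap, map_mul, Complex.conj_ofReal]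
    rfl
  simp only [Complex.ofReal_sub, sub_mul]
  rw [integral_sub (hi _ measurable_fst) (hi _ measurable_snd), h1]
  have := Complex.sub_conj (∫ z, (φ z.1 : ℂ) * H z)
  rw [Complex.star_def, this]
  push_cast
  ring

/-! ### The energy rate as a quartic form -/

section QuarticForm

open scoped Convolution

lemma fourierInv_convolution {f g : ℝ → ℂ} (hf : Integrable f) (hg : Integrable g) (x : ℝ) :
    𝓕⁻ (f ⋆[ContinuousLinearMap.mul ℂ ℂ] g) x = 𝓕⁻ f x * 𝓕⁻ g x := by
  simp only [Real.fourierInv_eq_fourier_neg]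
  exact Real.fourier_mul_convolution_eq hf hg _

lemma fourierInv_star_neg (V : ℝ → ℂ) (x : ℝ) :
    𝓕⁻ (fun ξ => star (V (-ξ))) x = star (𝓕⁻ V x) := by
  rw [Real.fourierInv_eq', Real.fourierInv_eq', ← integral_neg_eq_self, ← starRingEnd_apply,
    ← integral_conj]
  refine integral_congr_ae (Eventually.of_forall fun ξ => ?_)
  simp only [neg_neg, smul_eq_mul, map_mul, ← Complex.exp_conj, Complex.conj_ofReal,
    Complex.conj_I, Complex.star_def]
  congr 2
  simp

/-- The autocorrelation `∫ conj (V ξ) V (ξ + η) dξ`, the Fourier transform of `|𝓕⁻ V|²`. -/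
def autocorrelation (V : ℝ → ℂ) (η : ℝ) : ℂ := ∫ ξ, star (V ξ) * V (ξ + η)

lemma autocorrelation_eq_convolution (V : ℝ → ℂ) :
    autocorrelation V =
      (fun ξ => star (V (-ξ))) ⋆[ContinuousLinearMap.mul ℂ ℂ] V := by
  ext η
  rw [autocorrelation, convolution_def, ← integral_neg_eq_self]
  refine integral_congr_ae (Eventually.of_forall fun ξ => ?_)
  simp only [ContinuousLinearMap.mul_apply']
  congr 2
  ring

lemma integrable_star_neg {V : ℝ → ℂ} (hV : Integrable V) :
    Integrable fun ξ => star (V (-ξ)) := by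
  have h := hV.comp_neg
  exact Complex.conjLIE.integrable_comp_iff.2 h

lemma integrable_autocorrelation {V : ℝ → ℂ} (hV : Integrable V) :
    Integrable (autocorrelation V) := by
  rw [autocorrelation_eq_convolution]
  exact (integrable_star_neg hV).integrable_convolution _ hV

lemma star_autocorrelation (V : ℝ → ℂ) (η : ℝ) :
    star (autocorrelation V η) = autocorrelation V (-η) := by
  rw [autocorrelation, autocorrelation, ← starRingEnd_apply, ← integral_conj,
    ← integral_add_right_eq_self _ (-η)]
  refine integral_congr_ae (Eventually.of_forall fun ξ => ?_)
  simp [mul_comm]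

/-- The Fourier transform of `|f|² f`, for `f = 𝓕⁻ V`. -/
def cubicFourier (V : ℝ → ℂ) (ξ : ℝ) : ℂ := ∫ η, V η * autocorrelation V (ξ - η)

lemma cubicFourier_eq_convolution (V : ℝ → ℂ) :
    cubicFourier V = V ⋆[ContinuousLinearMap.mul ℂ ℂ] autocorrelation V := rfl

lemma integrable_cubicFourier {V : ℝ → ℂ} (hV : Integrable V) :
    Integrable (cubicFourier V) := by
  rw [cubicFourier_eq_convolution]
  exact hV.integrable_convolution _ (integrable_autocorrelation hV)

lemma fourierInv_cubicFourier {V : ℝ → ℂ} (hV : Integrable V) (x : ℝ) :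
    𝓕⁻ (cubicFourier V) x = cubic (𝓕⁻ V x) := by
  rw [cubicFourier_eq_convolution, fourierInv_convolution hV (integrable_autocorrelation hV),
    autocorrelation_eq_convolution, fourierInv_convolution (integrable_star_neg hV) hV,
    fourierInv_star_neg, cubic_eq]
  rfl

lemma fourier_lpClass_ae_eq {f Y : ℝ → ℂ} (hf : MemLp f 2 volume) (hY : Integrable Y)
    (h : f = 𝓕⁻ Y) : (𝓕 (lpClass f) : Lp ℂ 2 (volume : Measure ℝ)) =ᵐ[volume] Y := by
  refine fourier_ae_eq_of_eq_fourierInv _ hY ?_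
  have : (lpClass f : ℝ → ℂ) =ᵐ[volume] f := coeFn_lpClass hf
  rwa [h] at this ⊢

/-- The quartic convolution form is finite on `L¹ ∩ L²`. -/
lemma lintegral_quartic_le {z : ℝ → ℝ≥0∞} (hz : Measurable z) :
    ∫⁻ x : (ℝ × ℝ) × ℝ, z x.1.1 * z x.1.2 * (z x.2 * z (x.2 + x.1.1 - x.1.2)) ≤
      2 * (∫⁻ ξ, z ξ) ^ 2 * ∫⁻ ξ, z ξ ^ 2 := by
  rw [Measure.volume_eq_prod, lintegral_prod _ (by fun_prop)]
  have h : ∀ a : ℝ × ℝ, ∫⁻ ξ, z a.1 * z a.2 * (z ξ * z (ξ + a.1 - a.2)) ≤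
      z a.1 * z a.2 * (2 * ∫⁻ ξ, z ξ ^ 2) := by
    intro a
    rw [lintegral_const_mul _ (by fun_prop)]
    gcongr
    calc ∫⁻ ξ, z ξ * z (ξ + a.1 - a.2) ≤ ∫⁻ ξ, (z ξ ^ 2 + z (ξ + (a.1 - a.2)) ^ 2) :=
          lintegral_mono fun ξ => by
            rw [← add_sub_assoc]; exact ennreal_mul_le_add_sq _ _
      _ = (∫⁻ ξ, z ξ ^ 2) + ∫⁻ ξ, z ξ ^ 2 := by
          rw [lintegral_add_left (by fun_prop)]
          congr 1
          exact lintegral_add_right_eq_self (fun ξ => z ξ ^ 2) (a.1 - a.2)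
      _ = _ := (two_mul _).symm
  refine (lintegral_mono h).trans (le_of_eq ?_)
  rw [lintegral_mul_const _ (by fun_prop), Measure.volume_eq_prod,
    lintegral_prod_mul hz.aemeasurable hz.aemeasurable]
  ring

/-- The product `V(ξ₁) conj V(ξ₂) V(ξ₃) conj V(ξ₄)` at `x = ((ξ₄, ξ₁), ξ₂)`, where
`ξ₃ = ξ₂ + ξ₄ - ξ₁`. -/
def quarticProduct (V : ℝ → ℂ) (x : (ℝ × ℝ) × ℝ) : ℂ :=
  V x.1.2 * star (V x.2) * (V (x.2 + x.1.1 - x.1.2) * star (V x.1.1))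

lemma integrable_quarticProduct {V : ℝ → ℂ} (hm : Measurable V) (h1 : ∫⁻ ξ, ‖V ξ‖ₑ < ∞)
    (h2 : ∫⁻ ξ, ‖V ξ‖ₑ ^ 2 < ∞) : Integrable (quarticProduct V) := by
  have hstar : Measurable fun ξ => star (V ξ) :=
    (continuous_star (R := ℂ)).measurable.comp hm
  refine ⟨?_, ?_⟩
  · unfold quarticProduct
    have : Measurable fun x : (ℝ × ℝ) × ℝ =>
        V x.1.2 * star (V x.2) * (V (x.2 + x.1.1 - x.1.2) * star (V x.1.1)) := by fun_prop
    exact this.aestronglyMeasurable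
  · rw [HasFiniteIntegral]
    refine lt_of_le_of_lt (le_of_eq (lintegral_congr fun x => ?_))
      ((lintegral_quartic_le (z := fun ξ => ‖V ξ‖ₑ) hm.enorm).trans_lt
        (ENNReal.mul_lt_top (ENNReal.mul_lt_top (by norm_num) (ENNReal.pow_lt_top h1)) h2))
    have hs : ∀ z : ℂ, ‖star z‖ₑ = ‖z‖ₑ := fun z => by
      rw [← ofReal_norm, ← ofReal_norm, norm_star]
    simp only [quarticProduct, enorm_mul, hs]
    ring

/-- The energy rate of `f = 𝓕⁻ V` as a quartic form with the antisymmetrized symbol. -/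
lemma energyRate_eq_integral_quarticProduct {s : ℝ} (hs : s ≤ 0) {f V : ℝ → ℂ} (hm : Measurable V)
    (h1 : ∫⁻ ξ, ‖V ξ‖ₑ < ∞) (h2 : ∫⁻ ξ, ‖V ξ‖ₑ ^ 2 < ∞) (hf : MemLp f 2 volume)
    (hc : MemLp (fun x => cubic (f x)) 2 volume) (hfV : f = 𝓕⁻ V) :
    2 * Complex.I * (energyRate s f : ℂ) =
      ∫ x : (ℝ × ℝ) × ℝ, ((sobolevWeight s x.1.1 ^ 2 - sobolevWeight s x.1.2 ^ 2 : ℝ) : ℂ) *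
        quarticProduct V x := by
  have hV : Integrable V := ⟨hm.aestronglyMeasurable, h1⟩
  have e1 := fourier_lpClass_ae_eq hf hV hfV
  have e2 := fourier_lpClass_ae_eq hc (integrable_cubicFourier hV)
    (funext fun x => by rw [fourierInv_cubicFourier hV, hfV])
  have hQ := integrable_quarticProduct hm h1 h2
  set φ : ℝ → ℝ := fun ξ => sobolevWeight s ξ ^ 2 with hφ
  have hφm : Measurable φ := (measurable_sobolevWeight s).pow_const 2
  have hφ1 : ∀ ξ, |φ ξ| ≤ 1 := fun ξ => by
    rw [abs_of_nonneg (sq_nonneg _)]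
    exact pow_le_one₀ (sobolevWeight_pos s ξ).le (sobolevWeight_le_one hs ξ)
  set H : ℝ × ℝ → ℂ := fun z => V z.2 * star (V z.1) * autocorrelation V (z.1 - z.2) with hH
  have hHQ : ∀ z, H z = ∫ ξ, quarticProduct V (z, ξ) := by
    intro z
    simp only [hH, autocorrelation, quarticProduct]
    rw [← integral_const_mul]
    refine integral_congr_ae (Eventually.of_forall fun ξ => ?_)
    simp only [add_sub_assoc]
    ring
  have hHi : Integrable H := by
    have h := hQ.integral_prod_left
    exact h.congr (Eventually.of_forall fun z => (hHQ z).symm)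
  have hsymm : ∀ z, H z.swap = star (H z) := by
    intro z
    simp only [hH, Prod.fst_swap, Prod.snd_swap, star_mul', star_star, star_autocorrelation,
      neg_sub]
    ring
  have hφH : ∀ g : ℝ × ℝ → ℝ, Measurable g → (∀ z, |g z| ≤ 1) →
      Integrable fun z : ℝ × ℝ => (g z : ℂ) * H z :=
    fun g hg hg1 => hHi.bdd_mul (c := 1) (by
      have : Measurable fun z => (g z : ℂ) := by fun_prop
      exact this.aestronglyMeasurable)
      (Eventually.of_forall fun z => by rw [Complex.norm_real]; exact hg1 _)
  have hi := hφH (fun z => φ z.1) (by fun_prop) (fun z => hφ1 _)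
  have hinner : ∀ v, ∫ η : ℝ, (φ v : ℂ) * H (v, η) =
      (φ v : ℂ) * (star (V v) * cubicFourier V v) := by
    intro v
    have h : star (V v) * cubicFourier V v = ∫ η : ℝ, H (v, η) := by
      rw [cubicFourier, ← integral_const_mul]
      refine integral_congr_ae (Eventually.of_forall fun η => ?_)
      simp only [hH]
      ring
    rw [integral_const_mul, h]
  have hE : energyRate s f = (∫ z, (φ z.1 : ℂ) * H z).im := by
    rw [Measure.volume_eq_prod, integral_prod _ hi]
    have hi' := hi.integral_prod_left
    have := Complex.imCLM.integral_comp_comm hi'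
    simp only [Complex.imCLM_apply] at this
    rw [← this, energyRate]
    refine integral_congr_ae ?_
    filter_upwards [e1, e2] with v hv1 hv2
    rw [hv1, hv2, hinner]
    rfl
  rw [hE, im_integral_hermitian hHi hsymm hφm hφ1]
  have hb : ∀ z : ℝ × ℝ, |φ z.1 - φ z.2| ≤ 1 := fun z => by
    have a1 := hφ1 z.1
    have a2 := hφ1 z.2
    have b1 : 0 ≤ φ z.1 := sq_nonneg _
    have b2 : 0 ≤ φ z.2 := sq_nonneg _
    rw [abs_le] at *
    constructor <;> linarith
  have hfull : Integrable fun x : (ℝ × ℝ) × ℝ => ((φ x.1.1 - φ x.1.2 : ℝ) : ℂ) *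
      quarticProduct V x :=
    hQ.bdd_mul (c := 1) (by
      have : Measurable fun x : (ℝ × ℝ) × ℝ => ((φ x.1.1 - φ x.1.2 : ℝ) : ℂ) := by fun_prop
      exact this.aestronglyMeasurable)
      (Eventually.of_forall fun x => by rw [Complex.norm_real]; exact hb x.1)
  rw [Measure.volume_eq_prod (ℝ × ℝ) ℝ, integral_prod _ hfull]
  refine integral_congr_ae (Eventually.of_forall fun z => ?_)
  simp only
  rw [integral_const_mul, hHQ]

end QuarticForm

/-! ### The quartic form as a superposition of oscillations -/

section Superposition

/-- The points `(((ξ₄, ξ₁), ξ₂), (τ₁, τ₂), (τ₄, τ₃))` parametrizing the quartic form; the third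
frequency is `ξ₃ = ξ₂ + ξ₄ - ξ₁`. -/
abbrev QuarticSpace : Type := ((ℝ × ℝ) × ℝ) × ((ℝ × ℝ) × (ℝ × ℝ))

lemma lintegral_quarticSpace {f : QuarticSpace → ℝ≥0∞} (hf : Measurable f) :
    ∫⁻ y, f y = ∫⁻ ξ₁, ∫⁻ ξ₂, ∫⁻ ξ₄, ∫⁻ p : ℝ × ℝ, ∫⁻ q : ℝ × ℝ, f (((ξ₄, ξ₁), ξ₂), (p, q)) := by
  obtain ⟨g, hg⟩ : ∃ g : (ℝ × ℝ) × ℝ → ℝ≥0∞,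
      g = fun x => ∫⁻ z : (ℝ × ℝ) × (ℝ × ℝ), f (x, z) := ⟨_, rfl⟩
  have hgm : Measurable g := by rw [hg]; exact hf.lintegral_prod_right'
  have hg' : ∀ x, g x = ∫⁻ p : ℝ × ℝ, ∫⁻ q : ℝ × ℝ, f (x, (p, q)) := by
    intro x
    rw [hg, Measure.volume_eq_prod (ℝ × ℝ) (ℝ × ℝ)]
    exact lintegral_prod _ (hf.comp measurable_prodMk_left).aemeasurable
  have h1 : ∫⁻ y, f y = ∫⁻ x, g x := by
    rw [hg, Measure.volume_eq_prod]
    exact lintegral_prod _ hf.aemeasurable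
  have h2 : ∫⁻ x, g x = ∫⁻ ξ₄, ∫⁻ ξ₁, ∫⁻ ξ₂, g ((ξ₄, ξ₁), ξ₂) := by
    rw [Measure.volume_eq_prod, lintegral_prod _ hgm.aemeasurable, Measure.volume_eq_prod,
      lintegral_prod _ hgm.lintegral_prod_right'.aemeasurable]
  simp only [← hg']
  rw [h1, h2, lintegral_lintegral_swap]
  · refine lintegral_congr fun ξ₁ => lintegral_lintegral_swap ?_
    have : Measurable fun z : ℝ × ℝ => g ((z.1, ξ₁), z.2) := by fun_prop
    exact this.aemeasurable
  · have : Measurable fun z : ℝ × ℝ => ∫⁻ ξ₂, g (z, ξ₂) := hgm.lintegral_prod_right'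
    exact this.aemeasurable

/-- The amplitude of the quartic form: the antisymmetrized symbol times
`W(ξ₁, τ₁) conj W(ξ₂, τ₂) W(ξ₃, τ₃) conj W(ξ₄, τ₄)`. -/
def quarticAmplitude (s : ℝ) (W : ℝ → ℝ → ℂ) (y : QuarticSpace) : ℂ :=
  ((sobolevWeight s y.1.1.1 ^ 2 - sobolevWeight s y.1.1.2 ^ 2 : ℝ) : ℂ) *
    (W y.1.1.2 y.2.1.1 * star (W y.1.2 y.2.1.2) *
      (W (y.1.2 + y.1.1.1 - y.1.1.2) y.2.2.2 * star (W y.1.1.1 y.2.2.1)))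

/-- The time frequency `τ₁ - τ₂ + τ₃ - τ₄` of the quartic form. -/
def timeGap (y : QuarticSpace) : ℝ := (y.2.1.1 - y.2.1.2) - (y.2.2.1 - y.2.2.2)

lemma measurable_timeGap : Measurable timeGap := by
  unfold timeGap; fun_prop

lemma measurable_quarticAmplitude (s : ℝ) {W : ℝ → ℝ → ℂ} (hW : Measurable (Function.uncurry W)) :
    Measurable (quarticAmplitude s W) := by
  have h1 := measurable_sobolevWeight s
  have hstar : Measurable fun z : ℝ × ℝ => star (W z.1 z.2) :=
    (continuous_star (R := ℂ)).measurable.comp hW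
  obtain ⟨W', hW'⟩ : ∃ W' : ℝ → ℝ → ℂ, W' = fun ξ τ => star (W ξ τ) := ⟨_, rfl⟩
  have hm : Measurable (Function.uncurry W') := by rw [hW']; exact hstar
  have e : quarticAmplitude s W = fun y : QuarticSpace =>
      ((sobolevWeight s y.1.1.1 ^ 2 - sobolevWeight s y.1.1.2 ^ 2 : ℝ) : ℂ) *
      (W y.1.1.2 y.2.1.1 * W' y.1.2 y.2.1.2 *
      (W (y.1.2 + y.1.1.1 - y.1.1.2) y.2.2.2 * W' y.1.1.1 y.2.2.1)) := by
    rw [hW']; rfl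
  rw [e]
  fun_prop

lemma enorm_quarticAmplitude (s : ℝ) (W : ℝ → ℝ → ℂ) (y : QuarticSpace) :
    ‖quarticAmplitude s W y‖ₑ =
      ENNReal.ofReal |sobolevWeight s y.1.1.1 ^ 2 - sobolevWeight s y.1.1.2 ^ 2| *
      (‖W y.1.1.2 y.2.1.1‖ₑ * ‖W y.1.2 y.2.1.2‖ₑ * ‖W (y.1.2 + y.1.1.1 - y.1.1.2) y.2.2.2‖ₑ *
        ‖W y.1.1.1 y.2.2.1‖ₑ) := by
  have hs : ∀ z : ℂ, ‖star z‖ₑ = ‖z‖ₑ := fun z => by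
    rw [← ofReal_norm, ← ofReal_norm, norm_star]
  have hr : ∀ x : ℝ, ‖(x : ℂ)‖ₑ = ENNReal.ofReal |x| := fun x => by
    rw [← ofReal_norm, Complex.norm_real, Real.norm_eq_abs]
  simp only [quarticAmplitude, enorm_mul, hs, hr]
  ring

lemma abs_sobolevWeight_sub_le {s : ℝ} (hs : s ≤ 0) (x y : ℝ) :
    |sobolevWeight s x ^ 2 - sobolevWeight s y ^ 2| ≤ 1 := by
  have h : ∀ x, sobolevWeight s x ^ 2 ≤ 1 := fun x =>
    pow_le_one₀ (sobolevWeight_pos s x).le (sobolevWeight_le_one hs x)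
  rw [abs_le]
  constructor <;> linarith [h x, h y, sq_nonneg (sobolevWeight s x), sq_nonneg (sobolevWeight s y)]

lemma integrable_quarticAmplitude {s : ℝ} (hs : s ≤ 0) {W : ℝ → ℝ → ℂ}
    (hW : Measurable (Function.uncurry W)) (h1 : ∫⁻ ξ, ∫⁻ τ, ‖W ξ τ‖ₑ < ∞)
    (h2 : ∫⁻ ξ, (∫⁻ τ, ‖W ξ τ‖ₑ) ^ 2 < ∞) : Integrable (quarticAmplitude s W) := by
  have hm := measurable_quarticAmplitude s hW
  refine ⟨hm.aestronglyMeasurable, ?_⟩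
  obtain ⟨w, hw⟩ : ∃ w : ℝ → ℝ → ℝ≥0∞, w = fun ξ τ => ‖W ξ τ‖ₑ := ⟨_, rfl⟩
  have hwm : Measurable (Function.uncurry w) := by rw [hw]; exact Measurable.enorm hW
  obtain ⟨z, hz⟩ : ∃ z : ℝ → ℝ≥0∞, z = fun ξ => ∫⁻ τ, w ξ τ := ⟨_, rfl⟩
  have hzm : Measurable z := by rw [hz]; fun_prop
  rw [HasFiniteIntegral, Measure.volume_eq_prod, lintegral_prod _ (by fun_prop)]
  have hle : ∀ x : (ℝ × ℝ) × ℝ, ∫⁻ y : (ℝ × ℝ) × (ℝ × ℝ), ‖quarticAmplitude s W (x, y)‖ₑ ≤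
      z x.1.1 * z x.1.2 * (z x.2 * z (x.2 + x.1.1 - x.1.2)) := by
    intro x
    calc ∫⁻ y : (ℝ × ℝ) × (ℝ × ℝ), ‖quarticAmplitude s W (x, y)‖ₑ
        ≤ ∫⁻ y : (ℝ × ℝ) × (ℝ × ℝ), (w x.1.2 y.1.1 * w x.2 y.1.2) *
          (w x.1.1 y.2.1 * w (x.2 + x.1.1 - x.1.2) y.2.2) := by
          refine lintegral_mono fun y => ?_
          rw [enorm_quarticAmplitude, hw]
          refine (mul_le_of_le_one_left' (ENNReal.ofReal_le_one.2
            (abs_sobolevWeight_sub_le hs _ _))).trans (le_of_eq ?_)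
          ring
      _ = (z x.1.2 * z x.2) * (z x.1.1 * z (x.2 + x.1.1 - x.1.2)) := by
          rw [Measure.volume_eq_prod (ℝ × ℝ) (ℝ × ℝ),
            lintegral_prod_mul (f := fun p : ℝ × ℝ => w x.1.2 p.1 * w x.2 p.2)
              (g := fun q : ℝ × ℝ => w x.1.1 q.1 * w (x.2 + x.1.1 - x.1.2) q.2) (by fun_prop)
              (by fun_prop), Measure.volume_eq_prod, lintegral_prod_mul (by fun_prop) (by fun_prop),
            lintegral_prod_mul (by fun_prop) (by fun_prop), hz]
      _ = _ := by ring
  refine (lintegral_mono hle).trans_lt ((lintegral_quartic_le hzm).trans_lt ?_)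
  simp only [hw] at hz
  rw [hz]
  exact ENNReal.mul_lt_top (ENNReal.mul_lt_top (by norm_num) (ENNReal.pow_lt_top h1)) h2

lemma star_timeSlice (W : ℝ → ℝ → ℂ) (t ξ : ℝ) :
    star (timeSlice W t ξ) =
      ∫ τ : ℝ, Complex.exp (-(2 * Real.pi * t * τ * Complex.I)) * star (W ξ τ) := by
  rw [timeSlice, ← starRingEnd_apply, ← integral_conj]
  refine integral_congr_ae (Eventually.of_forall fun τ => ?_)
  simp only [map_mul, ← Complex.exp_conj, Complex.conj_ofReal, Complex.conj_I, map_ofNat]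
  congr 2
  ring

/-- The quartic form of the slice at time `t` is a superposition of the oscillations
`e^{2πi t (τ₁ - τ₂ + τ₃ - τ₄)}`. -/
lemma integral_quarticAmplitude {s : ℝ} (hs : s ≤ 0) {W : ℝ → ℝ → ℂ}
    (hW : Measurable (Function.uncurry W)) (h1 : ∫⁻ ξ, ∫⁻ τ, ‖W ξ τ‖ₑ < ∞)
    (h2 : ∫⁻ ξ, (∫⁻ τ, ‖W ξ τ‖ₑ) ^ 2 < ∞) (t : ℝ) :
    ∫ y, Complex.exp (2 * Real.pi * t * timeGap y * Complex.I) * quarticAmplitude s W y =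
      ∫ x : (ℝ × ℝ) × ℝ, ((sobolevWeight s x.1.1 ^ 2 - sobolevWeight s x.1.2 ^ 2 : ℝ) : ℂ) *
        quarticProduct (timeSlice W t) x := by
  have hA := integrable_quarticAmplitude hs hW h1 h2
  have hi : Integrable fun y =>
      Complex.exp (2 * Real.pi * t * timeGap y * Complex.I) * quarticAmplitude s W y := by
    have hm : Measurable fun y => Complex.exp (2 * Real.pi * t * timeGap y * Complex.I) := by
      have := measurable_timeGap
      fun_prop
    exact hA.bdd_mul (c := 1) hm.aestronglyMeasurable
      (Eventually.of_forall fun y => (norm_exp_two_pi _ _).le)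
  rw [Measure.volume_eq_prod, integral_prod _ hi]
  refine integral_congr_ae (Eventually.of_forall fun x => ?_)
  simp only
  set e : ℝ → ℂ := fun τ => Complex.exp (2 * Real.pi * t * τ * Complex.I) with he
  set e' : ℝ → ℂ := fun τ => Complex.exp (-(2 * Real.pi * t * τ * Complex.I)) with he'
  have hpt : ∀ y : (ℝ × ℝ) × (ℝ × ℝ),
      Complex.exp (2 * Real.pi * t * timeGap (x, y) * Complex.I) * quarticAmplitude s W (x, y) =
      ((sobolevWeight s x.1.1 ^ 2 - sobolevWeight s x.1.2 ^ 2 : ℝ) : ℂ) *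
      (((e y.1.1 * W x.1.2 y.1.1) * (e' y.1.2 * star (W x.2 y.1.2))) *
        ((e' y.2.1 * star (W x.1.1 y.2.1)) * (e y.2.2 * W (x.2 + x.1.1 - x.1.2) y.2.2))) := by
    intro y
    have hexp : Complex.exp (2 * Real.pi * t * timeGap (x, y) * Complex.I) =
        e y.1.1 * e' y.1.2 * (e' y.2.1 * e y.2.2) := by
      simp only [he, he', ← Complex.exp_add, timeGap]
      congr 1
      push_cast
      ring
    rw [hexp, quarticAmplitude]
    ring
  simp only [hpt]
  rw [integral_const_mul, Measure.volume_eq_prod (ℝ × ℝ) (ℝ × ℝ),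
    integral_prod_mul (fun p : ℝ × ℝ => (e p.1 * W x.1.2 p.1) * (e' p.2 * star (W x.2 p.2)))
      (fun q : ℝ × ℝ => (e' q.1 * star (W x.1.1 q.1)) * (e q.2 * W (x.2 + x.1.1 - x.1.2) q.2)),
    Measure.volume_eq_prod,
    integral_prod_mul (fun a => e a * W x.1.2 a) (fun a => e' a * star (W x.2 a)),
    integral_prod_mul (fun a => e' a * star (W x.1.1 a))
      (fun a => e a * W (x.2 + x.1.1 - x.1.2) a)]
  have hs1 : ∀ ξ, timeSlice W t ξ = ∫ τ, e τ * W ξ τ := fun ξ => rfl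
  have hs2 : ∀ ξ, star (timeSlice W t ξ) = ∫ τ, e' τ * star (W ξ τ) := star_timeSlice W t
  rw [quarticProduct, hs2, hs2, hs1, hs1]
  ring

variable {T ω : ℝ} {ζ₀ ζ₁ : ℝ → ℝ} {u₀ : ℝ → ℂ} {u : ℝ → ℝ → ℂ}

/-- Wherever the cut-off `ζ₀` does not vanish, `ζ₁ u = u`, so the energy rate of `u` is the quartic
form in the space-time Fourier transform of `ζ₁ u`. -/
lemma IsSmoothSolution.cutoff_mul_energyRate (hu : IsSmoothSolution T ω ζ₀ u₀ u)
    (hζ : IsCutoffPair T ζ₀ ζ₁) {s : ℝ} (hs : s ≤ 0) {W : ℝ → ℝ → ℂ}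
    (hW : Measurable (Function.uncurry W)) (i1 : ∫⁻ ξ, ∫⁻ τ, ‖W ξ τ‖ₑ < ∞)
    (i2 : ∫⁻ ξ, (∫⁻ τ, ‖W ξ τ‖ₑ) ^ 2 < ∞)
    (hWu : ∀ t, (fun x => (ζ₁ t : ℂ) * u t x) = 𝓕⁻ (timeSlice W t)) (t : ℝ) :
    2 * Complex.I * ((ζ₀ t * energyRate s (u t) : ℝ) : ℂ) = (ζ₀ t : ℂ) *
      ∫ y, Complex.exp (2 * Real.pi * t * timeGap y * Complex.I) * quarticAmplitude s W y := by
  by_cases ht : ζ₀ t = 0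
  · simp [ht]
  have h1 : ζ₁ t = 1 := mul_right_cancel₀ ht ((hζ.mul_eq t).trans (one_mul _).symm)
  have htm : t ∈ Icc (-2 * T) (2 * T) :=
    Ioo_subset_Icc_self (hζ.supp_zero (subset_tsupport _ ht))
  have hV : u t = 𝓕⁻ (timeSlice W t) := by
    rw [← hWu t, h1]
    simp
  have hVm : Measurable (timeSlice W t) := measurable_timeSlice hW t
  have hle : ∀ ξ, ‖timeSlice W t ξ‖ₑ ≤ ∫⁻ τ, ‖W ξ τ‖ₑ := enorm_timeSlice_le W t
  have hV1 : ∫⁻ ξ, ‖timeSlice W t ξ‖ₑ < ∞ := (lintegral_mono hle).trans_lt i1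
  have hV2 : ∫⁻ ξ, ‖timeSlice W t ξ‖ₑ ^ 2 < ∞ :=
    (lintegral_mono fun ξ => pow_le_pow_left' (hle ξ) 2).trans_lt i2
  rw [integral_quarticAmplitude hs hW i1 i2 t,
    ← energyRate_eq_integral_quarticProduct hs hVm hV1 hV2 (hu.memLp htm) (hu.memLp_cubic htm) hV]
  push_cast
  ring

end Superposition

/-! ### The energy estimate -/

section Energy

variable {T ω : ℝ} {ζ₀ ζ₁ : ℝ → ℝ} {u₀ : ℝ → ℂ} {u : ℝ → ℝ → ℂ}

lemma IsSmoothSolution.supSobolevNorm_ne_top (hu : IsSmoothSolution T ω ζ₀ u₀ u) {s : ℝ}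
    (hs : s ≤ 10) : supSobolevNorm (Icc (-2 * T) (2 * T)) s u ≠ ∞ := by
  obtain ⟨K, hK, hle⟩ := exists_sobolevNorm_le isCompact_Icc hu.continuous_sobolev
  exact ne_top_of_le_ne_top hK (iSup₂_le fun t ht => (sobolevNorm_mono hs).trans (hle t ht))

/-- A bound on the change of the energy since the time `t₀`, uniform in time, is inherited by the
supremum. -/
lemma abs_supSobolevNorm_sub_le {I : Set ℝ} {s : ℝ} {t₀ : ℝ} (ht₀ : t₀ ∈ I)
    (hfin : supSobolevNorm I s u ≠ ∞) {D : ℝ≥0∞}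
    (hD : ∀ t ∈ I, ENNReal.ofReal
      |(sobolevNorm s (u t)).toReal ^ 2 - (sobolevNorm s (u t₀)).toReal ^ 2| ≤ D) :
    ENNReal.ofReal |(supSobolevNorm I s u).toReal ^ 2 - (sobolevNorm s (u t₀)).toReal ^ 2| ≤ D := by
  rcases eq_or_ne D ∞ with rfl | hDtop
  · exact le_top
  have hle : ∀ t ∈ I, sobolevNorm s (u t) ≤ supSobolevNorm I s u := fun t ht =>
    le_iSup₂ (f := fun t (_ : t ∈ I) => sobolevNorm s (u t)) t ht
  set a := (sobolevNorm s (u t₀)).toReal with ha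
  have h1 : a ≤ (supSobolevNorm I s u).toReal := ENNReal.toReal_mono hfin (hle t₀ ht₀)
  have ha0 : 0 ≤ a := ENNReal.toReal_nonneg
  have h2 : supSobolevNorm I s u ≤ ENNReal.ofReal (Real.sqrt (a ^ 2 + D.toReal)) := by
    refine iSup₂_le fun t ht => ?_
    rw [← ENNReal.ofReal_toReal (ne_top_of_le_ne_top hfin (hle t ht))]
    refine ENNReal.ofReal_le_ofReal (Real.le_sqrt_of_sq_le ?_)
    have := (ENNReal.ofReal_le_iff_le_toReal hDtop).1 (hD t ht)
    linarith [(abs_le.1 this).2]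
  have h3 : (supSobolevNorm I s u).toReal ^ 2 ≤ a ^ 2 + D.toReal := by
    have hD0 : 0 ≤ D.toReal := ENNReal.toReal_nonneg
    have := ENNReal.toReal_mono ENNReal.ofReal_ne_top h2
    rw [ENNReal.toReal_ofReal (Real.sqrt_nonneg _)] at this
    calc _ ≤ Real.sqrt (a ^ 2 + D.toReal) ^ 2 := by gcongr
      _ = _ := Real.sq_sqrt (by positivity)
  rw [ENNReal.ofReal_le_iff_le_toReal hDtop, abs_of_nonneg (by nlinarith)]
  linarith

/-- The change of the `H^s` energy is bounded by the quartic form weighted by the time decay. -/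
lemma IsSmoothSolution.energy_sub_le (hu : IsSmoothSolution T ω ζ₀ u₀ u)
    (hζ : IsCutoffPair T ζ₀ ζ₁) (hT : 0 < T) (hω : ω = 1 ∨ ω = -1) {s M L : ℝ} (hs : s ≤ 0)
    (hM : ∫ t, |deriv ζ₀ t| ≤ M) (hL : 2 * T ≤ L) {W : ℝ → ℝ → ℂ}
    (hW : Measurable (Function.uncurry W)) (i1 : ∫⁻ ξ, ∫⁻ τ, ‖W ξ τ‖ₑ < ∞)
    (i2 : ∫⁻ ξ, (∫⁻ τ, ‖W ξ τ‖ₑ) ^ 2 < ∞)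
    (hWu : ∀ t, (fun x => (ζ₁ t : ℂ) * u t x) = 𝓕⁻ (timeSlice W t)) {t : ℝ}
    (ht : t ∈ Icc (-2 * T) (2 * T)) :
    ENNReal.ofReal |(sobolevNorm s (u t)).toReal ^ 2 - (sobolevNorm s u₀).toReal ^ 2| ≤
      ENNReal.ofReal (2 * Real.pi) * (ENNReal.ofReal ((L + 3) * M) *
        ∫⁻ y, ‖quarticAmplitude s W y‖ₑ * ENNReal.ofReal (timeDecay (timeGap y))) := by
  have hζc : ContDiff ℝ 1 ζ₀ := hζ.smooth_zero.of_le (by exact_mod_cast le_top)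
  have hcs : HasCompactSupport ζ₀ :=
    HasCompactSupport.of_support_subset_isCompact isCompact_Icc
      ((subset_tsupport ζ₀).trans (hζ.supp_zero.trans Ioo_subset_Icc_self))
  have hM0 : 0 ≤ M := (integral_nonneg fun t => abs_nonneg _).trans hM
  have htL : |t| ≤ L := (abs_le.2 ⟨by linarith [ht.1], ht.2⟩ : |t| ≤ 2 * T).trans hL
  have hA := integrable_quarticAmplitude hs hW i1 i2
  obtain ⟨hint, hle⟩ := integral_superposition_le hA measurable_timeGap hζc.continuous
    (norm_integral_mul_exp_le hζc hcs hM htL)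
  have hrate := fun r => hu.cutoff_mul_energyRate hζ hs hW i1 i2 hWu r
  simp only [← hrate] at hint hle
  have hre : IntervalIntegrable (fun r => ζ₀ r * energyRate s (u r)) volume 0 t := by
    have h := hint.const_mul (2 * Complex.I)⁻¹
    have e : ∀ r, (2 * Complex.I)⁻¹ * (2 * Complex.I * ((ζ₀ r * energyRate s (u r) : ℝ) : ℂ)) =
        ((ζ₀ r * energyRate s (u r) : ℝ) : ℂ) := fun r =>
      inv_mul_cancel_left₀ (by simp) _
    simp only [e] at h
    exact ⟨h.1.re, h.2.re⟩
  rw [hu.energy_sub hζc.continuous hs hT ht hre]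
  rw [intervalIntegral.integral_const_mul, intervalIntegral.integral_ofReal, enorm_mul] at hle
  set I := ∫ r in (0 : ℝ)..t, ζ₀ r * energyRate s (u r) with hI
  have e1 : ENNReal.ofReal |(-(4 * Real.pi * ω)) * I| =
      ENNReal.ofReal (2 * Real.pi) * (‖2 * Complex.I‖ₑ * ‖(I : ℂ)‖ₑ) := by
    have hω1 : |ω| = 1 := by rcases hω with rfl | rfl <;> simp
    have n1 : ‖2 * Complex.I‖ₑ = ENNReal.ofReal 2 := by rw [← ofReal_norm]; simp
    have n2 : ‖(I : ℂ)‖ₑ = ENNReal.ofReal |I| := by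
      rw [← ofReal_norm, Complex.norm_real, Real.norm_eq_abs]
    rw [n1, n2, ← ENNReal.ofReal_mul (by norm_num), ← ENNReal.ofReal_mul (by positivity)]
    congr 1
    rw [abs_mul, abs_neg, abs_mul, hω1, abs_of_pos (by positivity)]
    ring
  rw [e1]
  refine mul_le_mul_right (hle.trans (le_of_eq ?_)) _
  rw [← lintegral_const_mul' _ _ ENNReal.ofReal_ne_top]
  refine lintegral_congr fun y => ?_
  have hL0 : 0 ≤ (L + 3) * M := mul_nonneg (by linarith) hM0
  rw [ENNReal.ofReal_mul hL0]
  ring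

lemma lintegral_quarticAmplitude {s : ℝ} {W : ℝ → ℝ → ℂ} (hW : Measurable (Function.uncurry W)) :
    ∫⁻ y, ‖quarticAmplitude s W y‖ₑ * ENNReal.ofReal (timeDecay (timeGap y)) =
      ∫⁻ ξ₁, ∫⁻ ξ₂, ∫⁻ ξ₄, ∫⁻ p : ℝ × ℝ, ∫⁻ q : ℝ × ℝ,
        ENNReal.ofReal |sobolevWeight s ξ₄ ^ 2 - sobolevWeight s ξ₁ ^ 2| *
        (‖W ξ₁ p.1‖ₑ * ‖W ξ₂ p.2‖ₑ * ‖W (ξ₂ + ξ₄ - ξ₁) q.2‖ₑ * ‖W ξ₄ q.1‖ₑ) *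
        ENNReal.ofReal (timeDecay ((p.1 - p.2) - (q.1 - q.2))) := by
  have hm := measurable_quarticAmplitude s hW
  have hg := measurable_timeDecay.comp measurable_timeGap
  have hm' : Measurable fun y =>
      ‖quarticAmplitude s W y‖ₑ * ENNReal.ofReal (timeDecay (timeGap y)) :=
    hm.enorm.mul (ENNReal.measurable_ofReal.comp hg)
  rw [lintegral_quarticSpace hm']
  simp only [enorm_quarticAmplitude, timeGap]

end Energy

end NLS

end

theorem proposition3p1 (T₀ M s r b : ℝ) (hs : s ∈ Set.Ioo (-1 / 2 : ℝ) 0)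
    (hr : -1 / 4 < r) (hb : 1 / 2 < b) :
    ∃ C : NNReal, ∀ T : ℝ, 0 < T → T ≤ T₀ →
      ∀ ζ₀ ζ₁ : ℝ → ℝ, NLS.IsCutoffPair T ζ₀ ζ₁ → (∫ t, |deriv ζ₀ t|) ≤ M →
      ∀ ω : ℝ, (ω = 1 ∨ ω = -1) →
      ∀ (u₀ : ℝ → ℂ) (u : ℝ → ℝ → ℂ), NLS.IsSmoothSolution T ω ζ₀ u₀ u →
        NLS.supSobolevNorm (Set.Icc (-2 * T) (2 * T)) s u ≠ ⊤ ∧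
        NLS.sobolevNorm s u₀ ≠ ⊤ ∧
        ∀ κ : ℝ, (κ = 1 ∨ κ = -1) →
          ENNReal.ofReal
            |(NLS.supSobolevNorm (Set.Icc (-2 * T) (2 * T)) s u).toReal ^ 2
              - (NLS.sobolevNorm s u₀).toReal ^ 2|
          ≤ (C : ENNReal) * NLS.bourgainNorm κ r b (fun t x => (ζ₁ t : ℂ) * u t x) ^ 4 := by
  obtain ⟨B, hB, hquartic⟩ := NLS.quartic_le hs hr hb
  refine ⟨(ENNReal.ofReal (2 * Real.pi) * (ENNReal.ofReal ((2 * T₀ + 3) * M) * B)).toNNReal, ?_⟩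
  intro T hT hT₀ ζ₀ ζ₁ hζ hM ω hω u₀ u hu
  have h0 : (0 : ℝ) ∈ Icc (-2 * T) (2 * T) := ⟨by linarith, by linarith⟩
  have hfin := hu.supSobolevNorm_ne_top (s := s) (by linarith [hs.2])
  refine ⟨hfin, ?_, fun κ hκ => ?_⟩
  · rw [← hu.initial]
    exact ne_top_of_le_ne_top hfin
      (le_iSup₂ (f := fun t (_ : t ∈ Icc (-2 * T) (2 * T)) => NLS.sobolevNorm s (u t)) 0 h0)
  have hκ2 : κ ^ 2 = 1 := by rcases hκ with rfl | rfl <;> norm_num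
  rw [ENNReal.coe_toNNReal (by finiteness), ← hu.initial]
  refine NLS.abs_supSobolevNorm_sub_le h0 hfin fun t ht => ?_
  rw [hu.initial]
  have hw := hu.memLp_cutoff hζ
  obtain ⟨i1, i2⟩ := hu.lintegral_spaceTimeFourier_lt_top hζ
  have hWu := hu.eq_fourierInv_timeSlice hζ
  have hWm := NLS.measurable_spaceTimeFourier hw
  have hX := NLS.bourgainNorm_sq κ r b hw
  obtain ⟨W, hW⟩ : ∃ W : ℝ → ℝ → ℂ, W = NLS.spaceTimeFourier _ hw := ⟨_, rfl⟩
  rw [← hW] at i1 i2 hWu hWm hX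
  refine (hu.energy_sub_le hζ hT hω hs.2.le hM (by linarith : 2 * T ≤ 2 * T₀) hWm i1 i2 hWu
    ht).trans ?_
  rw [NLS.lintegral_quarticAmplitude hWm]
  have hq := hquartic κ hκ2 (fun ξ τ => ‖W ξ τ‖ₑ) (Measurable.enorm hWm)
  set X := ∫⁻ ξ, ∫⁻ τ, ‖W ξ τ‖ₑ ^ 2 * ENNReal.ofReal
    (NLS.bracket (2 * Real.pi * τ - κ * (2 * Real.pi * ξ) ^ 2) ^ (2 * b) *
      NLS.bracket (2 * Real.pi * ξ) ^ (2 * r)) with hXdef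
  set N := NLS.bourgainNorm κ r b (fun t x => (ζ₁ t : ℂ) * u t x) with hN
  have hXN : X ≤ N ^ 2 := by
    rw [hX]
    refine le_mul_of_one_le_left' ?_
    rw [ENNReal.one_le_ofReal]
    nlinarith [Real.pi_gt_three]
  calc _ ≤ ENNReal.ofReal (2 * Real.pi) * (ENNReal.ofReal ((2 * T₀ + 3) * M) * (B * X ^ 2)) := by
        gcongr
    _ ≤ ENNReal.ofReal (2 * Real.pi) *
        (ENNReal.ofReal ((2 * T₀ + 3) * M) * (B * (N ^ 2) ^ 2)) := by gcongr
    _ = _ := by ring
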